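/- Let $(\mathbf M,\mathbf g)$ be a smooth (Hausdorff, second countable) four-dimensional Lorentzian manifold of signature $(-,+,+,+)$, foliated by the space-like level hypersurfaces $\Sigma_t$ of a smooth time function $t$, with future unit normal $\mathbf T$ and lapse $n=(dt(\mathbf T))^{-1}$. Let $p\in\mathbf M$. Let $\mathbb S^2$ be the unit sphere of $T_p\Sigma_{t(p)}$. For $\omega\in\mathbb S^2$ let $\gamma_\omega(s)$ be the affinely parametrized geodesic with $\gamma_\omega(0)=p$, $\dot\gamma_\omega(0)=\ell_\omega:=\omega-\mathbf T_p$ (so $\ell_\omega$ is null, past directed, and $\mathbf g(\ell_\omega,\mathbf T_p)=1$), and put $\mathcal G(s,\omega)=\gamma_\omega(s)$. Write $\mathcal G(t,\omega)$ for the point where $\gamma_\omega|_{s\ge 0}$ meets $\Sigma_t$. Let $\ell_*(p,t)\in[0,\infty]$ be the infimum of the values $t(p)-t$, $t<t(p)$, for which there are two distinct geodesics $\gamma_{\omega_1},\gamma_{\omega_2}$ that intersect at a point of $\Sigma_t$. Let $\mathcal J^-(p)$ be the causal past of $p$ and $\mathcal N^-(p)$ its boundary. A point $\gamma_\omega(s_*)$,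 $s_*>0$, is a terminal point of $\mathcal N^-(p)$ if $\gamma_\omega(s)\in\mathcal N^-(p)$ for $0\le s\le s_*$ and $\gamma_\omega(s)$ is in the interior of $\mathcal J^-(p)$ for all $s>s_*$ for which it is defined; it is a conjugate terminal point if moreover the differential of $(s,\omega)\mapsto\gamma_\omega(s)$ at $(s_*,\omega)$ is not injective. Consider, for $\epsilon>0$ and $r_0>0$, the following assumptions. **A1.** There is a constant $c_{\mathcal N}>\ell_*(p,t)$ such that $\mathcal N^-(p)$ has no conjugate terminal points in the slab $[t(p)-c_{\mathcal N},t(p)]$. **A2.** For all $t$ with $t(p)-\ell_*(p,t)<t<t(p)$, the pull-back $\sigma_t$ to $\mathbb S^2$, by $\mathcal G(t,\cdot)$, of the metric induced on $\Sigma_t$ satisfies $$|\sigma_t(X,X)-\sigma_0(X,X)|<\epsilon\,\sigma_t(X,X)\qquad\text{for all } 0\ne X\in T\mathbb S^2,$$ where $\sigma_0=\big(n(p)(t(p)-t)\big)^2\sigma_{\mathbb S^2}$ is the round metric of radius $n(p)(t(p)-t)$. Moreover $|\mathbf g(\dot\gamma_\omega,\mathbf T)-1|\le\epsilon$ at all points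 of the geodesics $\gamma_\omega|_{s\ge0}$ with $t(p)-\ell_*(p,t)<t\le t(p)$. **A3.** There are smooth coordinates $(x^0,x^1,x^2,x^3)$ with $x^0=t$ on a neighborhood $\mathcal O$ of $p$, with image a product $I_p\times U_p$ of an open interval and an open set, in which $|\mathbf g_{\alpha\beta}-\mathbf m_{\alpha\beta}|<\epsilon$ on $\mathcal O$ for all $\alpha,\beta$, where $\mathbf m=-n(p)^2dt^2+\delta_{ij}dx^idx^j$. The geodesic ball of radius $r_0$ about $p$ in $\Sigma_{t(p)}$ is contained in $\mathcal O$; $\sup_{t,t'\in I_p}|t-t'|\ge r_0$; and for every $t\in[t(p)-r_0/3,t(p)]$, $\mathcal O$ contains the Euclidean ball of radius $2(t(p)-t)$ in $\Sigma_t$ centered at the point with the same coordinates $x^1,x^2,x^3$ as $p$. **Proposition.** For every $N_0>0$ there are constants $\epsilon_0>0$ and $\kappa>0$, depending only on $N_0$, such that the following holds for every such space-time and every point $p$ with $N_0^{-1}\le n(p)\le N_0$. Suppose that $0<\epsilon\le\epsilon_0$ and $r_0>0$, that A1, A2 and A3 are satisfied, and that $\ell_*(p,t)<\delta_*$ for some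 $\delta_*\le\kappa r_0$. Then no two past directed null geodesics $\gamma_1,\gamma_2$ originating at $p$ that are opposite at $p$ (that is, the orthogonal projections of $\dot\gamma_1(0)$ and $\dot\gamma_2(0)$ to $T_p\Sigma_{t(p)}$ lie on the same line and point in opposite directions) can intersect at a point $q$ with $t(p)-\ell_*(p,t)\le t(q)<t(p)$. -/

import Mathlib

open Set Filter Topology Bundle
open scoped Manifold ContDiff

noncomputable section

/-- The model space of a four-dimensional space-time, with coordinates `x 0, x 1, x 2, x 3`. -/
abbrev E4 : Type := EuclideanSpace ℝ (Fin 4)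

/-- The velocity vector of a curve at the parameter `s`. -/
def velocity {M : Type*} [TopologicalSpace M] [ChartedSpace E4 M] (γ : ℝ → M) (s : ℝ) :
    TangentSpace 𝓘(ℝ, E4) (γ s) :=
  mfderiv 𝓘(ℝ, ℝ) 𝓘(ℝ, E4) γ s (1 : ℝ)

/-- A smooth Lorentzian metric, of signature `(-,+,+,+)`, on a smooth four-manifold. -/
structure LorentzMetric (M : Type*) [TopologicalSpace M] [ChartedSpace E4 M]
    [IsManifold 𝓘(ℝ, E4) ∞ M] where
  /-- The scalar product on the tangent spaces. -/
  val (x : M) : TangentSpace 𝓘(ℝ, E4) x →L[ℝ] TangentSpace 𝓘(ℝ, E4) x →L[ℝ] ℝ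
  symm (x : M) (v w : TangentSpace 𝓘(ℝ, E4) x) : val x v w = val x w v
  signature (x : M) : ∃ e : TangentSpace 𝓘(ℝ, E4) x, val x e e < 0 ∧
    ∀ v : TangentSpace 𝓘(ℝ, E4) x, val x e v = 0 → v ≠ 0 → 0 < val x v v
  contMDiff : ContMDiff 𝓘(ℝ, E4) (𝓘(ℝ, E4).prod 𝓘(ℝ, E4 →L[ℝ] E4 →L[ℝ] ℝ)) ∞
    (fun x ↦ TotalSpace.mk' (E4 →L[ℝ] E4 →L[ℝ] ℝ)
      (E := fun x : M ↦ TangentSpace 𝓘(ℝ, E4) x →L[ℝ] TangentSpace 𝓘(ℝ, E4) x →L[ℝ] ℝ)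
      x (val x))

namespace LorentzMetric

variable {M : Type*} [TopologicalSpace M] [ChartedSpace E4 M] [IsManifold 𝓘(ℝ, E4) ∞ M]

/-- The metric in the coordinates `φ`: the number `g (v^α ∂_α, w^β ∂_β)` at the point with
coordinates `y`. -/
def inCoord (g : LorentzMetric M) (φ : OpenPartialHomeomorph M E4) (y v w : E4) : ℝ :=
  g.val (φ.symm y) (mfderiv 𝓘(ℝ, E4) 𝓘(ℝ, E4) φ.symm y v)
    (mfderiv 𝓘(ℝ, E4) 𝓘(ℝ, E4) φ.symm y w)

/-- `γ` is an affinely parametrized geodesic on the parameter set `J`: in every smooth chart,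
`g_{kj} c̈^j + (∂_i g_{jk} - ½ ∂_k g_{ij}) ċ^i ċ^j = 0` for all `k`, where `c` is `γ` in the chart.
This is the geodesic equation with the index lowered, contracted here with a vector `v`. -/
def IsGeodesicOn (g : LorentzMetric M) (γ : ℝ → M) (J : Set ℝ) : Prop :=
  ∀ s ∈ J, ContMDiffAt 𝓘(ℝ, ℝ) 𝓘(ℝ, E4) 2 γ s ∧
    ∀ φ ∈ IsManifold.maximalAtlas 𝓘(ℝ, E4) ∞ M, γ s ∈ φ.source → ∀ v : E4,
      g.inCoord φ (φ (γ s)) (deriv (deriv (φ ∘ γ)) s) v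
        + fderiv ℝ (fun y ↦ g.inCoord φ y (deriv (φ ∘ γ) s) v) (φ (γ s)) (deriv (φ ∘ γ) s)
        - (1 / 2) * fderiv ℝ (fun y ↦ g.inCoord φ y (deriv (φ ∘ γ) s) (deriv (φ ∘ γ) s))
            (φ (γ s)) v = 0

/-- `γ` is a geodesic on the interval `(a, b)`, which contains `0`, with `γ 0 = p` and initial
velocity `v`. -/
def IsGeodesicFrom (g : LorentzMetric M) (p : M) (v : TangentSpace 𝓘(ℝ, E4) p)
    (γ : ℝ → M) (a b : ℝ) : Prop :=
  a < 0 ∧ 0 < b ∧ g.IsGeodesicOn γ (Ioo a b) ∧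
    (⟨γ 0, velocity γ 0⟩ : TangentBundle 𝓘(ℝ, E4) M) = ⟨p, v⟩

end LorentzMetric

/-- A four-dimensional space-time foliated by the space-like level hypersurfaces `Σ_t` of a smooth
time function, which increases towards the future. -/
structure FoliatedSpacetime (M : Type*) [TopologicalSpace M] [ChartedSpace E4 M]
    [IsManifold 𝓘(ℝ, E4) ∞ M] where
  /-- The space-time metric. -/
  g : LorentzMetric M
  /-- The time function. -/
  time : M → ℝ
  time_smooth : ContMDiff 𝓘(ℝ, E4) 𝓘(ℝ, ℝ) ∞ time
  /-- The vectors tangent to the level hypersurfaces are space-like. -/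
  spacelike (x : M) (v : TangentSpace 𝓘(ℝ, E4) x) :
    mfderiv 𝓘(ℝ, E4) 𝓘(ℝ, ℝ) time x v = (0 : ℝ) → v ≠ 0 → 0 < g.val x v v
  /-- The future unit normal to the level hypersurfaces (it is determined by the metric and the
  time function). -/
  T (x : M) : TangentSpace 𝓘(ℝ, E4) x
  T_normal (x : M) (v : TangentSpace 𝓘(ℝ, E4) x) :
    mfderiv 𝓘(ℝ, E4) 𝓘(ℝ, ℝ) time x v = (0 : ℝ) → g.val x (T x) v = 0
  T_unit (x : M) : g.val x (T x) (T x) = -1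
  T_future (x : M) : (0 : ℝ) < mfderiv 𝓘(ℝ, E4) 𝓘(ℝ, ℝ) time x (T x)

namespace FoliatedSpacetime

variable {M : Type*} [TopologicalSpace M] [ChartedSpace E4 M] [IsManifold 𝓘(ℝ, E4) ∞ M]

/-- The differential of the time function. -/
def dt (S : FoliatedSpacetime M) (x : M) (v : TangentSpace 𝓘(ℝ, E4) x) : ℝ :=
  mfderiv 𝓘(ℝ, E4) 𝓘(ℝ, ℝ) S.time x v

/-- The lapse `n` of the foliation: `n T` moves the time function at unit rate, so that
`-n² dt² + g_{ij} dx^i dx^j` is the metric in transported coordinates. -/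
def lapse (S : FoliatedSpacetime M) (x : M) : ℝ := (S.dt x (S.T x))⁻¹

/-- The orthogonal projection of a tangent vector to the tangent space of `Σ_t`. -/
def proj (S : FoliatedSpacetime M) (x : M) (v : TangentSpace 𝓘(ℝ, E4) x) :
    TangentSpace 𝓘(ℝ, E4) x :=
  v + S.g.val x v (S.T x) • S.T x

/-- Past directed null vectors. -/
def IsPastNull (S : FoliatedSpacetime M) (x : M) (v : TangentSpace 𝓘(ℝ, E4) x) : Prop :=
  S.g.val x v v = 0 ∧ S.dt x v < 0

/-! ### Causal past -/

/-- `q` is reached from `p` by a past directed causal `C¹` curve. -/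
def CausalStep (S : FoliatedSpacetime M) (p q : M) : Prop :=
  ∃ γ : ℝ → M, γ 0 = p ∧ γ 1 = q ∧ ∀ s ∈ Icc (0 : ℝ) 1,
    ContMDiffAt 𝓘(ℝ, ℝ) 𝓘(ℝ, E4) 1 γ s ∧
      S.g.val (γ s) (velocity γ s) (velocity γ s) ≤ 0 ∧ S.dt (γ s) (velocity γ s) < 0

/-- The causal past `J⁻(p)`: the point `p` and all points that are reached from it by piecewise
`C¹` past directed causal curves. -/
def causalPast (S : FoliatedSpacetime M) (p : M) : Set M :=
  {q | Relation.ReflTransGen S.CausalStep p q}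

/-- The null boundary `N⁻(p)` of the causal past. -/
def nullBoundary (S : FoliatedSpacetime M) (p : M) : Set M := frontier (S.causalPast p)

/-! ### The null exponential map -/

/-- The sphere `𝕊²` of directions at `p`, as the unit sphere in the tangent space of `Σ_{t(p)}`. -/
def directions (S : FoliatedSpacetime M) (p : M) : Set (TangentSpace 𝓘(ℝ, E4) p) :=
  {w | S.dt p w = 0 ∧ S.g.val p w w = 1}

/-- The unit vectors tangent to the sphere of directions at `w`. -/
def unitTangents (S : FoliatedSpacetime M) (p : M) (w : TangentSpace 𝓘(ℝ, E4) p) :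
    Set (TangentSpace 𝓘(ℝ, E4) p) :=
  {X | S.dt p X = 0 ∧ S.g.val p X w = 0 ∧ S.g.val p X X = 1}

/-- The null vector `ℓ_w = w - T`: it is past directed, projects to the direction `w`, and satisfies
`g (ℓ_w, T) = 1`. -/
def nullVector (S : FoliatedSpacetime M) (p : M) (w : TangentSpace 𝓘(ℝ, E4) p) :
    TangentSpace 𝓘(ℝ, E4) p :=
  w - S.T p

/-- `q = γ_w(s)`, where `γ_w` is the geodesic from `p` with initial velocity `ℓ_w`. -/
def OnRay (S : FoliatedSpacetime M) (p : M) (w : TangentSpace 𝓘(ℝ, E4) p) (s : ℝ) (q : M) :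
    Prop :=
  ∃ (γ : ℝ → M) (a b : ℝ), S.g.IsGeodesicFrom p (S.nullVector p w) γ a b ∧ s ∈ Ioo a b ∧ γ s = q

open Classical in
/-- The exponential map `(s, w) ↦ γ_w(s)` (with the value `p` where `γ_w(s)` does not exist). -/
def expS (S : FoliatedSpacetime M) (p : M) (s : ℝ) (w : TangentSpace 𝓘(ℝ, E4) p) : M :=
  if h : ∃ q, S.OnRay p w s q then h.choose else p

open Classical in
/-- The exponential map `(t, w) ↦ γ_w(t)` relative to the time foliation: the point at which
`γ_w`, followed from `p` towards the past, meets `Σ_t` (with the value `p` where there is none). -/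
def expT (S : FoliatedSpacetime M) (p : M) (t : ℝ) (w : TangentSpace 𝓘(ℝ, E4) p) : M :=
  if h : ∃ q, (∃ s, 0 ≤ s ∧ S.OnRay p w s q) ∧ S.time q = t then h.choose else p

/-- The great circle of directions through `w` with initial velocity `X`. -/
def greatCircle {p : M} (w X : TangentSpace 𝓘(ℝ, E4) p) (u : ℝ) : TangentSpace 𝓘(ℝ, E4) p :=
  Real.cos u • w + Real.sin u • X

/-- `ℓ_*(p,t)`: the infimum of the values `t(p) - t`, `t < t(p)`, for which two distinct null
geodesics `γ_{w₁}`, `γ_{w₂}` from `p` intersect at a point of `Σ_t`; it is `⊤` if there are none. -/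
def ellStar (S : FoliatedSpacetime M) (p : M) : EReal :=
  sInf {l : EReal | ∃ w₁ ∈ S.directions p, ∃ w₂ ∈ S.directions p, w₁ ≠ w₂ ∧
    ∃ (s₁ s₂ : ℝ) (q : M), 0 ≤ s₁ ∧ 0 ≤ s₂ ∧ S.OnRay p w₁ s₁ q ∧ S.OnRay p w₂ s₂ q ∧
      S.time q < S.time p ∧ l = ((S.time p - S.time q : ℝ) : EReal)}

/-- The exponential map `(s, w) ↦ γ_w(s)` is singular at `(s, w)`: its differential kills a nonzero
tangent vector `(α, β X)` of `ℝ × 𝕊²`. -/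
def IsSingularAt (S : FoliatedSpacetime M) (p : M) (s : ℝ) (w : TangentSpace 𝓘(ℝ, E4) p) : Prop :=
  ∃ X ∈ S.unitTangents p w, ∃ α β : ℝ, (α, β) ≠ (0, 0) ∧
    velocity (fun r : ℝ ↦ S.expS p (s + α * r) (greatCircle w X (β * r))) 0 = 0

/-- `γ_w(s)`, `s > 0`, is a terminal point of `N⁻(p)`: up to the parameter `s` the geodesic `γ_w` is
on `N⁻(p)`, beyond it in the interior of `J⁻(p)`. -/
def IsTerminal (S : FoliatedSpacetime M) (p : M) (s : ℝ) (w : TangentSpace 𝓘(ℝ, E4) p) : Prop :=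
  0 < s ∧ (∃ q, S.OnRay p w s q) ∧ (∀ s' ∈ Icc 0 s, S.expS p s' w ∈ S.nullBoundary p) ∧
    ∀ s', s < s' → (∃ q, S.OnRay p w s' q) → S.expS p s' w ∈ interior (S.causalPast p)

/-! ### The three assumptions -/

/-- For some `c > ℓ_*(p,t)` there are no conjugate terminal points of `N⁻(p)` in the slab
`[t(p) - c, t(p)]`. -/
def AssumptionA1 (S : FoliatedSpacetime M) (p : M) : Prop :=
  ∃ c : ℝ, S.ellStar p < (c : EReal) ∧ ∀ w ∈ S.directions p, ∀ s : ℝ,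
    S.IsTerminal p s w → S.time (S.expS p s w) ∈ Icc (S.time p - c) (S.time p) →
      ¬ S.IsSingularAt p s w

/-- For `t(p) - ℓ_*(p,t) < t < t(p)` the metric `σ_t` of `S_t`, pulled back to `𝕊²` by the exponential
map, is close to `σ₀`, the round metric of radius `n(p) (t(p) - t)`:
`|σ_t(X,X) - σ₀(X,X)| < ε σ_t(X,X)` for `X ≠ 0`, stated for the `X` of unit length in `𝕊²`.
For `t(p) - ℓ_*(p,t) < t ≤ t(p)` the null lapse `g (L, T)`, with `L` the velocity of the null
geodesics `γ_w`, is within `ε` of `1`. -/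
def AssumptionA2 (S : FoliatedSpacetime M) (p : M) (ε : ℝ) : Prop :=
  (∀ t : ℝ, t < S.time p → ((S.time p - t : ℝ) : EReal) < S.ellStar p →
    ∀ w ∈ S.directions p, ∀ X ∈ S.unitTangents p w,
      let c : ℝ → M := fun u ↦ S.expT p t (greatCircle w X u)
      let σ : ℝ := S.g.val (c 0) (velocity c 0) (velocity c 0)
      |σ - (S.lapse p * (S.time p - t)) ^ 2| < ε * σ) ∧
  ∀ w ∈ S.directions p, ∀ (γ : ℝ → M) (a b : ℝ),
    S.g.IsGeodesicFrom p (S.nullVector p w) γ a b → ∀ s ∈ Ico 0 b,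
      ((S.time p - S.time (γ s) : ℝ) : EReal) < S.ellStar p →
        |S.g.val (γ s) (velocity γ s) (S.T (γ s)) - 1| ≤ ε

/-- The open geodesic ball of radius `r` around `p` in `Σ_{t(p)}`: the points joined to `p` by a `C¹`
curve in `Σ_{t(p)}` of length less than `r`. -/
def sliceBall (S : FoliatedSpacetime M) (p : M) (r : ℝ) : Set M :=
  {q | ∃ γ : ℝ → M, γ 0 = p ∧ γ 1 = q ∧
    (∀ u ∈ Icc (0 : ℝ) 1, ContMDiffAt 𝓘(ℝ, ℝ) 𝓘(ℝ, E4) 1 γ u ∧ S.time (γ u) = S.time p) ∧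
    ∫ u in (0 : ℝ)..1, √(S.g.val (γ u) (velocity γ u) (velocity γ u)) < r}

/-- The spatial part `(x¹, x², x³)` of the coordinates `(x⁰, x¹, x², x³)`. -/
def spatial (y : E4) : EuclideanSpace ℝ (Fin 3) := WithLp.toLp 2 fun i ↦ y i.succ

/-- The coefficients of the Minkowski metric `-n² dt² + δ_{ij} dx^i dx^j`. -/
def minkowski (n : ℝ) (α β : Fin 4) : ℝ :=
  if α = β then (if α = 0 then -n ^ 2 else 1) else 0

/-- There are coordinates `φ = (t, x¹, x², x³)` on a neighbourhood `O = I_p × U_p` of `p` in which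
the metric is within `ε` of the Minkowski metric `-n(p)² dt² + δ_{ij} dx^i dx^j`. The set `U_p`
contains the geodesic ball of radius `r₀`, the interval `I_p` has length at least `r₀`, and, for
`t` in `[t(p) - r₀/3, t(p)]`, `O` contains the Euclidean ball of radius `2 (t(p) - t)` in `Σ_t`
around the point with the same spatial coordinates as `p`. -/
def AssumptionA3 (S : FoliatedSpacetime M) (p : M) (ε r₀ : ℝ) : Prop :=
  ∃ φ ∈ IsManifold.maximalAtlas 𝓘(ℝ, E4) ∞ M,
  ∃ (J : Set ℝ) (V : Set (EuclideanSpace ℝ (Fin 3))),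
    J.OrdConnected ∧ p ∈ φ.source ∧
    (∀ q ∈ φ.source, φ q 0 = S.time q) ∧
    φ.target = {y | y 0 ∈ J ∧ spatial y ∈ V} ∧
    (∀ y ∈ φ.target, ∀ α β : Fin 4,
      |S.g.inCoord φ y (EuclideanSpace.single α 1) (EuclideanSpace.single β 1)
        - minkowski (S.lapse p) α β| < ε) ∧
    S.sliceBall p r₀ ⊆ φ.source ∧
    ENNReal.ofReal r₀ ≤ Metric.ediam J ∧
    ∀ t ∈ Icc (S.time p - r₀ / 3) (S.time p), ∀ y : E4, y 0 = t →
      ‖spatial y - spatial (φ p)‖ < 2 * (S.time p - t) → y ∈ φ.target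

end FoliatedSpacetime

end

open Set Filter Topology Bundle
open scoped Manifold ContDiff

noncomputable section

/-! Suppose two opposite rays meet, and let `t` be slightly later than the time of the meeting
point, so that A2 is in force at `t`. In the coordinates of A3, centred at `p` and divided by `T =
n(p) (t(p) - t)`, the slice of the light cone at `t` is the image of a map `F` from the unit sphere
to `E3`. Two properties of `F` prevent `F N` and `F (-N)` from being close.

Upper bound. By A2 the metric `σ_t` is nearly `T²` times the round one, and by A3 the metric of the
slice is nearly Euclidean. Hence `F` stretches angles at most by `1 + η`
(`AdaptedChart.norm_sphere_sub_le`).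

Lower bound. In every direction `e`, `F` takes a value `l • e` with `l ≥ 1 - η`
(`AdaptedChart.exists_sphere_eq`). This is Fermat's principle: the farthest point in the direction
`e` that causal curves reach in time `T` is at least as far as straight causal curves go, and an
optimal curve is a null geodesic from `p`. The optimal curve is found by discretization. Among
polygons with `N` edges, `l` is maximized under the single smooth constraint `∑ exp (N Q) ≤ N`,
which softens the condition `Q ≤ 0` on each edge (`ConeField.exists_isExtremal`). Stationarity is a
discrete form of Hamilton's equations, with the weights `exp (N Q)` as multipliers. These stay
bounded above and below uniformly in `N`, so that `Q = O(1/N)` (`ConeField.exists_extremal_bounds`),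
and the polygons converge to the null geodesic with the limiting initial velocity
(`ConeField.exists_trajectory_reaching`). That geodesic does reach `Σ_t`, because A2 makes the
exponential map nondegenerate there (`AssumptionA2.expT_spec`).

Conclusion (`antipodes_separated`). Near every point of the sphere `F` has a value of length nearly
`1`; otherwise the radial extension of `F`, with Lipschitz constant close to `1`, would map a set of
definitely smaller volume onto a whole shell. So `‖F N‖` is bounded below. If `F (-N)` were close to
`F N`, all values of `F` would lie within about `π/2` of `F N`, since every point is within a right
angle of `N` or `-N`. This leaves no room for the long value in the direction opposite to `F N`. Two
rays that meet contradict this by continuity just above the meeting time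
(`AdaptedChart.opposite_rays_disjoint`). -/

/-- The space of the spatial coordinates. -/
abbrev E3 : Type := EuclideanSpace ℝ (Fin 3)

/-! ### Near-isometries of the sphere -/

section Sphere

open MeasureTheory InnerProductGeometry
open scoped RealInnerProductSpace

/-- A map that is `K`-Lipschitz at small scales increases the Hausdorff measure at most by the
factor `K ^ d`. -/
theorem hausdorffMeasure_image_le_of_dist_lt {X Y : Type*} [MetricSpace X] [MetricSpace Y]
    [MeasurableSpace X] [BorelSpace X] [MeasurableSpace Y] [BorelSpace Y]
    [SecondCountableTopology X] {K : NNReal} {f : X → Y} {s t : Set X} {r d : ℝ} (hr : 0 < r)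
    (hd : 0 ≤ d) (hst : s ⊆ t) (ht : MeasurableSet t)
    (h : ∀ x ∈ s, ∀ y ∈ s, dist x y < r → dist (f x) (f y) ≤ K * dist x y) :
    μH[d] (f '' s) ≤ (K : ENNReal) ^ d * μH[d] t := by
  rcases isEmpty_or_nonempty X with hX | hX
  · simp [Set.eq_empty_of_isEmpty s]
  set u : ℕ → X := TopologicalSpace.denseSeq X
  -- Points of one piece are less than `r` apart, so the hypothesis is a Lipschitz bound on each
  -- piece. The pieces are cut out of the measurable set `t`, since `s` need not be measurable, and
  -- are made disjoint so that their measures add up.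
  set B : ℕ → Set X := fun n ↦ t ∩ Metric.ball (u n) (r / 2) with hB
  have hBm : ∀ n, MeasurableSet (B n) := fun n ↦ ht.inter Metric.isOpen_ball.measurableSet
  have hcov : s ⊆ ⋃ n, disjointed B n := by
    rw [iUnion_disjointed]
    intro x hx
    obtain ⟨n, hn⟩ := (TopologicalSpace.denseRange_denseSeq X).exists_dist_lt x (half_pos hr)
    exact mem_iUnion.2 ⟨n, hst hx, hn⟩
  have hsub : f '' s ⊆ ⋃ n, f '' (s ∩ disjointed B n) := by
    rw [← image_iUnion, ← inter_iUnion]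
    exact image_mono fun x hx ↦ ⟨hx, hcov hx⟩
  have hpiece : ∀ n, μH[d] (f '' (s ∩ disjointed B n)) ≤
      (K : ENNReal) ^ d * μH[d] (disjointed B n) := by
    intro n
    have hl : LipschitzOnWith K f (s ∩ disjointed B n) := by
      refine LipschitzOnWith.of_dist_le_mul fun x hx y hy ↦ h x hx.1 y hy.1 ?_
      have h1 := (disjointed_subset B n hx.2).2
      have h2 := (disjointed_subset B n hy.2).2
      rw [Metric.mem_ball] at h1 h2
      calc dist x y ≤ dist x (u n) + dist y (u n) := dist_triangle_right _ _ _
        _ < r := by linarith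
    refine (hl.hausdorffMeasure_image_le hd).trans ?_
    gcongr
    exact inter_subset_right
  calc μH[d] (f '' s) ≤ ∑' n, μH[d] (f '' (s ∩ disjointed B n)) :=
        (measure_mono hsub).trans (measure_iUnion_le _)
    _ ≤ ∑' n, (K : ENNReal) ^ d * μH[d] (disjointed B n) := ENNReal.tsum_le_tsum hpiece
    _ = (K : ENNReal) ^ d * μH[d] (⋃ n, disjointed B n) := by
        rw [ENNReal.tsum_mul_left, measure_iUnion (disjoint_disjointed B)
          fun n ↦ MeasurableSet.disjointed hBm n]
    _ ≤ (K : ENNReal) ^ d * μH[d] t := by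
        rw [iUnion_disjointed]
        gcongr
        exact iUnion_subset fun n ↦ inter_subset_left

theorem norm_sub_eq_two_mul_sin_angle {a b : E3} (ha : ‖a‖ = 1) (hb : ‖b‖ = 1) :
    ‖a - b‖ = 2 * Real.sin (angle a b / 2) := by
  have h0 : 0 ≤ Real.sin (angle a b / 2) :=
    Real.sin_nonneg_of_nonneg_of_le_pi (by linarith [angle_nonneg a b])
      (by linarith [angle_le_pi a b, Real.pi_pos])
  have h1 : ‖a - b‖ ^ 2 = (2 * Real.sin (angle a b / 2)) ^ 2 := by
    have h2 := norm_sub_sq_eq_norm_sq_add_norm_sq_sub_two_mul_norm_mul_norm_mul_cos_angle a b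
    have h3 := Real.cos_sq' (angle a b / 2)
    have h4 := Real.cos_two_mul (angle a b / 2)
    rw [mul_div_cancel₀ _ (two_ne_zero)] at h4
    rw [ha, hb] at h2
    nlinarith
  exact (sq_eq_sq₀ (norm_nonneg _) (by positivity)).1 h1

theorem angle_le_pi_div_two_mul_norm_sub {a b : E3} (ha : ‖a‖ = 1) (hb : ‖b‖ = 1) :
    angle a b ≤ Real.pi / 2 * ‖a - b‖ := by
  have h := Real.mul_le_sin (x := angle a b / 2) (by linarith [angle_nonneg a b])
    (by linarith [angle_le_pi a b])
  rw [norm_sub_eq_two_mul_sin_angle ha hb]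
  calc angle a b = Real.pi * (2 / Real.pi * (angle a b / 2)) := by
        field_simp
    _ ≤ Real.pi * Real.sin (angle a b / 2) := by gcongr
    _ = _ := by ring

/-- The chord `2 sin (θ / 2)` falls short of the angle `θ` only by a cubic term, which is at most
`δ` times the chord when the chord is at most `δ` and `1`. -/
theorem angle_le_one_add_mul_norm_sub {a b : E3} (ha : ‖a‖ = 1) (hb : ‖b‖ = 1) {δ : ℝ}
    (h1 : ‖a - b‖ ≤ 1) (hδ : ‖a - b‖ ≤ δ) : angle a b ≤ (1 + δ) * ‖a - b‖ := by
  have h := angle_le_pi_div_two_mul_norm_sub ha hb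
  have hs := norm_sub_eq_two_mul_sin_angle ha hb
  set c := ‖a - b‖
  set θ := angle a b
  have hc : 0 ≤ c := norm_nonneg _
  have h2 : θ ≤ 2 * c := h.trans (by nlinarith [Real.pi_lt_four])
  rcases (angle_nonneg a b).eq_or_lt with h0 | h0
  · change 0 = θ at h0
    rw [← h0]; exact mul_nonneg (by linarith) hc
  · change 0 < θ at h0
    have h3 := Real.sin_gt_sub_cube (x := θ / 2) (by linarith)
    have h4 : θ ^ 3 ≤ (2 * c) ^ 3 := by gcongr
    nlinarith [mul_nonneg hc hc, mul_le_mul_of_nonneg_left hδ hc,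
      mul_le_mul_of_nonneg_left h1 (mul_nonneg hc hc)]

/-- The squared distance splits into a radial and an angular part, so a map that preserves norms
inherits the Lipschitz constant of its action on directions, if that is at least `1`. -/
theorem norm_smul_sub_smul_sq {u u' : E3} (hu : ‖u‖ = 1) (hu' : ‖u'‖ = 1) (r r' : ℝ) :
    ‖r • u - r' • u'‖ ^ 2 = (r - r') ^ 2 + r * r' * ‖u - u'‖ ^ 2 := by
  rw [norm_sub_sq_real, norm_sub_sq_real, norm_smul, norm_smul, hu, hu', real_inner_smul_left,
    real_inner_smul_right]
  simp only [Real.norm_eq_abs, mul_one, sq_abs]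
  ring

/-- Radial projection to the outside of a ball contracts: two vectors of length at least `c` are at
least `c` times as far apart as their directions. -/
theorem mul_norm_normalize_sub_le {x y : E3} {c : ℝ} (hc : 0 < c) (hx : c ≤ ‖x‖) (hy : c ≤ ‖y‖) :
    c * ‖‖x‖⁻¹ • x - ‖y‖⁻¹ • y‖ ≤ ‖x - y‖ := by
  have hx0 : ‖x‖ ≠ 0 := (hc.trans_le hx).ne'
  have hy0 : ‖y‖ ≠ 0 := (hc.trans_le hy).ne'
  have hu : ‖‖x‖⁻¹ • x‖ = 1 := by rw [norm_smul, norm_inv, norm_norm, inv_mul_cancel₀ hx0]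
  have hv : ‖‖y‖⁻¹ • y‖ = 1 := by rw [norm_smul, norm_inv, norm_norm, inv_mul_cancel₀ hy0]
  have h := norm_smul_sub_smul_sq hu hv ‖x‖ ‖y‖
  rw [smul_smul, smul_smul, mul_inv_cancel₀ hx0, mul_inv_cancel₀ hy0, one_smul, one_smul] at h
  have h2 : c * c ≤ ‖x‖ * ‖y‖ := by gcongr
  refine abs_le_of_sq_le_sq' ?_ (norm_nonneg _) |>.2
  rw [mul_pow, h]
  nlinarith [sq_nonneg (‖x‖ - ‖y‖), mul_le_mul_of_nonneg_right h2
    (sq_nonneg ‖‖x‖⁻¹ • x - ‖y‖⁻¹ • y‖)]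

/-- A map of the unit sphere that is nearly `1`-Lipschitz, and whose values of length nearly `1` take
all directions, has such values near every point of the sphere. -/
theorem exists_near_of_nearly_lipschitz : ∃ η : ℝ, 0 < η ∧ η ≤ 1 / 100 ∧ ∀ F : E3 → E3,
    (∀ a b, ‖a‖ = 1 → ‖b‖ = 1 → ‖F a - F b‖ ≤ (1 + η) * angle a b) →
    (∀ e, ‖e‖ = 1 → ∃ a, ‖a‖ = 1 ∧ ∃ l, 1 - η ≤ l ∧ F a = l • e) →
    ∀ N, ‖N‖ = 1 → ∃ a, ‖a‖ = 1 ∧ ‖a - N‖ < 1 / 5 ∧ 1 - η ≤ ‖F a‖ := by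
  set A : Set E3 := Metric.closedBall 0 1 \ Metric.ball 0 (1 / 2) with hA
  have hAm : MeasurableSet A :=
    Metric.isClosed_closedBall.measurableSet.diff Metric.isOpen_ball.measurableSet
  have hmemA : ∀ x, x ∈ A ↔ 1 / 2 ≤ ‖x‖ ∧ ‖x‖ ≤ 1 := fun x ↦ by
    simp [hA, and_comm]
  have h3 : ((Module.finrank ℝ E3 : ℕ) : ℝ) = 3 := by simp
  have hHaar : (μH[3] : Measure E3).IsAddHaarMeasure := by
    rw [← h3]; infer_instance
  set μ : Measure E3 := μH[3] with hμ
  have hfin : μ A ≠ ⊤ := ((measure_mono sdiff_subset).trans_lt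
    (isCompact_closedBall (0 : E3) 1).measure_lt_top).ne
  set V := (μ A).toReal
  set β := (μ (Metric.ball (0 : E3) (1 / 20))).toReal with hβ
  have hβ0 : 0 < β := ENNReal.toReal_pos (Metric.measure_ball_pos μ _ (by norm_num)).ne'
    measure_ball_lt_top.ne
  -- The fraction is the Lipschitz constant of the map `G` below. It tends to `1` with `η`, so its
  -- cube cannot make up for the volume `β` of a ball missing from the shell.
  obtain ⟨η, hη0, hη1, hη⟩ : ∃ η : ℝ, 0 < η ∧ η ≤ 1 / 100 ∧
      ((1 + η) ^ 2 / (1 - η)) ^ 3 * (V - β) < V := by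
    have hc : Tendsto (fun η : ℝ ↦ ((1 + η) ^ 2 / (1 - η)) ^ 3 * (V - β)) (𝓝[>] 0)
        (𝓝 (((1 + 0) ^ 2 / (1 - 0)) ^ 3 * (V - β))) := by
      refine tendsto_nhdsWithin_of_tendsto_nhds (ContinuousAt.tendsto (f := fun η : ℝ ↦
        ((1 + η) ^ 2 / (1 - η)) ^ 3 * (V - β)) ?_)
      fun_prop (disch := norm_num)
    have h1 := hc.eventually_lt_const (u := V) (by norm_num; exact hβ0)
    have h2 : ∀ᶠ η : ℝ in 𝓝[>] 0, η < 1 / 100 :=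
      nhdsWithin_le_nhds (gt_mem_nhds (by norm_num))
    obtain ⟨η, ⟨h1, h2⟩, h3⟩ := ((h1.and h2).and self_mem_nhdsWithin).exists
    exact ⟨η, h3, h2.le, h1⟩
  refine ⟨η, hη0, hη1, fun F hF hsurj N hN ↦ ?_⟩
  by_contra! hcon
  -- This ball lies inside the shell, and the directions of its points are within `1 / 5` of `N`.
  set W := Metric.ball ((3 / 4 : ℝ) • N) (1 / 20) with hW
  have hdir : ∀ x : E3, 1 / 2 ≤ ‖x‖ → ‖‖x‖⁻¹ • x‖ = 1 := fun x hx ↦ by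
    rw [norm_smul, norm_inv, norm_norm, inv_mul_cancel₀ (by linarith)]
  have hN' : ‖(3 / 4 : ℝ) • N‖ = 3 / 4 := by rw [norm_smul, hN]; norm_num
  have hWA : W ⊆ A := by
    intro x hx
    rw [hW, Metric.mem_ball, dist_eq_norm] at hx
    have h1 := norm_sub_norm_le x ((3 / 4 : ℝ) • N)
    have h2 := norm_sub_norm_le ((3 / 4 : ℝ) • N) x
    rw [norm_sub_rev] at h2
    rw [hmemA]
    constructor <;> linarith
  set s : Set E3 := {x ∈ A | 1 - η ≤ ‖F (‖x‖⁻¹ • x)‖} with hs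
  have hsW : s ⊆ A \ W := by
    refine fun x hx ↦ ⟨hx.1, fun hxW ↦ ?_⟩
    have hx1 := (hmemA x).1 hx.1
    refine (hcon _ (hdir x hx1.1) ?_).not_ge hx.2
    rw [hW, Metric.mem_ball, dist_eq_norm] at hxW
    have h1 : |‖x‖ - 3 / 4| < 1 / 20 := by
      rw [← hN']; exact (abs_norm_sub_norm_le _ _).trans_lt hxW
    have h2 : ‖x - ‖x‖ • N‖ < 1 / 10 := by
      have : x - ‖x‖ • N = (x - (3 / 4 : ℝ) • N) - (‖x‖ - 3 / 4) • N := by module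
      rw [this]
      refine (norm_sub_le _ _).trans_lt ?_
      rw [norm_smul, hN, Real.norm_eq_abs]
      linarith
    have h3 : ‖x‖⁻¹ • x - N = ‖x‖⁻¹ • (x - ‖x‖ • N) := by
      rw [smul_sub, smul_smul, inv_mul_cancel₀ (by linarith), one_smul]
    rw [h3, norm_smul, norm_inv, norm_norm, inv_mul_lt_iff₀ (by linarith)]
    rw [abs_lt] at h1
    linarith
  -- The radial extension of the direction of `F`. It maps `s` onto the shell because the long
  -- values of `F` take all directions. Short values are left out of `s`, since normalizing them
  -- could stretch distances.
  set G : E3 → E3 := fun x ↦ ‖x‖ • (‖F (‖x‖⁻¹ • x)‖⁻¹ • F (‖x‖⁻¹ • x)) with hG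
  have hAG : A ⊆ G '' s := by
    intro y hy
    have hy1 := (hmemA y).1 hy
    have hy0 : ‖y‖ ≠ 0 := by linarith
    obtain ⟨a, ha, l, hl, hFa⟩ := hsurj _ (hdir y hy1.1)
    have hna : ‖‖y‖ • a‖ = ‖y‖ := by rw [norm_smul, ha, norm_norm, mul_one]
    have hnF : ‖F a‖ = l := by
      rw [hFa, norm_smul, hdir y hy1.1, mul_one, Real.norm_of_nonneg (by linarith)]
    have hda : ‖‖y‖ • a‖⁻¹ • ‖y‖ • a = a := by
      rw [hna, smul_smul, inv_mul_cancel₀ hy0, one_smul]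
    refine ⟨‖y‖ • a, ⟨(hmemA _).2 (by rwa [hna]), by rw [hda, hnF]; exact hl⟩, ?_⟩
    rw [hG]
    simp only
    rw [hda, hna, hnF, hFa, smul_smul l⁻¹, inv_mul_cancel₀ (by linarith), one_smul, smul_smul,
      mul_inv_cancel₀ hy0, one_smul]
  have hK0 : 0 ≤ (1 + η) ^ 2 / (1 - η) := div_nonneg (by positivity) (by linarith)
  have hK1 : 1 ≤ (1 + η) ^ 2 / (1 - η) := by
    rw [le_div_iff₀ (by linarith)]; nlinarith
  obtain ⟨K', hK'⟩ : ∃ K' : NNReal, (K' : ℝ) = (1 + η) ^ 2 / (1 - η) := ⟨⟨_, hK0⟩, rfl⟩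
  -- One factor `1 + η` is the Lipschitz constant of `F`, the other replaces the angle by the chord
  -- at this scale, and `1 / (1 - η)` comes from normalizing values of length at least `1 - η`.
  have hlip : ∀ x ∈ s, ∀ y ∈ s, dist x y < η / 2 →
      dist (G x) (G y) ≤ K' * dist x y := by
    intro x hx y hy hxy
    have hx1 := (hmemA x).1 hx.1
    have hy1 := (hmemA y).1 hy.1
    rw [dist_eq_norm] at hxy
    rw [dist_eq_norm, dist_eq_norm, hK']
    have h1 := mul_norm_normalize_sub_le (by norm_num : (0 : ℝ) < 1 / 2) hx1.1 hy1.1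
    have h2 := angle_le_one_add_mul_norm_sub (hdir x hx1.1) (hdir y hy1.1) (δ := η)
      (by linarith) (by linarith)
    have h3 := hF _ _ (hdir x hx1.1) (hdir y hy1.1)
    have h4 := mul_norm_normalize_sub_le (by linarith : 0 < 1 - η) hx.2 hy.2
    have hu : ‖‖F (‖x‖⁻¹ • x)‖⁻¹ • F (‖x‖⁻¹ • x)‖ = 1 := by
      rw [norm_smul, norm_inv, norm_norm, inv_mul_cancel₀ (by linarith [hx.2])]
    have hv : ‖‖F (‖y‖⁻¹ • y)‖⁻¹ • F (‖y‖⁻¹ • y)‖ = 1 := by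
      rw [norm_smul, norm_inv, norm_norm, inv_mul_cancel₀ (by linarith [hy.2])]
    have h5 := norm_smul_sub_smul_sq hu hv ‖x‖ ‖y‖
    have h6 := norm_smul_sub_smul_sq (hdir x hx1.1) (hdir y hy1.1) ‖x‖ ‖y‖
    rw [smul_smul, smul_smul ‖y‖, mul_inv_cancel₀ (by linarith : ‖x‖ ≠ 0),
      mul_inv_cancel₀ (by linarith : ‖y‖ ≠ 0), one_smul, one_smul] at h6
    refine abs_le_of_sq_le_sq' ?_ (by positivity) |>.2
    rw [mul_pow, h6]
    refine h5.le.trans ?_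
    set K := (1 + η) ^ 2 / (1 - η) with hK
    set c := ‖‖x‖⁻¹ • x - ‖y‖⁻¹ • y‖
    set c' := ‖‖F (‖x‖⁻¹ • x)‖⁻¹ • F (‖x‖⁻¹ • x) - ‖F (‖y‖⁻¹ • y)‖⁻¹ • F (‖y‖⁻¹ • y)‖
    have h7 : c' ≤ K * c := by
      rw [hK, div_mul_eq_mul_div, le_div_iff₀ (by linarith)]
      calc c' * (1 - η) = (1 - η) * c' := mul_comm _ _
        _ ≤ (1 + η) * ((1 + η) * c) := h4.trans (h3.trans (by gcongr))
        _ = _ := by ring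
    have h8 : c' ^ 2 ≤ K ^ 2 * c ^ 2 := by
      rw [← mul_pow]; exact pow_le_pow_left₀ (norm_nonneg _) h7 2
    have h9 : 1 ≤ K ^ 2 := one_le_pow₀ hK1
    have h10 := mul_le_mul_of_nonneg_left h8 (mul_nonneg (norm_nonneg x) (norm_nonneg y))
    nlinarith [mul_le_mul_of_nonneg_right h9 (sq_nonneg (‖x‖ - ‖y‖))]
  have key := (measure_mono hAG).trans (hausdorffMeasure_image_le_of_dist_lt (d := 3)
    (half_pos hη0) (by norm_num) hsW (hAm.diff Metric.isOpen_ball.measurableSet) hlip)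
  rw [← hμ, measure_sdiff hWA Metric.isOpen_ball.measurableSet.nullMeasurableSet
    measure_ball_lt_top.ne, Measure.addHaar_ball_center] at key
  have key2 := ENNReal.toReal_mono (by
    refine ENNReal.mul_ne_top (by simp) (ENNReal.sub_ne_top hfin)) key
  rw [ENNReal.toReal_mul, ENNReal.toReal_sub_of_le ?_ hfin] at key2
  · refine (hη.trans_le key2).ne ?_
    simp [V, β, hK']
  · rw [← Measure.addHaar_ball_center μ ((3 / 4 : ℝ) • N)]; exact measure_mono hWA

/-- A map of the unit sphere that is nearly `1`-Lipschitz, and whose values of length nearly `1` take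
all directions, separates antipodal points. -/
theorem antipodes_separated : ∃ η : ℝ, 0 < η ∧ η ≤ 1 / 100 ∧ ∀ F : E3 → E3,
    (∀ a b, ‖a‖ = 1 → ‖b‖ = 1 → ‖F a - F b‖ ≤ (1 + η) * angle a b) →
    (∀ e, ‖e‖ = 1 → ∃ a, ‖a‖ = 1 ∧ ∃ l, 1 - η ≤ l ∧ F a = l • e) →
    ∀ N, ‖N‖ = 1 → 1 / 100 < ‖F N - F (-N)‖ := by
  obtain ⟨η, hη0, hη1, h⟩ := exists_near_of_nearly_lipschitz
  refine ⟨η, hη0, hη1, fun F hF hsurj N hN ↦ ?_⟩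
  by_contra! hcon
  obtain ⟨a, ha, haN, hFa⟩ := h F hF hsurj N hN
  have hpi := Real.pi_lt_d2
  have hpi3 := Real.pi_gt_three
  have h1 : ‖F a - F N‖ ≤ 33 / 100 := by
    have h2 := angle_le_pi_div_two_mul_norm_sub ha hN
    have h3 : angle a N ≤ 63 / 200 := by nlinarith
    nlinarith [hF a N ha hN]
  have h2 : 66 / 100 ≤ ‖F N‖ := by
    have := norm_sub_norm_le (F a) (F N)
    linarith
  have hne : ‖F N‖ ≠ 0 := by linarith
  -- The image of `b` points away from `F N`, so the two are at least `99/100 + 66/100` apart.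
  obtain ⟨b, hb, l, hl, hFb⟩ := hsurj (-(‖F N‖⁻¹ • F N)) (by
    rw [norm_neg, norm_smul, norm_inv, norm_norm, inv_mul_cancel₀ hne])
  have h3 : 165 / 100 ≤ ‖F b - F N‖ := by
    have : F b - F N = -((l * ‖F N‖⁻¹ + 1) • F N) := by rw [hFb]; module
    rw [this, norm_neg, norm_smul, Real.norm_of_nonneg (by
      have := inv_nonneg.2 (norm_nonneg (F N)); nlinarith), add_mul, mul_assoc,
      inv_mul_cancel₀ hne]
    linarith
  -- One of `N` and `-N` is within a right angle of `b`. With `π < 3.15` and `η ≤ 1/100` the bound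
  -- is below `1.61`.
  have h4 : ‖F b - F N‖ ≤ (1 + η) * (Real.pi / 2) + 1 / 100 := by
    rcases le_total (angle b N) (Real.pi / 2) with h5 | h5
    · refine (hF b N hb hN).trans ?_
      nlinarith
    · have h6 : angle b (-N) ≤ Real.pi / 2 := by rw [angle_neg_right]; linarith
      have h7 := hF b (-N) hb (by rwa [norm_neg])
      calc ‖F b - F N‖ ≤ ‖F b - F (-N)‖ + ‖F N - F (-N)‖ := by
            rw [norm_sub_rev (F N)]; exact norm_sub_le_norm_sub_add_norm_sub _ _ _
        _ ≤ _ := by nlinarith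
  nlinarith

end Sphere

/-! ### Fields of cones -/

open scoped RealInnerProductSpace

/-- A field of quadratic functions `v ↦ ⟪S v, v⟫ - 2 ⟪b, v⟫ + a` of the velocity, close to
`‖v‖² - 1`, over the cylinder `[0, T] × B(0, 3T)`. Its zeros are the null directions of a Lorentzian
metric, and the variable in `[0, T]` is the normalized time to the past. -/
structure ConeField (T θ : ℝ) where
  /-- The quadratic part. -/
  S : ℝ × E3 → E3 →L[ℝ] E3
  /-- The linear part. -/
  b : ℝ × E3 → E3
  /-- The constant part. -/
  a : ℝ × E3 → ℝ
  /-- The domain. -/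
  U : Set (ℝ × E3)
  isOpen : IsOpen U
  subset : Icc 0 T ×ˢ Metric.closedBall 0 (3 * T) ⊆ U
  S_smooth : ContDiffOn ℝ 2 S U
  b_smooth : ContDiffOn ℝ 2 b U
  a_smooth : ContDiffOn ℝ 2 a U
  symm : ∀ z ∈ U, ∀ v w, ⟪S z v, w⟫ = ⟪v, S z w⟫
  S_near : ∀ z ∈ U, ∀ v, ‖S z v - v‖ ≤ θ * ‖v‖
  b_near : ∀ z ∈ U, ‖b z‖ ≤ θ
  a_near : ∀ z ∈ U, |a z + 1| ≤ θ
  θ_nonneg : 0 ≤ θ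
  θ_le : θ ≤ 1 / 100
  T_pos : 0 < T

namespace ConeField

variable {T θ : ℝ} (D : ConeField T θ)

/-- The quadratic function of the velocity. -/
def Q (z : ℝ × E3) (v : E3) : ℝ := ⟪D.S z v, v⟫ - 2 * ⟪D.b z, v⟫ + D.a z

/-- Half of the gradient of `Q` in the velocity. -/
def mom (z : ℝ × E3) (v : E3) : E3 := D.S z v - D.b z

/-- Half of the gradient of `Q` in the position. -/
def force (z : ℝ × E3) (v : E3) : E3 :=
  (1 / 2 : ℝ) • (InnerProductSpace.toDual ℝ E3).symm
    ((fderiv ℝ (fun z' ↦ D.Q z' v) z).comp (ContinuousLinearMap.inr ℝ ℝ E3))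

theorem inner_force (z : ℝ × E3) (v w : E3) :
    ⟪D.force z v, w⟫ = 1 / 2 * fderiv ℝ (fun z' ↦ D.Q z' v) z (0, w) := by
  rw [force, real_inner_smul_left, InnerProductSpace.toDual_symm_apply]
  simp

variable {D}

theorem contDiffAt_Q {z : ℝ × E3} (hz : z ∈ D.U) (v : E3) :
    ContDiffAt ℝ 2 (fun y : (ℝ × E3) × E3 ↦ D.Q y.1 y.2) (z, v) := by
  have hU := D.isOpen.mem_nhds hz
  have hS : ContDiffAt ℝ 2 (fun y : (ℝ × E3) × E3 ↦ D.S y.1) (z, v) :=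
    (D.S_smooth.contDiffAt hU).comp (z, v) contDiffAt_fst
  have hb : ContDiffAt ℝ 2 (fun y : (ℝ × E3) × E3 ↦ D.b y.1) (z, v) :=
    (D.b_smooth.contDiffAt hU).comp (z, v) contDiffAt_fst
  have ha : ContDiffAt ℝ 2 (fun y : (ℝ × E3) × E3 ↦ D.a y.1) (z, v) :=
    (D.a_smooth.contDiffAt hU).comp (z, v) contDiffAt_fst
  unfold Q
  exact (((hS.clm_apply contDiffAt_snd).inner ℝ contDiffAt_snd).sub
    (contDiffAt_const.mul (hb.inner ℝ contDiffAt_snd))).add ha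

theorem contDiffAt_force {z : ℝ × E3} (hz : z ∈ D.U) (v : E3) :
    ContDiffAt ℝ 1 (fun y : (ℝ × E3) × E3 ↦ D.force y.1 y.2) (z, v) := by
  have h1 : ContDiffAt ℝ 1 (fun y : (ℝ × E3) × E3 ↦ fderiv ℝ (fun z' ↦ D.Q z' y.2) y.1) (z, v) := by
    refine ContDiffAt.fderiv (n := 2) (f := fun (y : (ℝ × E3) × E3) z' ↦ D.Q z' y.2) ?_
      contDiffAt_fst (by norm_num)
    exact ContDiffAt.comp ((z, v), z) (g := fun y : (ℝ × E3) × E3 ↦ D.Q y.1 y.2)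
      (f := fun y : ((ℝ × E3) × E3) × (ℝ × E3) ↦ (y.2, y.1.2)) (contDiffAt_Q hz v)
      (contDiffAt_snd.prodMk contDiffAt_fst.snd)
  unfold force
  refine ContDiffAt.const_smul _ ?_
  exact ((InnerProductSpace.toDual ℝ E3).symm.contDiff.contDiffAt).comp (z, v)
    (h1.clm_comp contDiffAt_const)

theorem contDiffAt_mom {z : ℝ × E3} (hz : z ∈ D.U) (v : E3) :
    ContDiffAt ℝ 1 (fun y : (ℝ × E3) × E3 ↦ D.mom y.1 y.2) (z, v) := by
  have hU := D.isOpen.mem_nhds hz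
  have hS : ContDiffAt ℝ 2 (fun y : (ℝ × E3) × E3 ↦ D.S y.1) (z, v) :=
    (D.S_smooth.contDiffAt hU).comp (z, v) contDiffAt_fst
  have hb : ContDiffAt ℝ 2 (fun y : (ℝ × E3) × E3 ↦ D.b y.1) (z, v) :=
    (D.b_smooth.contDiffAt hU).comp (z, v) contDiffAt_fst
  exact ((hS.clm_apply contDiffAt_snd).sub hb).of_le (by norm_num)

theorem Q_add {z : ℝ × E3} (hz : z ∈ D.U) (v w : E3) :
    D.Q z (v + w) = D.Q z v + 2 * ⟪D.mom z v, w⟫ + ⟪D.S z w, w⟫ := by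
  simp only [Q, mom, map_add, inner_add_left, inner_add_right, inner_sub_left]
  have := D.symm z hz w v
  rw [this, real_inner_comm (D.S z v) w]
  ring

/-- The derivative of `Q` along a line. -/
theorem hasDerivAt_Q_line {t : ℝ} {x : E3} (hz : (t, x) ∈ D.U) (v d w : E3) :
    HasDerivAt (fun ε : ℝ ↦ D.Q (t, x + ε • d) (v + ε • w))
      (2 * (⟪D.force (t, x) v, d⟫ + ⟪D.mom (t, x) v, w⟫)) 0 := by
  have hline : HasDerivAt (fun ε : ℝ ↦ ((t, x + ε • d) : ℝ × E3)) (0, d) 0 := by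
    refine (hasDerivAt_const 0 t).prodMk ?_
    simpa using ((hasDerivAt_id (0 : ℝ)).smul_const d).const_add x
  have h0 : ((t, x + (0 : ℝ) • d) : ℝ × E3) = (t, x) := by simp
  have hQ : DifferentiableAt ℝ (fun z' ↦ D.Q z' v) (t, x) :=
    DifferentiableAt.comp (t, x) (g := fun y : (ℝ × E3) × E3 ↦ D.Q y.1 y.2)
      (f := fun z' ↦ (z', v)) ((contDiffAt_Q hz v).differentiableAt (by norm_num))
      (differentiableAt_id.prodMk (differentiableAt_const v))
  have h1 : HasDerivAt (fun ε : ℝ ↦ D.Q (t, x + ε • d) v)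
      (fderiv ℝ (fun z' ↦ D.Q z' v) (t, x) (0, d)) 0 := by
    have := hQ.hasFDerivAt
    rw [← h0] at this
    have := this.comp_hasDerivAt 0 hline
    rwa [h0] at this
  have hM : DifferentiableAt ℝ (fun ε : ℝ ↦ D.mom (t, x + ε • d) v) 0 := by
    refine DifferentiableAt.comp (0 : ℝ) (g := fun y : (ℝ × E3) × E3 ↦ D.mom y.1 y.2)
      (f := fun ε : ℝ ↦ ((t, x + ε • d), v)) ?_ (hline.differentiableAt.prodMk
        (differentiableAt_const v))
    simp only [h0]
    exact (contDiffAt_mom hz v).differentiableAt (by norm_num)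
  have hS : DifferentiableAt ℝ (fun ε : ℝ ↦ D.S (t, x + ε • d)) 0 := by
    refine DifferentiableAt.comp (0 : ℝ) (g := D.S) ?_ hline.differentiableAt
    rw [h0]
    exact (D.S_smooth.contDiffAt (D.isOpen.mem_nhds hz)).differentiableAt (by norm_num)
  have h2 : HasDerivAt (fun ε : ℝ ↦ 2 * (ε * ⟪D.mom (t, x + ε • d) v, w⟫))
      (2 * ⟪D.mom (t, x) v, w⟫) 0 := by
    have := ((hasDerivAt_id (0 : ℝ)).mul
      (hM.hasDerivAt.inner ℝ (hasDerivAt_const 0 w))).const_mul 2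
    simpa using this
  have h3 : HasDerivAt (fun ε : ℝ ↦ ε ^ 2 * ⟪D.S (t, x + ε • d) w, w⟫) 0 0 := by
    have := (hasDerivAt_pow 2 (0 : ℝ)).fun_mul
      ((hS.hasDerivAt.clm_apply (hasDerivAt_const 0 w)).inner ℝ (hasDerivAt_const 0 w))
    simpa using this
  have h4 := (h1.add h2).add h3
  refine (h4.congr_of_eventuallyEq ?_).congr_deriv ?_
  · have hU : ∀ᶠ ε : ℝ in 𝓝 0, ((t, x + ε • d) : ℝ × E3) ∈ D.U :=
      hline.continuousAt.eventually_mem (by rw [h0]; exact D.isOpen.mem_nhds hz)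
    filter_upwards [hU] with ε hε
    simp only [Pi.add_apply]
    rw [Q_add hε, real_inner_smul_right, map_smul, real_inner_smul_left, real_inner_smul_right]
    ring
  · rw [inner_force]; ring

/-! ### Elementary bounds -/

theorem inner_S_near {z : ℝ × E3} (hz : z ∈ D.U) (v : E3) :
    |⟪D.S z v, v⟫ - ‖v‖ ^ 2| ≤ θ * ‖v‖ ^ 2 := by
  have h : ⟪D.S z v, v⟫ - ‖v‖ ^ 2 = ⟪D.S z v - v, v⟫ := by
    rw [inner_sub_left, real_inner_self_eq_norm_sq]
  rw [h]
  calc |⟪D.S z v - v, v⟫| ≤ ‖D.S z v - v‖ * ‖v‖ := abs_real_inner_le_norm _ _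
    _ ≤ θ * ‖v‖ * ‖v‖ := by gcongr; exact D.S_near z hz v
    _ = _ := by ring

theorem abs_inner_b_le {z : ℝ × E3} (hz : z ∈ D.U) (v : E3) : |⟪D.b z, v⟫| ≤ θ * ‖v‖ :=
  (abs_real_inner_le_norm _ _).trans (by gcongr; exact D.b_near z hz)

theorem Q_le {z : ℝ × E3} (hz : z ∈ D.U) (v : E3) :
    D.Q z v ≤ (1 + θ) * ‖v‖ ^ 2 + 2 * θ * ‖v‖ - 1 + θ := by
  have h1 := abs_le.1 (inner_S_near hz v)
  have h2 := abs_le.1 (abs_inner_b_le hz v)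
  have h3 := abs_le.1 (D.a_near z hz)
  rw [Q]; linarith

theorem le_Q {z : ℝ × E3} (hz : z ∈ D.U) (v : E3) :
    (1 - θ) * ‖v‖ ^ 2 - 2 * θ * ‖v‖ - 1 - θ ≤ D.Q z v := by
  have h1 := abs_le.1 (inner_S_near hz v)
  have h2 := abs_le.1 (abs_inner_b_le hz v)
  have h3 := abs_le.1 (D.a_near z hz)
  rw [Q]; linarith

theorem norm_lt_of_Q_le {z : ℝ × E3} (hz : z ∈ D.U) {v : E3} (h : D.Q z v ≤ 1) : ‖v‖ < 3 / 2 := by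
  have h1 := le_Q hz v
  have h2 := D.θ_nonneg
  have h3 := D.θ_le
  have h4 := norm_nonneg v
  by_contra! h5
  nlinarith [mul_le_mul_of_nonneg_right h3 (sq_nonneg ‖v‖), mul_le_mul_of_nonneg_right h3 h4]

theorem norm_mom_le {z : ℝ × E3} (hz : z ∈ D.U) {v : E3} (h : ‖v‖ ≤ 3) : ‖D.mom z v‖ ≤ 4 := by
  have h1 := D.S_near z hz v
  have h2 := D.b_near z hz
  have h3 := D.θ_le
  have h4 : D.mom z v = (D.S z v - v) + v - D.b z := by rw [mom]; abel
  have h5 := D.θ_nonneg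
  rw [h4]
  calc _ ≤ ‖D.S z v - v‖ + ‖v‖ + ‖D.b z‖ :=
        (norm_sub_le _ _).trans (by gcongr; exact norm_add_le _ _)
    _ ≤ 4 := by nlinarith [norm_nonneg v]

/-- Pairing the momentum with `v` gives `Q - a` up to the small term `⟪b, v⟫`. As `a` is close to
`-1`, this is bounded below, while `‖v‖ ≤ 3`. -/
theorem le_norm_mom {z : ℝ × E3} (hz : z ∈ D.U) {v : E3} (h : ‖v‖ ≤ 3) (hQ : -(1 / 4) ≤ D.Q z v) :
    1 / 5 ≤ ‖D.mom z v‖ := by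
  have h1 : D.Q z v = ⟪D.mom z v, v⟫ - ⟪D.b z, v⟫ + D.a z := by
    rw [Q, mom, inner_sub_left]; ring
  have h2 := abs_le.1 (abs_inner_b_le hz v)
  have h3 := abs_le.1 (D.a_near z hz)
  have h4 := real_inner_le_norm (D.mom z v) v
  have h5 := D.θ_le
  have h6 := D.θ_nonneg
  have h7 := norm_nonneg v
  have h8 := norm_nonneg (D.mom z v)
  nlinarith

end ConeField

namespace ConeField

variable {T θ : ℝ} {D : ConeField T θ}

/-! ### Extremal polygons -/

/-- The `i`-th vertex of a polygon with `N` edges, as a point of space-time. -/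
def node (_ : ConeField T θ) (N : ℕ) (x : ℕ → E3) (i : ℕ) : ℝ × E3 := (T * i / N, x i)

/-- The velocity along the `i`-th edge of a polygon. -/
def vel (_ : ConeField T θ) (N : ℕ) (x : ℕ → E3) (i : ℕ) : E3 :=
  ((N : ℝ) / T) • (x (i + 1) - x i)

variable (D) in
/-- The weight of the `i`-th edge of a polygon. -/
def weight (N : ℕ) (x : ℕ → E3) (i : ℕ) : ℝ :=
  Real.exp (N * D.Q (D.node N x i) (D.vel N x i))

variable (D) in
/-- The polygon `x` reaches the farthest point `l • e` in the direction `e` subject to a bound on the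
sum of the weights. -/
structure IsExtremal (N : ℕ) (e : E3) (l : ℝ) (x : ℕ → E3) : Prop where
  zero : x 0 = 0
  last : x N = l • e
  norm_vel_le : ∀ i < N, ‖D.vel N x i‖ ≤ 3
  sum_weight : ∑ i ∈ Finset.range N, D.weight N x i = N
  euler : ∀ k, k + 1 < N →
    D.weight N x (k + 1) • D.mom (D.node N x (k + 1)) (D.vel N x (k + 1))
      - D.weight N x k • D.mom (D.node N x k) (D.vel N x k)
    = (T / N * D.weight N x (k + 1)) • D.force (D.node N x (k + 1)) (D.vel N x (k + 1))

theorem weight_pos (N : ℕ) (x : ℕ → E3) (i : ℕ) : 0 < D.weight N x i := Real.exp_pos _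

theorem step_eq {N : ℕ} (hN : 0 < N) (x : ℕ → E3) (i : ℕ) :
    x (i + 1) = x i + (T / N : ℝ) • D.vel N x i := by
  have hN' : (N : ℝ) ≠ 0 := by positivity
  have hT := D.T_pos.ne'
  rw [vel, smul_smul, div_mul_div_cancel₀ hN', div_self hT, one_smul]
  abel

theorem norm_le_of_norm_vel_le {N : ℕ} {x : ℕ → E3} (h0 : x 0 = 0)
    (hv : ∀ i < N, ‖D.vel N x i‖ ≤ 3) {i : ℕ} (hi : i ≤ N) : ‖x i‖ ≤ 3 * (T * i / N) := by
  have hT := D.T_pos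
  induction i with
  | zero => simp [h0]
  | succ i ih =>
    have hN : 0 < N := by omega
    have hN' : (0 : ℝ) < N := by exact_mod_cast hN
    rw [step_eq (D := D) hN x i]
    calc _ ≤ ‖x i‖ + ‖(T / N : ℝ) • D.vel N x i‖ := norm_add_le _ _
      _ ≤ 3 * (T * i / N) + T / N * 3 := by
          gcongr
          · exact ih (by omega)
          · rw [norm_smul, Real.norm_of_nonneg (by positivity)]
            gcongr
            exact hv i (by omega)
      _ = _ := by push_cast; ring

theorem time_mem {N i : ℕ} (D : ConeField T θ) (hi : i ≤ N) : T * i / N ∈ Icc 0 T := by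
  have hT := D.T_pos
  refine ⟨by positivity, ?_⟩
  rcases Nat.eq_zero_or_pos N with hN | hN
  · subst hN; simp [hT.le]
  · rw [div_le_iff₀ (by exact_mod_cast hN)]
    gcongr

theorem node_mem {N : ℕ} {x : ℕ → E3} (h0 : x 0 = 0)
    (hv : ∀ i < N, ‖D.vel N x i‖ ≤ 3) {i : ℕ} (hi : i ≤ N) :
    D.node N x i ∈ Icc 0 T ×ˢ Metric.closedBall (0 : E3) (3 * T) := by
  have h1 := time_mem D hi
  refine ⟨h1, ?_⟩
  rw [mem_closedBall_zero_iff]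
  exact (norm_le_of_norm_vel_le h0 hv hi).trans (by linarith [h1.2])

theorem node_mem_U {N : ℕ} {x : ℕ → E3} (h0 : x 0 = 0)
    (hv : ∀ i < N, ‖D.vel N x i‖ ≤ 3) {i : ℕ} (hi : i ≤ N) : D.node N x i ∈ D.U :=
  D.subset (node_mem h0 hv hi)

theorem vel_add_smul (N : ℕ) (x d : ℕ → E3) (ε : ℝ) (i : ℕ) :
    D.vel N (x + ε • d) i = D.vel N x i + ε • D.vel N d i := by
  simp only [vel, Pi.add_apply, Pi.smul_apply]
  module

theorem hasDerivAt_sum_weight {N : ℕ} {x : ℕ → E3} (hx : ∀ i < N, D.node N x i ∈ D.U)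
    (d : ℕ → E3) :
    HasDerivAt (fun ε : ℝ ↦ ∑ i ∈ Finset.range N, D.weight N (x + ε • d) i)
      (∑ i ∈ Finset.range N, D.weight N x i * (N * (2 *
        (⟪D.force (D.node N x i) (D.vel N x i), d i⟫
          + ⟪D.mom (D.node N x i) (D.vel N x i), D.vel N d i⟫)))) 0 := by
  refine HasDerivAt.fun_sum fun i hi ↦ ?_
  have h := ((hasDerivAt_Q_line (hx i (Finset.mem_range.1 hi)) (D.vel N x i) (d i)
    (D.vel N d i)).const_mul (N : ℝ)).exp
  simp only [zero_smul, add_zero] at h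
  simp only [weight, vel_add_smul]
  exact h

/-- The sum of the weights is bounded by the number of edges only if all velocities are small. -/
theorem norm_vel_lt {N : ℕ} {x : ℕ → E3} {i : ℕ} (hi : i < N) (hz : D.node N x i ∈ D.U)
    (hJ : ∑ i ∈ Finset.range N, D.weight N x i ≤ N) : ‖D.vel N x i‖ < 3 / 2 := by
  have hN : (0 : ℝ) < N := by exact_mod_cast (by omega : 0 < N)
  have h1 : D.weight N x i ≤ N := (Finset.single_le_sum (f := D.weight N x)
    (fun j _ ↦ (weight_pos N x j).le) (Finset.mem_range.2 hi)).trans hJ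
  -- A single weight is at most `N`, so `N Q ≤ log N ≤ N - 1`.
  refine norm_lt_of_Q_le hz ?_
  rw [weight, ← Real.le_log_iff_exp_le hN] at h1
  have h2 := Real.log_le_sub_one_of_pos hN
  by_contra! h3
  nlinarith

/-- The maximizer comes from compactness. The straight polygon of speed `1 - 4θ` is admissible,
since along it `Q ≤ -4θ (1 - 4θ²) ≤ 0`, and this bounds the maximum below. -/
theorem exists_maximal {N : ℕ} (hN : 0 < N) {e : E3} (he : ‖e‖ = 1) :
    ∃ (l : ℝ) (x : ℕ → E3), (1 - 4 * θ) * T ≤ l ∧ x 0 = 0 ∧ x N = l • e ∧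
      (∀ i < N, ‖D.vel N x i‖ ≤ 3) ∧ ∑ i ∈ Finset.range N, D.weight N x i ≤ N ∧
      ∀ (l' : ℝ) (y : ℕ → E3), y 0 = 0 → y N = l' • e → (∀ i < N, ‖D.vel N y i‖ ≤ 3) →
        ∑ i ∈ Finset.range N, D.weight N y i ≤ N → l' ≤ l := by
  have hT := D.T_pos
  have hN' : (0 : ℝ) < N := by exact_mod_cast hN
  have hee : ∀ l : ℝ, ⟪e, l • e⟫ = l := fun l ↦ by
    rw [real_inner_smul_right, real_inner_self_eq_norm_sq, he]; ring
  -- Bounding all vertices, also those beyond `N`, makes `A` a closed subset of a product of balls,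
  -- which is compact by Tychonoff's theorem. Competitors are brought into `A` by setting the
  -- irrelevant vertices to `0`.
  set A : Set (ℕ → E3) := {x | (∀ i, ‖x i‖ ≤ 3 * T) ∧ x 0 = 0 ∧ x N = ⟪e, x N⟫ • e ∧
    ∀ i < N, ‖D.vel N x i‖ ≤ 3} with hA
  have hAc : IsCompact A := by
    have h1 : IsCompact {x : ℕ → E3 | ∀ i, ‖x i‖ ≤ 3 * T} := by
      have := isCompact_univ_pi (fun _ : ℕ ↦ isCompact_closedBall (0 : E3) (3 * T))
      convert this using 1
      ext x; simp
    refine h1.inter_right ?_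
    refine (isClosed_eq (continuous_apply 0) continuous_const).inter
      ((isClosed_eq (continuous_apply N) (by fun_prop)).inter ?_)
    have h2 : {x : ℕ → E3 | ∀ i < N, ‖D.vel N x i‖ ≤ 3} =
        ⋂ i, ⋂ (_ : i < N), {x | ‖D.vel N x i‖ ≤ 3} := by ext; simp
    change IsClosed {x : ℕ → E3 | ∀ i < N, ‖D.vel N x i‖ ≤ 3}
    rw [h2]
    refine isClosed_iInter fun i ↦ isClosed_iInter fun _ ↦ isClosed_le ?_ continuous_const
    unfold vel
    fun_prop
  have hcont : ContinuousOn (fun x ↦ ∑ i ∈ Finset.range N, D.weight N x i) A := by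
    refine continuousOn_finsetSum _ fun i hi x hx ↦ ?_
    have hi' := Finset.mem_range.1 hi
    have hz := node_mem_U (D := D) hx.2.1 hx.2.2.2 hi'.le
    refine ContinuousAt.continuousWithinAt ?_
    unfold weight
    refine Real.continuous_exp.continuousAt.comp (continuousAt_const.mul ?_)
    refine ContinuousAt.comp (f := fun x ↦ (D.node N x i, D.vel N x i))
      (g := fun y : (ℝ × E3) × E3 ↦ D.Q y.1 y.2) (contDiffAt_Q hz _).continuousAt ?_
    unfold node vel
    fun_prop
  have hK : IsCompact {x ∈ A | ∑ i ∈ Finset.range N, D.weight N x i ≤ N} := by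
    refine hAc.of_isClosed_subset ?_ (fun x hx ↦ hx.1)
    exact hcont.preimage_isClosed_of_isClosed hAc.isClosed isClosed_Iic
  -- truncation of a polygon after its last vertex
  have htrunc : ∀ (l' : ℝ) (y : ℕ → E3), y 0 = 0 → y N = l' • e → (∀ i < N, ‖D.vel N y i‖ ≤ 3) →
      ∑ i ∈ Finset.range N, D.weight N y i ≤ N →
      ∃ y' ∈ {x ∈ A | ∑ i ∈ Finset.range N, D.weight N x i ≤ N}, ⟪e, y' N⟫ = l' := by
    intro l' y h0 hl hv hJ
    set y' : ℕ → E3 := fun i ↦ if i ≤ N then y i else 0 with hy'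
    have hle : ∀ i ≤ N, y' i = y i := fun i hi ↦ by simp [hy', hi]
    have hvel : ∀ i < N, D.vel N y' i = D.vel N y i := fun i hi ↦ by
      rw [vel, vel, hle i hi.le, hle (i + 1) hi]
    have hw : ∀ i < N, D.weight N y' i = D.weight N y i := fun i hi ↦ by
      rw [weight, weight, hvel i hi, node, node, hle i hi.le]
    refine ⟨y', ⟨⟨fun i ↦ ?_, ?_, ?_, ?_⟩, ?_⟩, ?_⟩
    · by_cases hi : i ≤ N
      · rw [hle i hi]
        exact mem_closedBall_zero_iff.1 (node_mem (D := D) h0 hv hi).2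
      · simp [hy', hi, hT.le]
    · rw [hle 0 (by omega), h0]
    · rw [hle N le_rfl, hl, hee]
    · intro i hi
      rw [hvel i hi]; exact hv i hi
    · rw [Finset.sum_congr rfl fun i hi ↦ hw i (Finset.mem_range.1 hi)]
      exact hJ
    · rw [hle N le_rfl, hl, hee]
  -- the straight polygon
  have hθ0 := D.θ_nonneg
  have hθ1 := D.θ_le
  set c : ℝ := 1 - 4 * θ with hc
  have hstraight : ∃ y : ℕ → E3, y 0 = 0 ∧ y N = (c * T) • e ∧ (∀ i < N, ‖D.vel N y i‖ ≤ 3) ∧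
      ∑ i ∈ Finset.range N, D.weight N y i ≤ N := by
    refine ⟨fun i ↦ (c * T * i / N) • e, by simp, ?_, ?_, ?_⟩
    · simp only
      rw [mul_div_assoc, div_self hN'.ne', mul_one]
    all_goals
      have hvel : ∀ i, D.vel N (fun i ↦ (c * T * i / N) • e) i = c • e := by
        intro i
        rw [vel, ← sub_smul, smul_smul]
        congr 1
        push_cast
        field_simp
        ring
    · intro i _
      rw [hvel, norm_smul, he, Real.norm_of_nonneg (by linarith)]
      linarith
    · have hw : ∀ i ∈ Finset.range N, D.weight N (fun i ↦ (c * T * i / N) • e) i ≤ 1 := by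
        intro i hi
        have hz : D.node N (fun i ↦ (c * T * i / N) • e) i ∈ D.U := by
          refine node_mem_U (by simp) (fun j _ ↦ ?_) (Finset.mem_range.1 hi).le
          rw [hvel, norm_smul, he, Real.norm_of_nonneg (by linarith)]
          linarith
        rw [weight, Real.exp_le_one_iff, hvel]
        refine mul_nonpos_of_nonneg_of_nonpos hN'.le ((Q_le hz _).trans ?_)
        rw [norm_smul, he, Real.norm_of_nonneg (by linarith), hc]
        nlinarith [mul_nonneg hθ0 (by nlinarith : 0 ≤ 1 - 4 * θ ^ 2)]
      simpa using Finset.sum_le_sum hw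
  obtain ⟨y, hy0, hyN, hyv, hyJ⟩ := hstraight
  obtain ⟨y', hy', hy'l⟩ := htrunc _ y hy0 hyN hyv hyJ
  obtain ⟨x, hx, hmax⟩ := hK.exists_isMaxOn ⟨y', hy'⟩
    (f := fun x : ℕ → E3 ↦ ⟪e, x N⟫) (by fun_prop)
  refine ⟨⟪e, x N⟫, x, ?_, hx.1.2.1, hx.1.2.2.1, hx.1.2.2.2, hx.2, fun l' w h0 hl hv hJ ↦ ?_⟩
  · rw [← hy'l]; exact hmax hy'
  · obtain ⟨w', hw', hw'l⟩ := htrunc l' w h0 hl hv hJ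
    rw [← hw'l]; exact hmax hw'

/-- A maximizer also minimizes the sum of the weights among the nearby polygons with the same ends.
If that sum could drop below `N`, shifting each vertex by a small multiple of `i • e` would move the
endpoint farther out within the constraint. Stationarity of the sum under motions of a single
interior vertex then gives the Euler equation, without a Lagrange multiplier. -/
theorem exists_isExtremal {N : ℕ} (hN : 0 < N) {e : E3} (he : ‖e‖ = 1) :
    ∃ (l : ℝ) (x : ℕ → E3), (1 - 4 * θ) * T ≤ l ∧ D.IsExtremal N e l x := by
  obtain ⟨l, x, hl, h0, hxN, hv, hJ, hmax⟩ := exists_maximal (D := D) hN he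
  have hT := D.T_pos
  have hN' : (0 : ℝ) < N := by exact_mod_cast hN
  have hlt : ∀ (y : ℕ → E3), y 0 = 0 → (∀ i < N, ‖D.vel N y i‖ ≤ 3) →
      ∑ i ∈ Finset.range N, D.weight N y i ≤ N → ∀ i < N, ‖D.vel N y i‖ < 3 := by
    intro y hy0 hyv hyJ i hi
    exact (norm_vel_lt hi (node_mem_U hy0 hyv hi.le) hyJ).trans (by norm_num)
  -- small perturbations keep the velocities bounded
  have hpert : ∀ (y d : ℕ → E3), (∀ i < N, ‖D.vel N y i‖ < 3) →
      ∀ᶠ ε : ℝ in 𝓝 0, ∀ i < N, ‖D.vel N (y + ε • d) i‖ < 3 := by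
    intro y d hy
    have : ∀ᶠ ε : ℝ in 𝓝 0, ∀ i ∈ Finset.range N, ‖D.vel N (y + ε • d) i‖ < 3 := by
      rw [Filter.eventually_all_finset]
      intro i hi
      have hc : ContinuousAt (fun ε : ℝ ↦ ‖D.vel N (y + ε • d) i‖) 0 := by
        simp only [vel_add_smul]
        fun_prop
      refine hc.eventually_lt continuousAt_const ?_
      simpa using hy i (Finset.mem_range.1 hi)
    simpa using this
  -- the sum of the weights cannot be decreased
  have hmin : ∀ y : ℕ → E3, y 0 = 0 → y N = l • e → (∀ i < N, ‖D.vel N y i‖ < 3) →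
      (N : ℝ) ≤ ∑ i ∈ Finset.range N, D.weight N y i := by
    intro y hy0 hyN hyv
    by_contra! hlt'
    set d : ℕ → E3 := fun i ↦ (i : ℝ) • e with hd
    have hcont := (hasDerivAt_sum_weight (D := D)
      (fun i hi ↦ node_mem_U hy0 (fun i hi ↦ (hyv i hi).le) hi.le) d).continuousAt
    have h1 := hcont.eventually_lt (continuousAt_const (y := (N : ℝ))) (by simpa using hlt')
    have h2 := hpert y d hyv
    have h3 : ∀ᶠ ε : ℝ in 𝓝[>] 0, 0 < ε := self_mem_nhdsWithin
    obtain ⟨ε, ⟨h1, h2⟩, h3⟩ := (((h1.and h2).filter_mono nhdsWithin_le_nhds).and h3).exists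
    have := hmax (l + ε * N) (y + ε • d) (by simp [hy0, hd])
      (by simp [hyN, hd, smul_smul, add_smul]) (fun i hi ↦ (h2 i hi).le) h1.le
    nlinarith
  have hstrict := hlt x h0 hv hJ
  have hsum : ∑ i ∈ Finset.range N, D.weight N x i = N := le_antisymm hJ (hmin x h0 hxN hstrict)
  refine ⟨l, x, hl, h0, hxN, hv, hsum, fun k hk ↦ ?_⟩
  refine ext_inner_right ℝ fun w ↦ ?_
  set d : ℕ → E3 := Pi.single (k + 1) w with hd
  have hd1 : d (k + 1) = w := by simp [hd]
  have hd0 : ∀ i, i ≠ k + 1 → d i = 0 := fun i hi ↦ by simp [hd, hi]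
  have hderiv := hasDerivAt_sum_weight (D := D) (fun i hi ↦ node_mem_U h0 hv hi.le) d
  have hloc : IsLocalMin (fun ε : ℝ ↦ ∑ i ∈ Finset.range N, D.weight N (x + ε • d) i) 0 := by
    filter_upwards [hpert x d hstrict] with ε hε
    simp only [zero_smul, add_zero]
    rw [hsum]
    exact hmin _ (by simp [h0, hd0]) (by simp [hxN, hd0 N (by omega)]) hε
  have hzero := hloc.hasDerivAt_eq_zero hderiv
  have hsub : ({k, k + 1} : Finset ℕ) ⊆ Finset.range N := by
    intro i hi
    simp only [Finset.mem_insert, Finset.mem_singleton] at hi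
    rw [Finset.mem_range]; omega
  -- Only the two edges at the vertex `k + 1` change. Since `Q` is evaluated at the initial vertex
  -- of an edge, the force enters only through the edge `k + 1`.
  rw [← Finset.sum_subset hsub ?_, Finset.sum_pair (by omega)] at hzero
  · have hv1 : D.vel N d k = ((N : ℝ) / T) • w := by
      rw [vel, hd1, hd0 k (by omega), sub_zero]
    have hv2 : D.vel N d (k + 1) = -(((N : ℝ) / T) • w) := by
      rw [vel, hd1, hd0 (k + 1 + 1) (by omega), zero_sub, smul_neg]
    rw [hd1, hd0 k (by omega), hv1, hv2, inner_neg_right, real_inner_smul_right,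
      real_inner_smul_right, inner_zero_right] at hzero
    rw [inner_sub_left, real_inner_smul_left, real_inner_smul_left, real_inner_smul_left]
    have h2N : (N : ℝ) * 2 ≠ 0 := by positivity
    field_simp at hzero ⊢
    rw [zero_mul, mul_eq_zero, or_iff_right h2N] at hzero
    linarith
  · intro i _ hi
    simp only [Finset.mem_insert, Finset.mem_singleton, not_or] at hi
    have : D.vel N d i = 0 := by
      rw [vel, hd0 i hi.2, hd0 (i + 1) (by omega), sub_zero, smul_zero]
    rw [this, hd0 i hi.2]
    simp

end ConeField

/-! ### Uniform bounds along extremal polygons, by a discrete Gronwall argument. -/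

theorem le_pow_mul_of_step {R : ℕ → ℝ} {q : ℝ} {N : ℕ} (hq : 1 ≤ q) (hR : ∀ i, 0 ≤ R i)
    (h : ∀ k, k + 1 < N → R k ≤ q * R (k + 1) ∧ R (k + 1) ≤ q * R k) {i j : ℕ} (hi : i < N)
    (hj : j < N) : R i ≤ q ^ N * R j := by
  have h1 : ∀ n i, i + n < N → R i ≤ q ^ n * R (i + n) ∧ R (i + n) ≤ q ^ n * R i := by
    intro n
    induction n with
    | zero => intro i _; simp
    | succ n ih =>
      intro i hi
      obtain ⟨h2, h3⟩ := ih i (by omega)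
      obtain ⟨h4, h5⟩ := h (i + n) (by omega)
      have hqn : 0 ≤ q ^ n := by positivity
      rw [← add_assoc, pow_succ]
      constructor
      · nlinarith
      · nlinarith
  have h2 : ∃ n ≤ N, R i ≤ q ^ n * R j := by
    rcases le_total i j with hij | hij
    · obtain ⟨n, rfl⟩ := Nat.exists_eq_add_of_le hij
      exact ⟨n, by omega, (h1 n i hj).1⟩
    · obtain ⟨n, rfl⟩ := Nat.exists_eq_add_of_le hij
      exact ⟨n, by omega, (h1 n j hi).2⟩
  obtain ⟨n, hn, h3⟩ := h2
  exact h3.trans (mul_le_mul_of_nonneg_right (pow_le_pow_right₀ hq hn) (hR j))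

namespace ConeField

variable {T θ : ℝ} {D : ConeField T θ}

variable (D) in
/-- The momentum along the `i`-th edge of a polygon. -/
def moment (N : ℕ) (x : ℕ → E3) (i : ℕ) : E3 :=
  D.weight N x i • D.mom (D.node N x i) (D.vel N x i)

variable (D) in
theorem exists_norm_force_le : ∃ C : ℝ, 0 < C ∧
    ∀ z ∈ Icc 0 T ×ˢ Metric.closedBall (0 : E3) (3 * T), ∀ v : E3, ‖v‖ ≤ 3 →
      ‖D.force z v‖ ≤ C := by
  have hK : IsCompact ((Icc 0 T ×ˢ Metric.closedBall (0 : E3) (3 * T)) ×ˢ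
      Metric.closedBall (0 : E3) 3) :=
    (isCompact_Icc.prod (isCompact_closedBall _ _)).prod (isCompact_closedBall _ _)
  obtain ⟨C, hC⟩ := hK.exists_bound_of_continuousOn
    (f := fun y : (ℝ × E3) × E3 ↦ D.force y.1 y.2)
    fun y hy ↦ (contDiffAt_force (D.subset hy.1) y.2).continuousAt.continuousWithinAt
  exact ⟨max C 1, by positivity, fun z hz v hv ↦
    (hC (z, v) ⟨hz, mem_closedBall_zero_iff.2 hv⟩).trans (le_max_left _ _)⟩

variable (D) in
/-- Along an extremal polygon, the weights and momenta are bounded above and below, and the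
velocities are nearly null. -/
theorem exists_extremal_bounds : ∃ C : ℝ, 1 ≤ C ∧ ∀ᶠ N : ℕ in atTop, ∀ (e : E3) (l : ℝ)
    (x : ℕ → E3), D.IsExtremal N e l x → ∀ i < N,
      D.weight N x i ∈ Icc C⁻¹ C ∧ ‖D.moment N x i‖ ∈ Icc C⁻¹ C ∧
        |D.Q (D.node N x i) (D.vel N x i)| ≤ C / N := by
  obtain ⟨Cg, hCg, hforce⟩ := D.exists_norm_force_le
  have hT := D.T_pos
  -- The Gronwall factor: `(1 + 2β) ^ N ≤ exp (2 β N)` with `β N = 5 Cg T`.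
  set Γ := Real.exp (10 * Cg * T) with hΓ
  have hΓ1 : 1 ≤ Γ := Real.one_le_exp (by positivity)
  have hlim : Tendsto (fun N : ℕ ↦ Real.exp (-((N : ℝ) / 4))) atTop (𝓝 0) :=
    Real.tendsto_exp_neg_atTop_nhds_zero.comp
      (tendsto_natCast_atTop_atTop.atTop_div_const (by norm_num))
  have hlim2 : Tendsto (fun N : ℕ ↦ 5 * Cg * T / (N : ℝ)) atTop (𝓝 0) :=
    tendsto_const_nhds.div_atTop tendsto_natCast_atTop_atTop
  refine ⟨40 * Γ, by linarith, ?_⟩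
  filter_upwards [hlim.eventually_lt_const (show (0 : ℝ) < 1 / (10 * Γ) by positivity),
    hlim2.eventually_lt_const (show (0 : ℝ) < 1 / 2 by norm_num), eventually_gt_atTop 0]
    with N hη hβ hN e l x hx
  set η := Real.exp (-((N : ℝ) / 4)) with hηdef
  set β := 5 * Cg * T / (N : ℝ) with hβdef
  have hN' : (0 : ℝ) < N := by exact_mod_cast hN
  have hη0 : 0 < η := Real.exp_pos _
  have hη1 : η ≤ 1 := Real.exp_le_one_iff.2 (by linarith)
  have hβ0 : 0 ≤ β := by positivity
  have hnode : ∀ i < N, D.node N x i ∈ D.U := fun i hi ↦ node_mem_U hx.zero hx.norm_vel_le hi.le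
  have hPn : ∀ i, ‖D.moment N x i‖ = D.weight N x i * ‖D.mom (D.node N x i) (D.vel N x i)‖ :=
    fun i ↦ by rw [moment, norm_smul, Real.norm_of_nonneg (weight_pos N x i).le]
  have hw5 : ∀ i < N, -(1 / 4) ≤ D.Q (D.node N x i) (D.vel N x i) →
      D.weight N x i ≤ 5 * ‖D.moment N x i‖ := fun i hi hQ ↦ by
    have h1 := le_norm_mom (hnode i hi) (hx.norm_vel_le i hi) hQ
    rw [hPn]
    nlinarith [weight_pos (D := D) N x i]
  have hw : ∀ i < N, D.weight N x i ≤ 5 * ‖D.moment N x i‖ + η := fun i hi ↦ by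
    rcases le_or_gt (-(1 / 4)) (D.Q (D.node N x i) (D.vel N x i)) with hQ | hQ
    · linarith [hw5 i hi hQ]
    · have : D.weight N x i ≤ η := Real.exp_le_exp.2 (by nlinarith)
      linarith [norm_nonneg (D.moment N x i)]
  have hw4 : ∀ i < N, ‖D.moment N x i‖ ≤ 4 * D.weight N x i := fun i hi ↦ by
    rw [hPn]
    nlinarith [weight_pos (D := D) N x i, norm_mom_le (hnode i hi) (hx.norm_vel_le i hi)]
  -- The summand `η` takes care of edges with `Q < -1/4`: their momentum may be small, but their
  -- weight is at most `exp (-N / 4)`. So the weight is at most `5 R` on every edge, and by the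
  -- Euler equation `R` changes by a factor `1 + O(1/N)` per step.
  set R : ℕ → ℝ := fun i ↦ ‖D.moment N x i‖ + η with hR
  have hR0 : ∀ i, 0 ≤ R i := fun i ↦ by positivity
  have hstep : ∀ k, k + 1 < N → R k ≤ (1 + 2 * β) * R (k + 1) ∧ R (k + 1) ≤ (1 + 2 * β) * R k := by
    intro k hk
    have h1 : ‖D.moment N x (k + 1) - D.moment N x k‖ ≤ β * R (k + 1) := by
      rw [moment, moment, hx.euler k hk, norm_smul,
        Real.norm_of_nonneg (mul_nonneg (by positivity) (weight_pos N x _).le)]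
      have h2 := hforce _ (node_mem hx.zero hx.norm_vel_le hk.le) _ (hx.norm_vel_le _ hk)
      calc _ ≤ T / N * (5 * R (k + 1)) * Cg := by
            gcongr
            have := hw _ hk
            simp only [hR]; linarith
        _ = _ := by rw [hβdef]; ring
    have h3 := norm_sub_norm_le (D.moment N x (k + 1)) (D.moment N x k)
    have h4 := norm_sub_norm_le (D.moment N x k) (D.moment N x (k + 1))
    rw [norm_sub_rev] at h4
    have h5 : |R (k + 1) - R k| ≤ β * R (k + 1) := by
      simp only [hR] at h1 ⊢; rw [abs_le]; constructor <;> linarith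
    have h6 := abs_le.1 h5
    have h7 := hR0 (k + 1)
    have h8 := hR0 k
    constructor
    · nlinarith
    · nlinarith [mul_nonneg hβ0 h7, mul_nonneg hβ0 h8,
        mul_nonneg hβ0 (by nlinarith : 0 ≤ R k - (1 - β) * R (k + 1))]
  have hcomp : ∀ i < N, ∀ j < N, R i ≤ Γ * R j := by
    intro i hi j hj
    refine (le_pow_mul_of_step (by linarith) hR0 hstep hi hj).trans ?_
    refine mul_le_mul_of_nonneg_right ?_ (hR0 j)
    calc (1 + 2 * β) ^ N ≤ Real.exp (2 * β) ^ N := by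
          gcongr
          linarith [Real.add_one_le_exp (2 * β)]
      _ = Γ := by
          rw [← Real.exp_nat_mul, hΓ, hβdef]
          congr 1
          field_simp
          ring
  -- The weights have mean `1`, so one of them is at least `1` and one is at most `1`. Comparability
  -- of the momenta carries these two bounds to all edges.
  obtain ⟨i₁, hi₁, h₁⟩ : ∃ i < N, 1 ≤ D.weight N x i := by
    by_contra! hcon
    have : ∑ i ∈ Finset.range N, D.weight N x i < ∑ i ∈ Finset.range N, (1 : ℝ) :=
      Finset.sum_lt_sum_of_nonempty ⟨0, Finset.mem_range.2 hN⟩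
        fun i hi ↦ hcon i (Finset.mem_range.1 hi)
    rw [hx.sum_weight] at this
    simp at this
  obtain ⟨i₂, hi₂, h₂⟩ : ∃ i < N, D.weight N x i ≤ 1 := by
    by_contra! hcon
    have : ∑ i ∈ Finset.range N, (1 : ℝ) < ∑ i ∈ Finset.range N, D.weight N x i :=
      Finset.sum_lt_sum_of_nonempty ⟨0, Finset.mem_range.2 hN⟩
        fun i hi ↦ hcon i (Finset.mem_range.1 hi)
    rw [hx.sum_weight] at this
    simp at this
  have hQ₁ : 0 ≤ D.Q (D.node N x i₁) (D.vel N x i₁) := by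
    rw [weight, Real.one_le_exp_iff] at h₁
    exact nonneg_of_mul_nonneg_right h₁ hN'
  have hlow : ∀ j < N, 1 / (10 * Γ) ≤ ‖D.moment N x j‖ := by
    intro j hj
    have h1 := hcomp i₁ hi₁ j hj
    have h2 := hw5 i₁ hi₁ (by linarith)
    have h3 : 1 / 5 ≤ Γ * R j := by simp only [hR] at h1 ⊢; linarith
    have h4 : 1 / (5 * Γ) ≤ R j := by
      rw [div_le_iff₀ (by positivity)]; linarith
    have h5 : 1 / (5 * Γ) = 1 / (10 * Γ) + 1 / (10 * Γ) := by field_simp; norm_num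
    simp only [hR] at h4
    linarith
  have hup : ∀ j < N, ‖D.moment N x j‖ ≤ 5 * Γ := by
    intro j hj
    have h1 := hcomp j hj i₂ hi₂
    have h2 := hw4 i₂ hi₂
    simp only [hR] at h1
    nlinarith
  intro i hi
  have hl := hlow i hi
  have hu := hup i hi
  have hwl : (40 * Γ)⁻¹ ≤ D.weight N x i := by
    have := hw4 i hi
    have h5 : (40 * Γ)⁻¹ = 1 / (10 * Γ) / 4 := by field_simp; norm_num
    rw [h5]; linarith
  have hwu : D.weight N x i ≤ 40 * Γ := by
    have := hw i hi
    linarith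
  refine ⟨⟨hwl, hwu⟩, ⟨le_trans ?_ hl, by linarith⟩, ?_⟩
  · rw [one_div]
    gcongr
    norm_num
  -- `N Q` is the logarithm of the weight, which has just been bounded on both sides.
  · rw [le_div_iff₀ hN', ← abs_of_pos hN', ← abs_mul, mul_comm, abs_le]
    have hpos : 0 < 40 * Γ := by positivity
    have hlog : Real.log (40 * Γ) ≤ 40 * Γ := (Real.log_le_sub_one_of_pos hpos).trans (by linarith)
    rw [weight] at hwl hwu
    have h1 := (Real.le_log_iff_exp_le hpos).2 hwu
    have h2 := (Real.log_le_iff_le_exp (by positivity)).2 hwl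
    rw [Real.log_inv] at h2
    constructor <;> linarith

end ConeField

/-! ### Convergence of Euler polygons -/

/-- A curve whose speed is bounded by the derivative of `B` moves at most as far as `B`. -/
theorem norm_sub_le_of_norm_deriv_le {Y : Type*} [NormedAddCommGroup Y] [NormedSpace ℝ Y]
    {f f' : ℝ → Y} {B B' : ℝ → ℝ} {a b : ℝ} (hab : a ≤ b)
    (hf : ∀ s ∈ Icc a b, HasDerivWithinAt f (f' s) (Icc a b) s)
    (hB : ∀ s ∈ Icc a b, HasDerivWithinAt B (B' s) (Icc a b) s)
    (h : ∀ s ∈ Icc a b, ‖f' s‖ ≤ B' s) : ‖f b - f a‖ ≤ B b - B a := by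
  refine image_norm_le_of_norm_deriv_right_le_deriv_boundary'
    (f := fun r ↦ f r - f a) (f' := f') (B := fun r ↦ B r - B a) (B' := B') (a := a) (b := b)
    ?_ ?_ (by simp) ?_ ?_ (fun s hs ↦ h s (Ico_subset_Icc_self hs)) (right_mem_Icc.2 hab)
  · exact ContinuousOn.sub (fun s hs ↦ (hf s hs).continuousWithinAt) continuousOn_const
  · intro s hs
    exact ((hf s (Ico_subset_Icc_self hs)).sub_const _).mono_of_mem_nhdsWithin
      (mem_of_superset (Icc_mem_nhdsGE hs.2) (Icc_subset_Icc_left hs.1))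
  · exact ContinuousOn.sub (fun s hs ↦ (hB s hs).continuousWithinAt) continuousOn_const
  · intro s hs
    exact ((hB s (Ico_subset_Icc_self hs)).sub_const _).mono_of_mem_nhdsWithin
      (mem_of_superset (Icc_mem_nhdsGE hs.2) (Icc_subset_Icc_left hs.1))

/-- Polygons that satisfy the Euler scheme of the differential equation `dy/dτ = f (τ, y)` up to small
errors are close to the solution `y`, which is parametrized here by an arbitrary parameter `s`. -/
theorem euler_scheme_close {Y : Type*} [NormedAddCommGroup Y] [NormedSpace ℝ Y] {T s₁ K ρ : ℝ}
    (hT : 0 < T) (hs₁ : 0 ≤ s₁) (hK : 0 ≤ K) (hρ : 0 < ρ) {τ m : ℝ → ℝ} {y : ℝ → Y}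
    {f : ℝ → Y → Y} (hτ0 : τ 0 = 0)
    (hτ : ∀ s ∈ Icc 0 s₁, HasDerivWithinAt τ (m s) (Icc 0 s₁) s) (hm : ∀ s ∈ Icc 0 s₁, 0 < m s)
    (hy : ∀ s ∈ Icc 0 s₁, HasDerivWithinAt y (m s • f (τ s) (y s)) (Icc 0 s₁) s)
    (hf : ContinuousOn (fun s ↦ f (τ s) (y s)) (Icc 0 s₁))
    (hlip : ∀ s ∈ Icc 0 s₁, ∀ z, ‖z - y s‖ ≤ ρ →
      ‖f (τ s) z - f (τ s) (y s)‖ ≤ K * ‖z - y s‖) {ν : ℝ} (hν : 0 < ν) :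
    ∃ δ > 0, ∀ N : ℕ, T / N ≤ δ → ∀ z : ℕ → Y, ‖z 0 - y 0‖ ≤ δ →
      (∀ k, k + 1 < N → ‖z (k + 1) - z k - (T / N : ℝ) • f (T * k / N) (z k)‖ ≤ T / N * δ) →
      ∀ k < N, ∀ s ∈ Icc 0 s₁, τ s = T * k / N → ‖z k - y s‖ ≤ ν := by
  have hτc : ContinuousOn τ (Icc 0 s₁) := fun s hs ↦ (hτ s hs).continuousWithinAt
  have hτmono : StrictMonoOn τ (Icc 0 s₁) := by
    refine strictMonoOn_of_deriv_pos (convex_Icc _ _) hτc fun s hs ↦ ?_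
    rw [interior_Icc] at hs
    rw [((hτ s (Ioo_subset_Icc_self hs)).hasDerivAt (Icc_mem_nhds hs.1 hs.2)).deriv]
    exact hm s (Ioo_subset_Icc_self hs)
  set E := Real.exp (K * T) with hE
  have hE0 : 0 < E := Real.exp_pos _
  -- The initial error is at most `δ₁`, the scheme and the exact solution each contribute at most
  -- `δ₁ T`, and `E` bounds their amplification. The bound by `ρ` keeps the polygon where `f` is
  -- known to be Lipschitz.
  obtain ⟨δ₁, hδ₁, hδE⟩ : ∃ δ₁ > 0, E * (δ₁ * (1 + 2 * T)) ≤ min ν ρ := by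
    refine ⟨min ν ρ / (E * (1 + 2 * T)), by positivity, le_of_eq ?_⟩
    field_simp
  -- uniform continuity of the right-hand side with respect to `τ`
  obtain ⟨δ₂, hδ₂, huc⟩ : ∃ δ₂ > 0, ∀ s ∈ Icc 0 s₁, ∀ s' ∈ Icc 0 s₁, |τ s - τ s'| ≤ δ₂ →
      ‖f (τ s) (y s) - f (τ s') (y s')‖ ≤ δ₁ := by
    -- The pairs at which the right-hand sides differ by at least `δ₁` form a compact set. As `τ` is
    -- injective, `|τ s - τ s'|` has a positive minimum on it, unless it is empty.
    set A : Set (ℝ × ℝ) := {q ∈ Icc 0 s₁ ×ˢ Icc 0 s₁ |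
      ‖f (τ q.1) (y q.1) - f (τ q.2) (y q.2)‖ ∈ Ici δ₁} with hA
    have hc : ContinuousOn (fun q : ℝ × ℝ ↦ ‖f (τ q.1) (y q.1) - f (τ q.2) (y q.2)‖)
        (Icc 0 s₁ ×ˢ Icc 0 s₁) :=
      ((hf.comp continuousOn_fst fun q hq ↦ hq.1).sub
        (hf.comp continuousOn_snd fun q hq ↦ hq.2)).norm
    have hAc : IsCompact A := (isCompact_Icc.prod isCompact_Icc).of_isClosed_subset
      (hc.preimage_isClosed_of_isClosed (isClosed_Icc.prod isClosed_Icc) isClosed_Ici)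
      fun q hq ↦ hq.1
    have hd : ContinuousOn (fun q : ℝ × ℝ ↦ |τ q.1 - τ q.2|) A :=
      (((hτc.comp continuousOn_fst fun q hq ↦ hq.1).sub
        (hτc.comp continuousOn_snd fun q hq ↦ hq.2)).mono fun q hq ↦ hq.1).abs
    rcases A.eq_empty_or_nonempty with hAe | hAn
    · refine ⟨1, one_pos, fun s hs s' hs' _ ↦ ?_⟩
      by_contra! h
      have : (s, s') ∈ A := ⟨⟨hs, hs'⟩, h.le⟩
      simp [hAe] at this
    · obtain ⟨q, hq, hmin⟩ := hAc.exists_isMinOn hAn hd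
      have hne : τ q.1 ≠ τ q.2 := by
        intro h
        have := hτmono.injOn hq.1.1 hq.1.2 h
        have h2 := hq.2
        rw [this, sub_self, norm_zero, mem_Ici] at h2
        linarith
      have hpos : 0 < |τ q.1 - τ q.2| := abs_pos.2 (sub_ne_zero.2 hne)
      refine ⟨|τ q.1 - τ q.2| / 2, by positivity, fun s hs s' hs' h ↦ ?_⟩
      by_contra! h'
      have := hmin (show (s, s') ∈ A from ⟨⟨hs, hs'⟩, h'.le⟩)
      simp only [mem_ofPred_eq] at this
      linarith
  refine ⟨min δ₁ δ₂, lt_min hδ₁ hδ₂, fun N hN z hz0 hz ↦ ?_⟩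
  intro k hk
  have hN0 : (0 : ℝ) < N := by exact_mod_cast (by omega : 0 < N)
  set h := T / (N : ℝ) with hh
  have hh0 : 0 < h := by positivity
  have htime : ∀ k : ℕ, T * k / N = h * k := fun k ↦ by rw [hh]; ring
  have hhk : ∀ k : ℕ, k ≤ N → h * k ≤ T := fun k hk ↦ by
    rw [hh, div_mul_eq_mul_div, div_le_iff₀ hN0]
    gcongr
  have hpow : ∀ k : ℕ, k ≤ N → (1 + K * h) ^ k ≤ E := fun k hk ↦ by
    calc (1 + K * h) ^ k ≤ Real.exp (K * h) ^ k := by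
          gcongr
          linarith [Real.add_one_le_exp (K * h)]
      _ = Real.exp (k * (K * h)) := (Real.exp_nat_mul _ _).symm
      _ ≤ E := Real.exp_le_exp.2 (by nlinarith [hhk k hk])
  have hkey : ∀ k < N, ∀ s ∈ Icc 0 s₁, τ s = T * k / N →
      ‖z k - y s‖ ≤ (1 + K * h) ^ k * (δ₁ + 2 * δ₁ * (h * k)) := by
    intro k
    induction k with
    | zero =>
      intro _ s hs hτs
      have : s = 0 := hτmono.injOn hs ⟨le_rfl, hs₁⟩ (by rw [hτs, hτ0]; simp)
      subst this
      simpa using hz0.trans (min_le_left _ _)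
    | succ k ih =>
      intro hk s hs hτs
      obtain ⟨s', hs', hτs'⟩ : T * k / N ∈ τ '' Icc 0 s := by
        refine intermediate_value_Icc hs.1 (hτc.mono (Icc_subset_Icc_right hs.2)) ⟨?_, ?_⟩
        · rw [hτ0]; positivity
        · rw [hτs, htime, htime]; push_cast; nlinarith
      have hs's : s' ∈ Icc 0 s₁ := ⟨hs'.1, hs'.2.trans hs.2⟩
      have hih := ih (by omega) s' hs's hτs'
      have hclose : ‖z k - y s'‖ ≤ ρ := by
        refine hih.trans (le_trans ?_ (hδE.trans (min_le_right _ _)))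
        refine mul_le_mul (hpow k (by omega)) (by nlinarith [hhk k (by omega)])
          (by positivity) hE0.le
      -- the exact solution over one step
      have hstep : ‖y s - y s' - (τ s - τ s') • f (τ s') (y s')‖ ≤ δ₁ * (τ s - τ s') := by
        have hsub : Icc s' s ⊆ Icc 0 s₁ := Icc_subset_Icc hs'.1 hs.2
        have := norm_sub_le_of_norm_deriv_le hs'.2
          (f := fun r ↦ y r - (τ r - τ s') • f (τ s') (y s'))
          (f' := fun r ↦ m r • f (τ r) (y r) - m r • f (τ s') (y s'))
          (B := fun r ↦ δ₁ * τ r) (B' := fun r ↦ δ₁ * m r)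
          (fun r hr ↦ ((hy r (hsub hr)).fun_sub
            (((hτ r (hsub hr)).sub_const _).smul_const _)).mono hsub)
          (fun r hr ↦ ((hτ r (hsub hr)).const_mul δ₁).mono hsub) ?_
        · simp only [sub_self, zero_smul, sub_zero, ← mul_sub] at this
          rwa [sub_right_comm] at this
        · intro r hr
          have hr' := hsub hr
          rw [← smul_sub, norm_smul, Real.norm_of_nonneg (hm r hr').le, mul_comm]
          refine mul_le_mul_of_nonneg_right (huc r hr' s' hs's ?_) (hm r hr').le
          have h1 := hτmono.monotoneOn hs's hr' hr.1
          have h2 := hτmono.monotoneOn hr' hs hr.2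
          rw [abs_of_nonneg (by linarith)]
          have h3 : τ s - τ s' = h := by rw [hτs, hτs', htime, htime]; push_cast; ring
          have := hN.trans (min_le_right δ₁ δ₂)
          linarith
      have hdτ : τ s - τ s' = h := by rw [hτs, hτs', htime, htime]; push_cast; ring
      rw [hdτ] at hstep
      have hz' := hz k hk
      rw [← hτs'] at hz'
      have hl := hlip s' hs's (z k) hclose
      -- The terms are the error of the scheme in this step, the deviation of the exact solution
      -- from its tangent, the previous error, and the effect of that error on `f`.
      have hdecomp : z (k + 1) - y s = (z (k + 1) - z k - h • f (τ s') (z k))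
          - (y s - y s' - h • f (τ s') (y s')) + (z k - y s')
          + h • (f (τ s') (z k) - f (τ s') (y s')) := by
        rw [smul_sub]; abel
      have hbound : ‖z (k + 1) - y s‖ ≤ (1 + K * h) * ‖z k - y s'‖ + 2 * δ₁ * h := by
        rw [hdecomp]
        refine (norm_add_le _ _).trans ?_
        refine (add_le_add_left ((norm_add_le _ _).trans
          (add_le_add_left (norm_sub_le _ _) _)) _).trans ?_
        rw [norm_smul, Real.norm_of_nonneg hh0.le]
        have h1 : h * min δ₁ δ₂ ≤ h * δ₁ := by gcongr; exact min_le_left _ _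
        nlinarith
      refine hbound.trans ?_
      have h1K : 1 ≤ 1 + K * h := by nlinarith [mul_nonneg hK hh0.le]
      have hp1 : 1 ≤ (1 + K * h) ^ (k + 1) := one_le_pow₀ h1K
      calc (1 + K * h) * ‖z k - y s'‖ + 2 * δ₁ * h
          ≤ (1 + K * h) * ((1 + K * h) ^ k * (δ₁ + 2 * δ₁ * (h * k)))
            + (1 + K * h) ^ (k + 1) * (2 * δ₁ * h) := by
            refine add_le_add (by gcongr) (le_mul_of_one_le_left (by positivity) hp1)
        _ = _ := by push_cast; ring
  intro s hs hτs
  refine (hkey k hk s hs hτs).trans (le_trans ?_ (hδE.trans (min_le_left _ _)))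
  exact mul_le_mul (hpow k hk.le) (by nlinarith [hhk k hk.le]) (by positivity) hE0.le

namespace ConeField

variable {T θ : ℝ} {D : ConeField T θ}

/-! ### The Hamiltonian flow -/

variable (D) in
/-- The inverse of the quadratic part. -/
def Sinv (z : ℝ × E3) : E3 →L[ℝ] E3 := Ring.inverse (D.S z)

theorem isUnit_S {z : ℝ × E3} (hz : z ∈ D.U) : IsUnit (D.S z) := by
  have h : ‖1 - D.S z‖ < 1 := by
    refine (ContinuousLinearMap.opNorm_le_bound _ D.θ_nonneg fun v ↦ ?_).trans_lt
      (D.θ_le.trans_lt (by norm_num))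
    rw [← norm_neg]
    simpa using D.S_near z hz v
  simpa using isUnit_one_sub_of_norm_lt_one h

theorem S_Sinv {z : ℝ × E3} (hz : z ∈ D.U) (v : E3) : D.S z (D.Sinv z v) = v := by
  have := congrArg (fun A : E3 →L[ℝ] E3 ↦ A v) (Ring.mul_inverse_cancel _ (isUnit_S hz))
  simpa [Sinv] using this

theorem Sinv_S {z : ℝ × E3} (hz : z ∈ D.U) (v : E3) : D.Sinv z (D.S z v) = v := by
  have := congrArg (fun A : E3 →L[ℝ] E3 ↦ A v) (Ring.inverse_mul_cancel _ (isUnit_S hz))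
  simpa [Sinv] using this

theorem inner_Sinv_pos {z : ℝ × E3} (hz : z ∈ D.U) {p : E3} (hp : p ≠ 0) :
    0 < ⟪p, D.Sinv z p⟫ := by
  have h1 : D.Sinv z p ≠ 0 := fun h ↦ hp (by rw [← S_Sinv hz p, h, map_zero])
  have h2 := abs_le.1 (inner_S_near hz (D.Sinv z p))
  rw [S_Sinv hz] at h2
  have h3 : 0 < ‖D.Sinv z p‖ := norm_pos_iff.2 h1
  nlinarith [D.θ_le, pow_pos h3 2]

theorem inner_Sinv_nonneg {z : ℝ × E3} (hz : z ∈ D.U) (p : E3) : 0 ≤ ⟪p, D.Sinv z p⟫ := by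
  rcases eq_or_ne p 0 with rfl | hp
  · simp
  · exact (inner_Sinv_pos hz hp).le

variable (D) in
/-- The rate `μ` in `p = μ (S v - b)` in terms of the momentum `p` and the value `q` of `Q` at `v`. -/
def rate (z : ℝ × E3) (p : E3) (q : ℝ) : ℝ :=
  √(⟪p, D.Sinv z p⟫ / (q + ⟪D.b z, D.Sinv z (D.b z)⟫ - D.a z))

variable (D) in
/-- The velocity `v` in `p = μ (S v - b)` in terms of the momentum `p` and the value `q` of `Q` at
`v`. -/
def speed (z : ℝ × E3) (p : E3) (q : ℝ) : E3 :=
  D.Sinv z ((D.rate z p q)⁻¹ • p + D.b z)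

variable (D) in
/-- The right-hand side of Hamilton's equations. -/
def flow (z : ℝ × E3) (p : E3) (q : ℝ) : E3 × E3 :=
  (D.speed z p q, D.rate z p q • D.force z (D.speed z p q))

theorem denom_pos {z : ℝ × E3} (hz : z ∈ D.U) {q : ℝ} (hq : |q| < 1 / 2) :
    0 < q + ⟪D.b z, D.Sinv z (D.b z)⟫ - D.a z := by
  have h1 := inner_Sinv_nonneg hz (D.b z)
  have h2 := abs_le.1 (D.a_near z hz)
  have h3 := abs_lt.1 hq
  linarith [D.θ_le]

/-- For `w = S v - b` one has `⟪w, S⁻¹ w⟫ = Q v + ⟪b, S⁻¹ b⟫ - a`. Hence the factor in `p = r w` can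
be read off from `p` and the value of `Q` alone. -/
theorem rate_eq {z : ℝ × E3} (hz : z ∈ D.U) {v : E3} {r : ℝ} (hr : 0 < r)
    (hq : |D.Q z v| < 1 / 2) : D.rate z (r • D.mom z v) (D.Q z v) = r := by
  have h1 : ⟪r • D.mom z v, D.Sinv z (r • D.mom z v)⟫ =
      r ^ 2 * (D.Q z v + ⟪D.b z, D.Sinv z (D.b z)⟫ - D.a z) := by
    rw [map_smul, real_inner_smul_left, real_inner_smul_right, mom, map_sub, Sinv_S hz,
      inner_sub_left, inner_sub_right, inner_sub_right, D.symm z hz, D.symm z hz, S_Sinv hz, Q,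
      real_inner_comm v (D.S z v), real_inner_comm (D.b z) v]
    ring
  rw [rate, h1, mul_div_assoc, div_self (denom_pos hz hq).ne', mul_one, Real.sqrt_sq hr.le]

theorem speed_eq {z : ℝ × E3} (hz : z ∈ D.U) {v : E3} {r : ℝ} (hr : 0 < r)
    (hq : |D.Q z v| < 1 / 2) : D.speed z (r • D.mom z v) (D.Q z v) = v := by
  rw [speed, rate_eq hz hr hq, smul_smul, inv_mul_cancel₀ hr.ne', one_smul, mom, sub_add_cancel,
    Sinv_S hz]

theorem flow_eq {z : ℝ × E3} (hz : z ∈ D.U) {v : E3} {r : ℝ} (hr : 0 < r)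
    (hq : |D.Q z v| < 1 / 2) :
    D.flow z (r • D.mom z v) (D.Q z v) = (v, r • D.force z v) := by
  rw [flow, rate_eq hz hr hq, speed_eq hz hr hq]

theorem contDiffAt_flow {z : ℝ × E3} (hz : z ∈ D.U) {p : E3} (hp : p ≠ 0) {q : ℝ}
    (hq : |q| < 1 / 2) :
    ContDiffAt ℝ 1 (fun y : (ℝ × E3) × E3 × ℝ ↦ D.flow y.1 y.2.1 y.2.2) (z, p, q) := by
  have hU := D.isOpen.mem_nhds hz
  have hS : ContDiffAt ℝ 1 (fun y : (ℝ × E3) × E3 × ℝ ↦ D.Sinv y.1) (z, p, q) := by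
    have h1 : ContDiffAt ℝ 1 D.S z := (D.S_smooth.contDiffAt hU).of_le (by norm_num)
    have h2 : ContDiffAt ℝ 1 D.Sinv z := by
      obtain ⟨u, hu⟩ := isUnit_S hz
      refine ContDiffAt.comp z ?_ h1
      rw [← hu]
      exact contDiffAt_ringInverse ℝ u
    exact ContDiffAt.comp (z, p, q) (g := D.Sinv) (f := Prod.fst) h2 contDiffAt_fst
  have hb : ContDiffAt ℝ 1 (fun y : (ℝ × E3) × E3 × ℝ ↦ D.b y.1) (z, p, q) :=
    ((D.b_smooth.contDiffAt hU).of_le (by norm_num)).comp (z, p, q) contDiffAt_fst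
  have ha : ContDiffAt ℝ 1 (fun y : (ℝ × E3) × E3 × ℝ ↦ D.a y.1) (z, p, q) :=
    ((D.a_smooth.contDiffAt hU).of_le (by norm_num)).comp (z, p, q) contDiffAt_fst
  have hpp : ContDiffAt ℝ 1 (fun y : (ℝ × E3) × E3 × ℝ ↦ y.2.1) (z, p, q) :=
    contDiffAt_snd.fst
  have hqq : ContDiffAt ℝ 1 (fun y : (ℝ × E3) × E3 × ℝ ↦ y.2.2) (z, p, q) :=
    contDiffAt_snd.snd
  have hden := denom_pos hz hq
  have hnum := inner_Sinv_pos hz hp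
  have hrate : ContDiffAt ℝ 1 (fun y : (ℝ × E3) × E3 × ℝ ↦ D.rate y.1 y.2.1 y.2.2) (z, p, q) := by
    unfold rate
    refine ContDiffAt.sqrt ?_ (div_pos hnum hden).ne'
    exact (hpp.inner ℝ (hS.clm_apply hpp)).div
      ((hqq.add (hb.inner ℝ (hS.clm_apply hb))).sub ha) hden.ne'
  have hrate0 : D.rate z p q ≠ 0 := (Real.sqrt_pos.2 (div_pos hnum hden)).ne'
  have hspeed : ContDiffAt ℝ 1 (fun y : (ℝ × E3) × E3 × ℝ ↦ D.speed y.1 y.2.1 y.2.2)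
      (z, p, q) := by
    unfold speed
    exact hS.clm_apply (((hrate.inv hrate0).smul hpp).add hb)
  have hforce : ContDiffAt ℝ 1 (fun y : (ℝ × E3) × E3 × ℝ ↦
      D.force y.1 (D.speed y.1 y.2.1 y.2.2)) (z, p, q) :=
    ContDiffAt.comp (z, p, q) (g := fun y : (ℝ × E3) × E3 ↦ D.force y.1 y.2)
      (f := fun y : (ℝ × E3) × E3 × ℝ ↦ (y.1, D.speed y.1 y.2.1 y.2.2))
      (contDiffAt_force hz _) (contDiffAt_fst.prodMk hspeed)
  exact hspeed.prodMk (hrate.smul hforce)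

end ConeField

/-- The second point is allowed to leave `s` because the Euler polygons run near the exact solution
curve, not on it. -/
theorem IsCompact.exists_lipschitz_near {X Y : Type*} [NormedAddCommGroup X] [NormedSpace ℝ X]
    [NormedAddCommGroup Y] [NormedSpace ℝ Y] {s : Set X} (hs : IsCompact s) {g : X → Y}
    (hg : ∀ x ∈ s, ContDiffAt ℝ 1 g x) :
    ∃ ρ > 0, ∃ K ≥ 0, ∀ x ∈ s, ∀ w, dist w x ≤ ρ → dist (g w) (g x) ≤ K * dist w x := by
  refine hs.induction_on (p := fun s ↦ ∃ ρ > 0, ∃ K ≥ 0, ∀ x ∈ s, ∀ w, dist w x ≤ ρ →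
    dist (g w) (g x) ≤ K * dist w x) ⟨1, one_pos, 0, le_rfl, by simp⟩ ?_ ?_ ?_
  · rintro s t hst ⟨ρ, hρ, K, hK, h⟩
    exact ⟨ρ, hρ, K, hK, fun x hx ↦ h x (hst hx)⟩
  · rintro s t ⟨ρ, hρ, K, hK, h⟩ ⟨ρ', hρ', K', hK', h'⟩
    refine ⟨min ρ ρ', lt_min hρ hρ', max K K', le_max_of_le_left hK, ?_⟩
    rintro x (hx | hx) w hw
    · exact (h x hx w (hw.trans (min_le_left _ _))).trans (by gcongr; exact le_max_left _ _)
    · exact (h' x hx w (hw.trans (min_le_right _ _))).trans (by gcongr; exact le_max_right _ _)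
  · intro x hx
    obtain ⟨K, t, ht, hK⟩ := (hg x hx).exists_lipschitzOnWith
    obtain ⟨r, hr, hball⟩ := Metric.mem_nhds_iff.1 ht
    refine ⟨Metric.ball x (r / 2),
      mem_nhdsWithin_of_mem_nhds (Metric.ball_mem_nhds x (by positivity)),
      r / 3, by positivity, K, K.2, fun y hy w hw ↦ hK.dist_le_mul _ (hball ?_) _ (hball ?_)⟩
    · rw [Metric.mem_ball] at hy ⊢
      linarith [dist_triangle w y x]
    · rw [Metric.mem_ball] at hy ⊢
      linarith

namespace ConeField

variable {T θ : ℝ} {D : ConeField T θ}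

/-! ### The reach of the null trajectories -/

variable (D) in
/-- A solution `(τ, x)`, with derivatives `m` and `u`, of the equations of the null geodesics, which
starts at the origin and ends at `τ = T`. -/
structure IsTrajectory (s₁ : ℝ) (τ m : ℝ → ℝ) (x u : ℝ → E3) : Prop where
  s_nonneg : 0 ≤ s₁
  τ_zero : τ 0 = 0
  τ_last : τ s₁ = T
  x_zero : x 0 = 0
  mem : ∀ s ∈ Icc 0 s₁, (τ s, x s) ∈ D.U
  τ_deriv : ∀ s ∈ Icc 0 s₁, HasDerivWithinAt τ (m s) (Icc 0 s₁) s
  m_pos : ∀ s ∈ Icc 0 s₁, 0 < m s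
  x_deriv : ∀ s ∈ Icc 0 s₁, HasDerivWithinAt x (u s) (Icc 0 s₁) s
  mom_deriv : ∀ s ∈ Icc 0 s₁, HasDerivWithinAt
    (fun s ↦ m s • D.mom (τ s, x s) ((m s)⁻¹ • u s))
    (m s ^ 2 • D.force (τ s, x s) ((m s)⁻¹ • u s)) (Icc 0 s₁) s
  null : ∀ s ∈ Icc 0 s₁, D.Q (τ s, x s) ((m s)⁻¹ • u s) = 0

/-- Null speeds with respect to `τ` are below `3 / 2`. The bound serves for the last step, which the
Euler scheme does not cover. -/
theorem IsTrajectory.norm_sub_le {s₁ : ℝ} {τ m : ℝ → ℝ} {x u : ℝ → E3}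
    (h : D.IsTrajectory s₁ τ m x u) {s : ℝ} (hs : s ∈ Icc 0 s₁) :
    ‖x s₁ - x s‖ ≤ 2 * (T - τ s) := by
  have hsub : Icc s s₁ ⊆ Icc 0 s₁ := Icc_subset_Icc_left hs.1
  have := norm_sub_le_of_norm_deriv_le hs.2 (f := x) (f' := u) (B := fun r ↦ 2 * τ r)
    (B' := fun r ↦ 2 * m r) (fun r hr ↦ (h.x_deriv r (hsub hr)).mono hsub)
    (fun r hr ↦ ((h.τ_deriv r (hsub hr)).const_mul 2).mono hsub) fun r hr ↦ ?_
  · rw [h.τ_last] at this; linarith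
  · have hm := h.m_pos r (hsub hr)
    have h1 := norm_lt_of_Q_le (h.mem r (hsub hr)) (by rw [h.null r (hsub hr)]; norm_num)
    rw [norm_smul, norm_inv, Real.norm_of_nonneg hm.le, inv_mul_lt_iff₀ hm] at h1
    linarith

set_option maxHeartbeats 400000 in
/-- Along extremal polygons Hamilton's equations hold up to small errors. -/
theorem eventually_euler_error_le {C : ℝ} (hC : 1 ≤ C) {δ : ℝ} (hδ : 0 < δ) :
    ∀ᶠ N : ℕ in atTop, ∀ (e : E3) (l : ℝ) (x : ℕ → E3), D.IsExtremal N e l x →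
      (∀ i < N, D.weight N x i ∈ Icc C⁻¹ C ∧ ‖D.moment N x i‖ ∈ Icc C⁻¹ C ∧
        |D.Q (D.node N x i) (D.vel N x i)| ≤ C / N) →
      ∀ k, k + 1 < N → ‖(x (k + 1), D.moment N x (k + 1)) - (x k, D.moment N x k)
        - (T / N : ℝ) • D.flow (D.node N x k) (D.moment N x k) 0‖ ≤ T / N * δ := by
  have hT := D.T_pos
  obtain ⟨Cf, hCf, hforce⟩ := D.exists_norm_force_le
  -- The flow is singular at zero momentum; the lower bound on the momenta keeps the states in a
  -- compact set on which it is uniformly continuous.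
  set A : Set ((ℝ × E3) × E3 × ℝ) := (Icc 0 T ×ˢ Metric.closedBall (0 : E3) (3 * T)) ×ˢ
    (Metric.closedBall (0 : E3) C \ Metric.ball 0 C⁻¹) ×ˢ Icc (-(1 / 4)) (1 / 4) with hA
  have hAc : IsCompact A := (isCompact_Icc.prod (isCompact_closedBall _ _)).prod
    (((isCompact_closedBall (0 : E3) C).diff Metric.isOpen_ball).prod isCompact_Icc)
  have hcont : ContinuousOn (fun y : (ℝ × E3) × E3 × ℝ ↦ D.flow y.1 y.2.1 y.2.2) A := by
    rintro ⟨z, p, q⟩ ⟨hz, hp, hq⟩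
    refine (contDiffAt_flow (D.subset hz) ?_ ?_).continuousAt.continuousWithinAt
    · rintro rfl
      exact hp.2 (Metric.mem_ball_self (by positivity))
    · exact (abs_le.2 hq).trans_lt (by norm_num)
  obtain ⟨η, hη, huc⟩ : ∃ η > 0, ∀ z p q z' p' q', (z, p, q) ∈ A → (z', p', q') ∈ A →
      dist (z, p, q) (z', p', q') < η → dist (D.flow z p q) (D.flow z' p' q') < δ := by
    obtain ⟨η, hη, huc⟩ := Metric.uniformContinuousOn_iff.1
      (hAc.uniformContinuousOn_of_continuous hcont) δ hδ
    exact ⟨η, hη, fun z p q z' p' q' h h' hd ↦ huc (z, p, q) h (z', p', q') h' hd⟩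
  set L := 3 * T + C * T * Cf + C with hL
  have hlim : Tendsto (fun N : ℕ ↦ L / (N : ℝ)) atTop (𝓝 0) :=
    tendsto_const_nhds.div_atTop tendsto_natCast_atTop_atTop
  have hlim2 : Tendsto (fun N : ℕ ↦ C / (N : ℝ)) atTop (𝓝 0) :=
    tendsto_const_nhds.div_atTop tendsto_natCast_atTop_atTop
  filter_upwards [hlim.eventually_lt_const hη, eventually_gt_atTop 0,
    hlim2.eventually_lt_const (show (0 : ℝ) < 1 / 4 by norm_num)]
    with N hNη hN hN4 e l x hx hb k hk
  have hN' : (0 : ℝ) < N := by exact_mod_cast hN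
  have hQ : ∀ i < N, |D.Q (D.node N x i) (D.vel N x i)| < 1 / 4 :=
    fun i hi ↦ (hb i hi).2.2.trans_lt hN4
  have hnode : ∀ i < N, D.node N x i ∈ Icc 0 T ×ˢ Metric.closedBall (0 : E3) (3 * T) :=
    fun i hi ↦ node_mem hx.zero hx.norm_vel_le hi.le
  have hflow : ∀ i < N, D.flow (D.node N x i) (D.moment N x i) (D.Q (D.node N x i) (D.vel N x i))
      = (D.vel N x i, D.weight N x i • D.force (D.node N x i) (D.vel N x i)) := fun i hi ↦
    flow_eq (D.subset (hnode i hi)) (weight_pos N x i) ((hQ i hi).trans (by norm_num))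
  have hmem : ∀ i < N, ∀ q, |q| ≤ 1 / 4 → (D.node N x i, D.moment N x i, q) ∈ A := by
    intro i hi q hq
    refine ⟨hnode i hi, ⟨mem_closedBall_zero_iff.2 (hb i hi).2.1.2, fun h ↦ ?_⟩, abs_le.1 hq⟩
    exact (mem_ball_zero_iff.1 h).not_ge (hb i hi).2.1.1
  have hk' : k < N := by omega
  have hx1 : x (k + 1) - x k = (T / N : ℝ) • D.vel N x k := by
    rw [step_eq (D := D) hN x k]; abel
  have hP1 : D.moment N x (k + 1) - D.moment N x k = (T / N : ℝ) •
      (D.weight N x (k + 1) • D.force (D.node N x (k + 1)) (D.vel N x (k + 1))) := by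
    rw [moment, moment, hx.euler k hk, smul_smul]
  have hdist : ∀ (z z' : ℝ × E3) (p p' : E3) (q q' : ℝ), dist (z, p, q) (z', p', q') =
      max (dist z z') (max (dist p p') (dist q q')) := fun _ _ _ _ _ _ ↦ rfl
  have hbase := hmem k hk' 0 (by norm_num)
  -- The position increment is given by the flow on the edge `k`, the momentum increment by the flow
  -- on the edge `k + 1`, each with its own value of `Q`. Both states are within `L / N` of the
  -- state on the edge `k` with `Q` replaced by `0`.
  have hd1 : dist (D.flow (D.node N x k) (D.moment N x k) (D.Q (D.node N x k) (D.vel N x k)))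
      (D.flow (D.node N x k) (D.moment N x k) 0) < δ := by
    refine huc _ _ _ _ _ _ (hmem k hk' _ (hQ k hk').le) hbase ?_
    rw [hdist, dist_self, dist_self, Real.dist_0_eq_abs]
    refine lt_of_le_of_lt ?_ hNη
    refine max_le (by positivity) (max_le (by positivity) ((hb k hk').2.2.trans ?_))
    gcongr
    rw [hL]; nlinarith [mul_nonneg (mul_nonneg (zero_le_one.trans hC) hT.le) hCf.le]
  have hd2 : dist (D.flow (D.node N x (k + 1)) (D.moment N x (k + 1))
      (D.Q (D.node N x (k + 1)) (D.vel N x (k + 1))))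
      (D.flow (D.node N x k) (D.moment N x k) 0) < δ := by
    refine huc _ _ _ _ _ _ (hmem _ hk _ (hQ _ hk).le) hbase ?_
    have hC0 : 0 ≤ C := zero_le_one.trans hC
    have hCTf : 0 ≤ C * T * Cf := by positivity
    rw [hdist, Real.dist_0_eq_abs]
    refine lt_of_le_of_lt ?_ hNη
    refine max_le ?_ (max_le ?_ ((hb _ hk).2.2.trans ?_))
    · rw [node, node, Prod.dist_eq, dist_eq_norm (x (k + 1)), hx1, Real.dist_eq]
      refine max_le ?_ ?_
      · have : T * ((k + 1 : ℕ) : ℝ) / N - T * k / N = T / N := by push_cast; ring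
        simp only
        rw [this, abs_of_pos (by positivity)]
        gcongr
        rw [hL]; linarith
      · rw [norm_smul, Real.norm_of_nonneg (by positivity), div_mul_eq_mul_div]
        gcongr
        have := mul_le_mul_of_nonneg_left (hx.norm_vel_le k hk') hT.le
        rw [hL]; linarith
    · rw [dist_eq_norm, hP1, norm_smul, norm_smul, Real.norm_of_nonneg (by positivity),
        Real.norm_of_nonneg (weight_pos N x _).le, div_mul_eq_mul_div]
      gcongr
      have h1 := mul_le_mul (hb _ hk).1.2 (hforce _ (hnode _ hk) _ (hx.norm_vel_le _ hk))
        (norm_nonneg _) hC0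
      have := mul_le_mul_of_nonneg_left h1 hT.le
      rw [hL]; linarith
    · gcongr
      rw [hL]; linarith
  rw [hflow k hk', dist_eq_norm] at hd1
  rw [hflow _ hk, dist_eq_norm] at hd2
  have heq : (x (k + 1), D.moment N x (k + 1)) - (x k, D.moment N x k)
      - (T / N : ℝ) • D.flow (D.node N x k) (D.moment N x k) 0 = (T / N : ℝ) •
      (D.vel N x k - (D.flow (D.node N x k) (D.moment N x k) 0).1,
        D.weight N x (k + 1) • D.force (D.node N x (k + 1)) (D.vel N x (k + 1))
          - (D.flow (D.node N x k) (D.moment N x k) 0).2) := by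
    refine Prod.ext ?_ ?_
    · simp only [Prod.fst_sub, Prod.smul_fst, hx1, smul_sub]
    · simp only [Prod.snd_sub, Prod.smul_snd, hP1, smul_sub]
  rw [heq, norm_smul, Real.norm_of_nonneg (by positivity)]
  gcongr
  rw [Prod.norm_def]
  refine max_le ?_ ?_
  · have h1 := (norm_fst_le _).trans hd1.le
    simpa only [Prod.fst_sub] using h1
  · have h1 := (norm_snd_le _).trans hd2.le
    simpa only [Prod.snd_sub] using h1

set_option maxHeartbeats 400000 in
variable (D) in
/-- In every direction, some null trajectory reaches nearly as far as in Minkowski space. -/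
theorem exists_trajectory_reaching {e : E3} (he : ‖e‖ = 1) :
    ∃ (l : ℝ) (v₀ : E3), (1 - 4 * θ) * T ≤ l ∧ D.Q (0, 0) v₀ = 0 ∧
      ∀ (s₁ : ℝ) (τ m : ℝ → ℝ) (x u : ℝ → E3), D.IsTrajectory s₁ τ m x u →
        u 0 = m 0 • v₀ → x s₁ = l • e := by
  have hT := D.T_pos
  obtain ⟨C, hC, hbounds⟩ := D.exists_extremal_bounds
  have hC0 : 0 < C := zero_lt_one.trans_le hC
  choose l X hl hX using fun N : ℕ ↦ exists_isExtremal (D := D) (Nat.succ_pos N) he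
  have h00 : ((0 : ℝ), (0 : E3)) ∈ D.U := D.subset ⟨⟨le_rfl, hT.le⟩, by simp [hT.le]⟩
  have hbounds' := (tendsto_add_atTop_nat 1).eventually hbounds
  have hnode0 : ∀ N, D.node (N + 1) (X N) 0 = (0, 0) := fun N ↦ by
    rw [node, (hX N).zero]; simp
  -- `X N` has `N + 1` edges. Along a subsequence the reach, the initial weight and the initial
  -- velocity converge. The limit weight is positive by the lower bound on weights, and the limit
  -- velocity is null because `Q = O(1/N)`.
  obtain ⟨⟨l₀, r₀, v₀⟩, hmem, φ, hφ, hlim⟩ : ∃ a ∈ Icc (-(3 * T)) (3 * T) ×ˢ Icc C⁻¹ C ×ˢ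
      Metric.closedBall (0 : E3) 3, ∃ φ : ℕ → ℕ, StrictMono φ ∧ Tendsto ((fun N ↦
        (l N, D.weight (N + 1) (X N) 0, D.vel (N + 1) (X N) 0)) ∘ φ) atTop (𝓝 a) := by
    refine (isCompact_Icc.prod (isCompact_Icc.prod (isCompact_closedBall _ _))).tendsto_subseq'
      (Eventually.frequently ?_)
    filter_upwards [hbounds'] with N hN
    refine ⟨abs_le.1 ?_, (hN e (l N) (X N) (hX N) 0 (by omega)).1,
      mem_closedBall_zero_iff.2 ((hX N).norm_vel_le 0 (by omega))⟩
    have := mem_closedBall_zero_iff.1 (node_mem (hX N).zero (hX N).norm_vel_le le_rfl).2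
    rwa [node, (hX N).last, norm_smul, he, mul_one] at this
  have hφt := hφ.tendsto_atTop
  have hl0 : Tendsto (fun n ↦ l (φ n)) atTop (𝓝 l₀) := hlim.fst_nhds
  have hr0 : Tendsto (fun n ↦ D.weight (φ n + 1) (X (φ n)) 0) atTop (𝓝 r₀) := hlim.snd_nhds.fst_nhds
  have hv0 : Tendsto (fun n ↦ D.vel (φ n + 1) (X (φ n)) 0) atTop (𝓝 v₀) := hlim.snd_nhds.snd_nhds
  have hr₀ : 0 < r₀ := (inv_pos.2 hC0).trans_le hmem.2.1.1
  have hQ0 : D.Q (0, 0) v₀ = 0 := by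
    have h1 : Tendsto (fun n ↦ D.Q (0, 0) (D.vel (φ n + 1) (X (φ n)) 0)) atTop
        (𝓝 (D.Q (0, 0) v₀)) := by
      refine Tendsto.comp (g := fun v ↦ D.Q (0, 0) v) (y := 𝓝 v₀) ?_ hv0
      refine Continuous.tendsto ?_ _
      unfold Q
      fun_prop
    have h2 : Tendsto (fun n ↦ C / ((φ n + 1 : ℕ) : ℝ)) atTop (𝓝 0) :=
      tendsto_const_nhds.div_atTop (tendsto_natCast_atTop_atTop.comp
        ((tendsto_add_atTop_nat 1).comp hφt))
    refine tendsto_nhds_unique h1 (squeeze_zero_norm' ?_ h2)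
    filter_upwards [hφt.eventually hbounds'] with n hn
    have := (hn e _ _ (hX (φ n)) 0 (by omega)).2.2
    rwa [hnode0] at this
  have hP0 : Tendsto (fun n ↦ D.moment (φ n + 1) (X (φ n)) 0) atTop
      (𝓝 (r₀ • D.mom (0, 0) v₀)) := by
    unfold moment
    simp only [hnode0]
    refine hr0.smul (Tendsto.comp (g := fun v ↦ D.mom (0, 0) v) (y := 𝓝 v₀) ?_ hv0)
    refine Continuous.tendsto ?_ _
    unfold mom
    fun_prop
  refine ⟨l₀, v₀, ge_of_tendsto' hl0 fun n ↦ hl _, hQ0, ?_⟩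
  intro s₁ τ m x u h hu0
  have h0mem : (0 : ℝ) ∈ Icc 0 s₁ := ⟨le_rfl, h.s_nonneg⟩
  have hm0 := h.m_pos 0 h0mem
  -- Hamilton's equations at `Q = 0` are homogeneous in the momentum, so the momentum of the
  -- trajectory may be rescaled to start at the limit of the momenta of the polygons.
  set c := r₀ / m 0 with hc
  have hc0 : 0 < c := by positivity
  set y : ℝ → E3 × E3 := fun s ↦ (x s, c • m s • D.mom (τ s, x s) ((m s)⁻¹ • u s)) with hy
  set f : ℝ → E3 × E3 → E3 × E3 := fun t z ↦ D.flow (t, z.1) z.2 0 with hf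
  have hQs : ∀ s ∈ Icc 0 s₁, |D.Q (τ s, x s) ((m s)⁻¹ • u s)| < 1 / 2 := fun s hs ↦ by
    rw [h.null s hs]; norm_num
  have hfy : ∀ s ∈ Icc 0 s₁, f (τ s) (y s) = ((m s)⁻¹ • u s,
      (c * m s) • D.force (τ s, x s) ((m s)⁻¹ • u s)) := by
    intro s hs
    have := flow_eq (h.mem s hs) (mul_pos hc0 (h.m_pos s hs)) (hQs s hs)
    rw [h.null s hs] at this
    simp only [hf, hy, smul_smul]
    exact this
  have hyderiv : ∀ s ∈ Icc 0 s₁, HasDerivWithinAt y (m s • f (τ s) (y s)) (Icc 0 s₁) s := by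
    intro s hs
    have hms := (h.m_pos s hs).ne'
    rw [hfy s hs]
    refine ((h.x_deriv s hs).prodMk ((h.mom_deriv s hs).const_smul c)).congr_deriv ?_
    refine Prod.ext ?_ ?_
    · simp [smul_smul, mul_inv_cancel₀ hms]
    · simp only [Prod.smul_snd, smul_smul]
      congr 1; ring
  have hyc : ContinuousOn y (Icc 0 s₁) := fun s hs ↦ (hyderiv s hs).continuousWithinAt
  have hτc : ContinuousOn τ (Icc 0 s₁) := fun s hs ↦ (h.τ_deriv s hs).continuousWithinAt
  have hy2 : ∀ s ∈ Icc 0 s₁, (y s).2 ≠ 0 := by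
    intro s hs
    have h1 := le_norm_mom (v := (m s)⁻¹ • u s) (h.mem s hs) ((norm_lt_of_Q_le (h.mem s hs) (by
      rw [h.null s hs]; norm_num)).le.trans (by norm_num)) (by rw [h.null s hs]; norm_num)
    have h2 : D.mom (τ s, x s) ((m s)⁻¹ • u s) ≠ 0 := norm_pos_iff.1 (by linarith)
    exact smul_ne_zero hc0.ne' (smul_ne_zero (h.m_pos s hs).ne' h2)
  have hfC : ∀ s ∈ Icc 0 s₁, ContDiffAt ℝ 1 (fun w : ℝ × E3 × E3 ↦ f w.1 w.2) (τ s, y s) := by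
    intro s hs
    exact ContDiffAt.comp (τ s, y s) (g := fun w : (ℝ × E3) × E3 × ℝ ↦ D.flow w.1 w.2.1 w.2.2)
      (f := fun w : ℝ × E3 × E3 ↦ ((w.1, w.2.1), w.2.2, 0))
      (contDiffAt_flow (h.mem s hs) (hy2 s hs) (by norm_num)) (by fun_prop)
  have hcurve : ContinuousOn (fun s ↦ (τ s, y s)) (Icc 0 s₁) := hτc.prodMk hyc
  obtain ⟨ρ, hρ, K, hK, hlip⟩ := (isCompact_Icc.image_of_continuousOn hcurve).exists_lipschitz_near
    (g := fun w : ℝ × E3 × E3 ↦ f w.1 w.2) (by rintro _ ⟨s, hs, rfl⟩; exact hfC s hs)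
  have hy0 : y 0 = (0, r₀ • D.mom (0, 0) v₀) := by
    simp only [hy, h.τ_zero, h.x_zero, hu0, smul_smul, inv_mul_cancel₀ hm0.ne', one_smul, hc]
    rw [div_mul_cancel₀ _ hm0.ne']
  have hdist : ∀ (t : ℝ) (z z' : E3 × E3), dist (t, z) (t, z') = dist z z' := fun t z z' ↦ by
    rw [Prod.dist_eq, dist_self, max_eq_right dist_nonneg]
  refine eq_of_forall_dist_le fun ν hν ↦ ?_
  obtain ⟨δ, hδ, hclose⟩ := euler_scheme_close hT h.s_nonneg hK hρ h.τ_zero h.τ_deriv h.m_pos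
    hyderiv (ContinuousOn.comp' (g := fun w : ℝ × E3 × E3 ↦ f w.1 w.2)
      (t := (fun s ↦ (τ s, y s)) '' Icc 0 s₁) (by
        rintro _ ⟨s, hs, rfl⟩; exact (hfC s hs).continuousAt.continuousWithinAt) hcurve
      (mapsTo_image _ _))
    (fun s hs z hz ↦ by
      have := hlip _ (mem_image_of_mem _ hs) (τ s, z) (by
        rw [hdist, dist_eq_norm]; exact hz)
      rw [hdist, dist_eq_norm, dist_eq_norm] at this
      exact this) (half_pos hν)
  have hsmall : ∀ a : ℝ, Tendsto (fun n ↦ a / ((φ n + 1 : ℕ) : ℝ)) atTop (𝓝 0) := fun a ↦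
    tendsto_const_nhds.div_atTop (tendsto_natCast_atTop_atTop.comp
      ((tendsto_add_atTop_nat 1).comp hφt))
  have hz0 : ∀ᶠ n in atTop,
      ‖((X (φ n) 0, D.moment (φ n + 1) (X (φ n)) 0) : E3 × E3) - y 0‖ < δ := by
    have : Tendsto (fun n ↦ ((X (φ n) 0, D.moment (φ n + 1) (X (φ n)) 0) : E3 × E3)) atTop
        (𝓝 (y 0)) := by
      rw [hy0]
      refine Tendsto.prodMk_nhds ?_ hP0
      simp only [(hX _).zero]
      exact tendsto_const_nhds
    have := this.eventually (Metric.ball_mem_nhds _ hδ)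
    filter_upwards [this] with n hn
    rwa [dist_eq_norm] at hn
  have herr := hφt.eventually ((tendsto_add_atTop_nat 1).eventually
    (eventually_euler_error_le (D := D) hC hδ))
  have hν4 : 0 < ν / 4 := by positivity
  have hn5 := (hsmall (5 * T)).eventually_lt_const hν4
  have hnT := (hsmall T).eventually_lt_const hδ
  have hnl := hl0.eventually (Metric.ball_mem_nhds l₀ hν4)
  have hb := hφt.eventually hbounds'
  obtain ⟨n, hz0, herr, hb, hnT, hn5, hnl⟩ :=
    (hz0.and (herr.and (hb.and (hnT.and (hn5.and hnl))))).exists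
  generalize hN : φ n + 1 = N at hz0 herr hb hnT hn5
  have hN0 : (0 : ℝ) < (N : ℝ) := by rw [← hN]; positivity
  have hext : D.IsExtremal N e (l (φ n)) (X (φ n)) := hN ▸ hX (φ n)
  have hbn := hb e _ _ hext
  -- The momentum lives on edges, so the comparison ends at the initial vertex of the last edge, one
  -- step before the time `T`.
  obtain ⟨s, hs, hτs⟩ : T * (φ n : ℝ) / N ∈ τ '' Icc 0 s₁ := by
    refine intermediate_value_Icc h.s_nonneg hτc ?_
    rw [h.τ_zero, h.τ_last]
    exact time_mem D (by omega : φ n ≤ N)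
  have herr' := herr e _ _ hext hbn
  simp only [node] at herr'
  simp only [hf] at hclose
  have hfin := hclose N hnT.le (fun k ↦ (X (φ n) k, D.moment N (X (φ n)) k)) hz0.le
    herr' (φ n) (by omega) s hs hτs
  have hfin1 := (norm_fst_le _).trans hfin
  simp only [hy, Prod.fst_sub] at hfin1
  have hstep : ‖X (φ n) N - X (φ n) (φ n)‖ ≤ 3 * T / N := by
    have hst : X (φ n) N = X (φ n) (φ n) + (T / N : ℝ) • D.vel N (X (φ n)) (φ n) := by
      rw [← step_eq (by omega), hN]
    rw [hst, add_sub_cancel_left, norm_smul,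
      Real.norm_of_nonneg (by positivity)]
    have := hext.norm_vel_le (φ n) (by omega)
    calc T / N * _ ≤ T / N * 3 := by gcongr
      _ = _ := by ring
  have hlast := h.norm_sub_le hs
  have hτd : T - τ s = T / N := by
    have : (N : ℝ) = φ n + 1 := by rw [← hN]; push_cast; rfl
    rw [hτs, this]; field_simp; ring
  rw [hext.last] at hstep
  rw [hτd] at hlast
  rw [Real.dist_eq] at hnl
  have hle : ‖l (φ n) • e - l₀ • e‖ ≤ ν / 4 := by
    rw [← sub_smul, norm_smul, he, mul_one]; exact hnl.le
  rw [dist_eq_norm]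
  -- The four terms are at most `2 T / N`, `ν / 2`, `3 T / N` and `ν / 4`.
  have hdec : x s₁ - l₀ • e = (x s₁ - x s) - (X (φ n) (φ n) - x s)
      - (l (φ n) • e - X (φ n) (φ n)) + (l (φ n) • e - l₀ • e) := by abel
  rw [hdec]
  refine (norm_add_le _ _).trans ((add_le_add_left ((norm_sub_le _ _).trans
    (add_le_add_left (norm_sub_le _ _) _)) _).trans ?_)
  have h5 : 5 * T / (N : ℝ) = 2 * (T / N) + 3 * T / N := by ring
  rw [h5] at hn5
  linarith

end ConeField

/-! ### The metric and the geodesics in a chart -/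


section Lagrange

variable {E : Type*} [NormedAddCommGroup E] [NormedSpace ℝ E]

/-- The acceleration of the critical points of the Lagrangian `G y v v / 2`. -/
def Lagrange.accel (G : E → E →L[ℝ] E →L[ℝ] ℝ) (y v : E) : E :=
  (G y).inverse ((1 / 2 : ℝ) • ((fderiv ℝ G y).flip v).flip v - fderiv ℝ G y v v)

set_option maxSynthPendingDepth 5 in
theorem Lagrange.contDiffAt_accel [CompleteSpace E] {G : E → E →L[ℝ] E →L[ℝ] ℝ} {y : E}
    (hG : ContDiffAt ℝ 2 G y) {e : E ≃L[ℝ] (E →L[ℝ] ℝ)} (he : (e : E →L[ℝ] E →L[ℝ] ℝ) = G y)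
    (v : E) : ContDiffAt ℝ 1 (fun z : E × E ↦ Lagrange.accel G z.1 z.2) (y, v) := by
  have hD : ContDiffAt ℝ 1 (fderiv ℝ G) y := hG.fderiv_right (by norm_num)
  have hD' : ContDiffAt ℝ 1 (fun z : E × E ↦ fderiv ℝ G z.1) (y, v) :=
    hD.comp (y, v) contDiffAt_fst
  have hflip : ContDiffAt ℝ 1 (fun z : E × E ↦ (fderiv ℝ G z.1).flip) (y, v) :=
    (ContinuousLinearMap.flipₗᵢ ℝ E E (E →L[ℝ] ℝ)).contDiff.contDiffAt.comp (y, v) hD'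
  have hflip2 : ContDiffAt ℝ 1 (fun z : E × E ↦ (((fderiv ℝ G z.1).flip z.2).flip)) (y, v) :=
    (ContinuousLinearMap.flipₗᵢ ℝ E E ℝ).contDiff.contDiffAt.comp (y, v)
      (hflip.clm_apply contDiffAt_snd)
  have hinv : ContDiffAt ℝ 1 (fun z : E × E ↦ (G z.1).inverse) (y, v) := by
    refine ContDiffAt.comp (y, v) (g := ContinuousLinearMap.inverse)
      (f := fun z : E × E ↦ G z.1) ?_ ((hG.of_le (by norm_num)).comp (y, v) contDiffAt_fst)
    simp only [← he]
    exact contDiffAt_map_inverse e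
  exact hinv.clm_apply (((hflip2.clm_apply contDiffAt_snd).const_smul (1 / 2 : ℝ)).sub
    ((hD'.clm_apply contDiffAt_snd).clm_apply contDiffAt_snd))

set_option maxSynthPendingDepth 5 in
theorem Lagrange.hasDerivAt_apply {G : E → E →L[ℝ] E →L[ℝ] ℝ} {c v w : ℝ → E} {c' v' w' : E} {s : ℝ}
    (hG : DifferentiableAt ℝ G (c s)) (hc : HasDerivAt c c' s) (hv : HasDerivAt v v' s)
    (hw : HasDerivAt w w' s) : HasDerivAt (fun r ↦ G (c r) (v r) (w r))
      (fderiv ℝ G (c s) c' (v s) (w s) + G (c s) v' (w s) + G (c s) (v s) w') s := by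
  have h := ((hG.hasFDerivAt.comp_hasDerivAt s hc).clm_apply hv).clm_apply hw
  simpa [Function.comp_def] using h

set_option maxSynthPendingDepth 5 in
theorem Lagrange.hasDerivAt_momentum {F : Type*} [NormedAddCommGroup F] [NormedSpace ℝ F]
    {G : E → E →L[ℝ] E →L[ℝ] ℝ} {c v : ℝ → E} {c' v' : E} {s : ℝ} (L : F →L[ℝ] E)
    (hG : DifferentiableAt ℝ G (c s)) (hc : HasDerivAt c c' s) (hv : HasDerivAt v v' s) :
    HasDerivAt (fun r ↦ (G (c r) (v r)).comp L)
      ((fderiv ℝ G (c s) c' (v s) + G (c s) v').comp L) s := by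
  have h := ((hG.hasFDerivAt.comp_hasDerivAt s hc).clm_apply hv).clm_comp (hasDerivAt_const s L)
  simpa [Function.comp_def] using h

set_option maxSynthPendingDepth 5 in
theorem Lagrange.apply_smul (B : E →L[ℝ] E →L[ℝ] ℝ) (D : E →L[ℝ] E →L[ℝ] E →L[ℝ] ℝ) (k : ℝ)
    (u v w : E) : B ((k * k) • u) v + D (k • w) (k • w) v - 1 / 2 * D v (k • w) (k • w)
      = k * k * (B u v + D w w v - 1 / 2 * D v w w) := by
  simp
  ring

end Lagrange

section Chart

variable {M : Type*} [TopologicalSpace M] [ChartedSpace E4 M] {φ : OpenPartialHomeomorph M E4}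

theorem mdifferentiable_of_mem_maximalAtlas (hφ : φ ∈ IsManifold.maximalAtlas 𝓘(ℝ, E4) ∞ M) :
    φ.MDifferentiable 𝓘(ℝ, E4) 𝓘(ℝ, E4) :=
  ⟨(contMDiffOn_of_mem_maximalAtlas hφ).mdifferentiableOn (by simp),
    (contMDiffOn_symm_of_mem_maximalAtlas hφ).mdifferentiableOn (by simp)⟩

/-- The velocity of a curve in a chart. -/
theorem hasDerivAt_chart (hφ : φ ∈ IsManifold.maximalAtlas 𝓘(ℝ, E4) ∞ M) {γ : ℝ → M} {s : ℝ}
    (hγ : MDifferentiableAt 𝓘(ℝ, ℝ) 𝓘(ℝ, E4) γ s) (hs : γ s ∈ φ.source) :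
    HasDerivAt (φ ∘ γ) (mfderiv 𝓘(ℝ, E4) 𝓘(ℝ, E4) φ (γ s) (velocity γ s)) s := by
  have h1 : HasMFDerivAt 𝓘(ℝ, E4) 𝓘(ℝ, E4) φ (γ s) (mfderiv 𝓘(ℝ, E4) 𝓘(ℝ, E4) φ (γ s)) :=
    ((mdifferentiable_of_mem_maximalAtlas hφ).mdifferentiableAt hs).hasMFDerivAt
  let L : ℝ →L[ℝ] E4 := (mfderiv 𝓘(ℝ, E4) 𝓘(ℝ, E4) φ (γ s)).comp (mfderiv 𝓘(ℝ, ℝ) 𝓘(ℝ, E4) γ s)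
  have h2 : HasFDerivAt (φ ∘ γ) L s := hasMFDerivAt_iff_hasFDerivAt.1 (h1.comp s hγ.hasMFDerivAt)
  have h3 : HasDerivAt (φ ∘ γ) (L 1) s := h2.hasDerivAt
  exact h3

variable [IsManifold 𝓘(ℝ, E4) ∞ M] {g : LorentzMetric M}

namespace LorentzMetric

/-- The metric in the coordinates `φ` at the point with coordinates `y`, as a bilinear form. -/
def coordForm (g : LorentzMetric M) (φ : OpenPartialHomeomorph M E4) (y : E4) :
    E4 →L[ℝ] E4 →L[ℝ] ℝ :=
  ContinuousLinearMap.bilinearComp (E := E4) (F := E4) (g.val (φ.symm y))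
    (mfderiv 𝓘(ℝ, E4) 𝓘(ℝ, E4) φ.symm y) (mfderiv 𝓘(ℝ, E4) 𝓘(ℝ, E4) φ.symm y)

theorem coordForm_apply (y v w : E4) : g.coordForm φ y v w = g.inCoord φ y v w := rfl

theorem coordForm_symm (y v w : E4) : g.coordForm φ y v w = g.coordForm φ y w v :=
  g.symm _ _ _

/-- The tangent map of `φ.symm` turns constant vectors into smooth fields along `φ.symm`, and the
smooth metric is evaluated on two of them. -/
theorem contDiffOn_coordForm (hφ : φ ∈ IsManifold.maximalAtlas 𝓘(ℝ, E4) ∞ M) :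
    ContDiffOn ℝ ∞ (g.coordForm φ) φ.target := by
  refine contDiffOn_clm_apply.2 fun v ↦ contDiffOn_clm_apply.2 fun w ↦ ?_
  have hsymm := contMDiffOn_symm_of_mem_maximalAtlas hφ
  have hfield : ∀ v : E4, ContMDiffOn 𝓘(ℝ, E4) (𝓘(ℝ, E4).prod 𝓘(ℝ, E4)) ∞
      (fun y : E4 ↦ TotalSpace.mk' E4 (E := fun x : M ↦ TangentSpace 𝓘(ℝ, E4) x) (φ.symm y)
        (mfderiv 𝓘(ℝ, E4) 𝓘(ℝ, E4) φ.symm y v)) φ.target := by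
    intro v
    have h1 := hsymm.contMDiffOn_tangentMapWithin (m := ∞) (by simp)
      φ.open_target.uniqueMDiffOn
    have h2 : ContMDiffOn 𝓘(ℝ, E4) (𝓘(ℝ, E4).tangent) ∞
        (fun y : E4 ↦ (⟨y, v⟩ : TangentBundle 𝓘(ℝ, E4) E4)) φ.target :=
      contMDiffOn_vectorSpace_iff_contDiffOn.2 contDiffOn_const
    refine (h1.comp h2 fun y hy ↦ hy).congr fun y hy ↦ ?_
    simp only [Function.comp_apply, tangentMapWithin]
    rw [mfderivWithin_of_isOpen φ.open_target hy]
  intro y hy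
  have := ContMDiffWithinAt.clm_bundle_apply₂ (F₁ := E4) (F₂ := E4) (F₃ := ℝ)
    (E₁ := fun x : M ↦ TangentSpace 𝓘(ℝ, E4) x) (E₂ := fun x : M ↦ TangentSpace 𝓘(ℝ, E4) x)
    (E₃ := Bundle.Trivial M ℝ)
    (g.contMDiff.contMDiffAt.comp_contMDiffWithinAt y (hsymm y hy)) (hfield v y hy) (hfield w y hy)
  simp only [contMDiffWithinAt_totalSpace] at this
  exact this.2.contDiffWithinAt

theorem contDiffAt_coordForm (hφ : φ ∈ IsManifold.maximalAtlas 𝓘(ℝ, E4) ∞ M) {y : E4}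
    (hy : y ∈ φ.target) : ContDiffAt ℝ ∞ (g.coordForm φ) y :=
  (g.contDiffOn_coordForm hφ).contDiffAt (φ.open_target.mem_nhds hy)

theorem val_eq_coordForm (hφ : φ ∈ IsManifold.maximalAtlas 𝓘(ℝ, E4) ∞ M) {q : M}
    (hq : q ∈ φ.source) (v w : TangentSpace 𝓘(ℝ, E4) q) :
    g.val q v w = g.coordForm φ (φ q) (mfderiv 𝓘(ℝ, E4) 𝓘(ℝ, E4) φ q v)
      (mfderiv 𝓘(ℝ, E4) 𝓘(ℝ, E4) φ q w) := by
  have h := (mdifferentiable_of_mem_maximalAtlas hφ).symm_comp_deriv hq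
  have hv : ∀ v : TangentSpace 𝓘(ℝ, E4) q, mfderiv 𝓘(ℝ, E4) 𝓘(ℝ, E4) φ.symm (φ q)
      (mfderiv 𝓘(ℝ, E4) 𝓘(ℝ, E4) φ q v) = (v : E4) := fun v ↦ congrArg (fun f ↦ f v) h
  let f : M → E4 → E4 → ℝ := fun x v w ↦ g.val x v w
  change f q v w = f (φ.symm (φ q)) (mfderiv 𝓘(ℝ, E4) 𝓘(ℝ, E4) φ.symm (φ q)
      (mfderiv 𝓘(ℝ, E4) 𝓘(ℝ, E4) φ q v)) (mfderiv 𝓘(ℝ, E4) 𝓘(ℝ, E4) φ.symm (φ q)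
      (mfderiv 𝓘(ℝ, E4) 𝓘(ℝ, E4) φ q w))
  rw [hv, hv, φ.left_inv hq]

/-- Such a `v` is orthogonal to the time-like vector of `signature`, on whose complement the metric
is positive definite. -/
theorem eq_zero_of_val_eq_zero {q : M} {v : TangentSpace 𝓘(ℝ, E4) q}
    (h : ∀ w, g.val q v w = 0) : v = 0 := by
  obtain ⟨e, -, he⟩ := g.signature q
  by_contra hv
  exact (he v (by rw [g.symm]; exact h e) hv).ne' (h v)

theorem exists_equiv_coordForm (hφ : φ ∈ IsManifold.maximalAtlas 𝓘(ℝ, E4) ∞ M) {y : E4}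
    (hy : y ∈ φ.target) :
    ∃ e : E4 ≃L[ℝ] (E4 →L[ℝ] ℝ), (e : E4 →L[ℝ] E4 →L[ℝ] ℝ) = g.coordForm φ y := by
  have hinj : Function.Injective (g.coordForm φ y) := by
    rw [injective_iff_map_eq_zero]
    intro v hv
    have hd := mdifferentiable_of_mem_maximalAtlas hφ
    have hb := hd.symm.mfderiv_bijective hy
    refine (injective_iff_map_eq_zero _).1 hb.1 v (g.eq_zero_of_val_eq_zero fun w ↦ ?_)
    obtain ⟨w', rfl⟩ := hb.2 w
    exact congrArg (fun f ↦ f w') hv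
  have hdim : Module.finrank ℝ E4 = Module.finrank ℝ (E4 →L[ℝ] ℝ) :=
    (InnerProductSpace.toDual ℝ E4).toLinearEquiv.finrank_eq
  let e := (LinearEquiv.ofInjectiveOfFinrankEq (g.coordForm φ y : E4 →ₗ[ℝ] (E4 →L[ℝ] ℝ)) hinj hdim)
  exact ⟨e.toContinuousLinearEquiv, by ext v w; rfl⟩

end LorentzMetric

/-! ### The geodesic equation in a chart. -/

namespace LorentzMetric

theorem IsGeodesicOn.contDiffAt_chart {γ : ℝ → M} {J : Set ℝ} (h : g.IsGeodesicOn γ J)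
    (hφ : φ ∈ IsManifold.maximalAtlas 𝓘(ℝ, E4) ∞ M) {s : ℝ} (hs : s ∈ J) (hγ : γ s ∈ φ.source) :
    ContDiffAt ℝ 2 (φ ∘ γ) s :=
  (((contMDiffAt_of_mem_maximalAtlas hφ hγ).of_le ENat.LEInfty.out).comp s
    (h s hs).1).contDiffAt

theorem IsGeodesicOn.mdifferentiableAt {γ : ℝ → M} {J : Set ℝ} (h : g.IsGeodesicOn γ J)
    {s : ℝ} (hs : s ∈ J) : MDifferentiableAt 𝓘(ℝ, ℝ) 𝓘(ℝ, E4) γ s :=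
  (h s hs).1.mdifferentiableAt (by norm_num)

theorem IsGeodesicOn.hasDerivAt_deriv {γ : ℝ → M} {J : Set ℝ} (h : g.IsGeodesicOn γ J)
    (hφ : φ ∈ IsManifold.maximalAtlas 𝓘(ℝ, E4) ∞ M) {s : ℝ} (hs : s ∈ J) (hγ : γ s ∈ φ.source) :
    HasDerivAt (deriv (φ ∘ γ)) (deriv (deriv (φ ∘ γ)) s) s := by
  have h2 := h.contDiffAt_chart hφ hs hγ
  have h1 : ContDiffAt ℝ 1 (deriv (φ ∘ γ)) s :=
    ((h2.fderiv_right (m := 1) (by norm_num)).clm_apply contDiffAt_const)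
  exact (h1.differentiableAt (by norm_num)).hasDerivAt

theorem fderiv_inCoord (hφ : φ ∈ IsManifold.maximalAtlas 𝓘(ℝ, E4) ∞ M) {y : E4}
    (hy : y ∈ φ.target) (v w k : E4) :
    fderiv ℝ (fun y ↦ g.inCoord φ y v w) y k = fderiv ℝ (g.coordForm φ) y k v w := by
  have h := ((g.contDiffAt_coordForm hφ hy).differentiableAt (by simp)).hasFDerivAt
  have h1 := (h.clm_apply (hasFDerivAt_const v y)).clm_apply (hasFDerivAt_const w y)
  have h2 : fderiv ℝ (fun y ↦ g.inCoord φ y v w) y = _ := h1.fderiv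
  rw [h2]
  simp

theorem IsGeodesicOn.chart_eq {γ : ℝ → M} {J : Set ℝ} (h : g.IsGeodesicOn γ J)
    (hφ : φ ∈ IsManifold.maximalAtlas 𝓘(ℝ, E4) ∞ M) {s : ℝ} (hs : s ∈ J) (hγ : γ s ∈ φ.source)
    (v : E4) :
    g.coordForm φ (φ (γ s)) (deriv (deriv (φ ∘ γ)) s) v
      + fderiv ℝ (g.coordForm φ) (φ (γ s)) (deriv (φ ∘ γ) s) (deriv (φ ∘ γ) s) v
      - 1 / 2 * fderiv ℝ (g.coordForm φ) (φ (γ s)) v (deriv (φ ∘ γ) s) (deriv (φ ∘ γ) s) = 0 := by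
  have := (h s hs).2 φ hφ hγ v
  rwa [fderiv_inCoord hφ (φ.map_source hγ), fderiv_inCoord hφ (φ.map_source hγ)] at this

/-- Solved for the acceleration, the geodesic equation is a first-order system in position and
velocity with a `C¹` right-hand side, to which uniqueness for differential equations applies. -/
theorem IsGeodesicOn.deriv_deriv_eq {γ : ℝ → M} {J : Set ℝ} (h : g.IsGeodesicOn γ J)
    (hφ : φ ∈ IsManifold.maximalAtlas 𝓘(ℝ, E4) ∞ M) {s : ℝ} (hs : s ∈ J) (hγ : γ s ∈ φ.source) :
    deriv (deriv (φ ∘ γ)) s = Lagrange.accel (g.coordForm φ) (φ (γ s)) (deriv (φ ∘ γ) s) := by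
  obtain ⟨e, he⟩ := g.exists_equiv_coordForm hφ (φ.map_source hγ)
  rw [Lagrange.accel, ← he, ContinuousLinearMap.inverse_equiv]
  refine (e.eq_symm_apply).2 ?_
  ext v
  have h1 := h.chart_eq hφ hs hγ v
  have h2 : ∀ w, e w = g.coordForm φ (φ (γ s)) w := fun w ↦ by rw [← he]; rfl
  simp only [sub_apply, smul_apply, ContinuousLinearMap.flip_apply, smul_eq_mul, h2]
  linarith

end LorentzMetric
end Chart

/-! ### Uniqueness of geodesics -/

namespace LorentzMetric

variable {M : Type*} [TopologicalSpace M] [ChartedSpace E4 M] [IsManifold 𝓘(ℝ, E4) ∞ M]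
  {g : LorentzMetric M} {φ : OpenPartialHomeomorph M E4} {γ γ' : ℝ → M} {J : Set ℝ} {s : ℝ}

theorem IsGeodesicOn.hasDerivAt_phase (h : g.IsGeodesicOn γ J)
    (hφ : φ ∈ IsManifold.maximalAtlas 𝓘(ℝ, E4) ∞ M) (hs : s ∈ J) (hγ : γ s ∈ φ.source) :
    HasDerivAt (fun r ↦ ((φ ∘ γ) r, deriv (φ ∘ γ) r))
      (deriv (φ ∘ γ) s, Lagrange.accel (g.coordForm φ) ((φ ∘ γ) s) (deriv (φ ∘ γ) s)) s := by
  have h1 := h.hasDerivAt_deriv hφ hs hγ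
  rw [h.deriv_deriv_eq hφ hs hγ] at h1
  exact ((h.contDiffAt_chart hφ hs hγ).differentiableAt (by norm_num)).hasDerivAt.prodMk h1

theorem IsGeodesicOn.eventually_mem_source (h : g.IsGeodesicOn γ J) (hs : s ∈ J)
    (hγ : γ s ∈ φ.source) : ∀ᶠ r in 𝓝 s, γ r ∈ φ.source :=
  (h s hs).1.continuousAt.eventually (φ.open_source.mem_nhds hγ)

theorem IsGeodesicOn.eventuallyEq_of_chart (h : g.IsGeodesicOn γ J) (h' : g.IsGeodesicOn γ' J)
    (hJ : J ∈ 𝓝 s) (hφ : φ ∈ IsManifold.maximalAtlas 𝓘(ℝ, E4) ∞ M) (hγ : γ s ∈ φ.source)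
    (heq : γ s = γ' s) (hd : deriv (φ ∘ γ) s = deriv (φ ∘ γ') s) : γ =ᶠ[𝓝 s] γ' := by
  have hs := mem_of_mem_nhds hJ
  have hγ' : γ' s ∈ φ.source := heq ▸ hγ
  obtain ⟨e, he⟩ := g.exists_equiv_coordForm hφ (φ.map_source hγ)
  have hsm : ContDiffAt ℝ 1 (fun z : E4 × E4 ↦ (z.2, Lagrange.accel (g.coordForm φ) z.1 z.2))
      (φ (γ s), deriv (φ ∘ γ) s) :=
    contDiffAt_snd.prodMk (Lagrange.contDiffAt_accel
      ((g.contDiffAt_coordForm hφ (φ.map_source hγ)).of_le ENat.LEInfty.out) he _)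
  obtain ⟨K, t, ht, hlip⟩ := hsm.exists_lipschitzOnWith
  have key : ∀ {γ : ℝ → M}, g.IsGeodesicOn γ J → γ s ∈ φ.source →
      t ∈ 𝓝 (φ (γ s), deriv (φ ∘ γ) s) → ∀ᶠ r in 𝓝 s,
        HasDerivAt (fun r ↦ ((φ ∘ γ) r, deriv (φ ∘ γ) r))
          (deriv (φ ∘ γ) r, Lagrange.accel (g.coordForm φ) ((φ ∘ γ) r) (deriv (φ ∘ γ) r)) r ∧
        ((φ ∘ γ) r, deriv (φ ∘ γ) r) ∈ t := by
    intro γ h hγ ht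
    filter_upwards [hJ, h.eventually_mem_source hs hγ,
      (h.hasDerivAt_phase hφ hs hγ).continuousAt.eventually ht] with r h1 h2 h3
    exact ⟨h.hasDerivAt_phase hφ h1 h2, h3⟩
  have := ODE_solution_unique_of_eventually
    (v := fun _ z ↦ (z.2, Lagrange.accel (g.coordForm φ) z.1 z.2)) (s := fun _ ↦ t)
    (Eventually.of_forall fun _ ↦ hlip) (key h hγ ht) (key h' hγ' (by rw [← heq, ← hd]; exact ht))
    (by simp [heq, hd])
  filter_upwards [this, h.eventually_mem_source hs hγ,
    h'.eventually_mem_source hs hγ'] with r h1 h2 h3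
  exact φ.injOn h2 h3 (congrArg Prod.fst h1)

theorem IsGeodesicOn.eventuallyEq (h : g.IsGeodesicOn γ J) (h' : g.IsGeodesicOn γ' J)
    (hJ : J ∈ 𝓝 s)
    (heq : (⟨γ s, velocity γ s⟩ : TangentBundle 𝓘(ℝ, E4) M) = ⟨γ' s, velocity γ' s⟩) :
    γ =ᶠ[𝓝 s] γ' := by
  have hs := mem_of_mem_nhds hJ
  have h0 : γ s = γ' s := congrArg TotalSpace.proj heq
  set φ := chartAt E4 (γ s)
  have hφ : φ ∈ IsManifold.maximalAtlas 𝓘(ℝ, E4) ∞ M := IsManifold.chart_mem_maximalAtlas _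
  have hγ : γ s ∈ φ.source := mem_chart_source _ _
  refine h.eventuallyEq_of_chart h' hJ hφ hγ h0 ?_
  rw [(hasDerivAt_chart hφ (h.mdifferentiableAt hs) hγ).deriv,
    (hasDerivAt_chart hφ (h'.mdifferentiableAt hs) (h0 ▸ hγ)).deriv]
  exact congrArg (fun z : TangentBundle 𝓘(ℝ, E4) M ↦
    (mfderiv 𝓘(ℝ, E4) 𝓘(ℝ, E4) φ z.1 z.2 : E4)) heq

/-- Two geodesics with a common velocity vector agree. -/
theorem IsGeodesicOn.eqOn [T2Space M] {a b : ℝ} (h : g.IsGeodesicOn γ (Ioo a b))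
    (h' : g.IsGeodesicOn γ' (Ioo a b)) (hs : s ∈ Ioo a b)
    (heq : (⟨γ s, velocity γ s⟩ : TangentBundle 𝓘(ℝ, E4) M) = ⟨γ' s, velocity γ' s⟩) :
    EqOn γ γ' (Ioo a b) := by
  set A : Set ℝ := {r | ∀ᶠ r' in 𝓝 r, γ r' = γ' r'} with hA
  have hAo : IsOpen A := isOpen_setOfPred_eventually_nhds
  have hsub : Ioo a b ⊆ A := by
    -- At a limit of points of local agreement, the positions agree since `M` is Hausdorff and the
    -- coordinate velocities agree by continuity, so local uniqueness applies there too.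
    refine isPreconnected_Ioo.subset_of_closure_inter_subset hAo
      ⟨s, hs, h.eventuallyEq h' (Ioo_mem_nhds hs.1 hs.2) heq⟩ ?_
    rintro r ⟨hrA, hr⟩
    have hfr : ∃ᶠ r' in 𝓝 r, r' ∈ A := mem_closure_iff_frequently.1 hrA
    have h0 : γ r = γ' r := by
      by_contra hne
      have : ∀ᶠ r' in 𝓝 r, γ r' ≠ γ' r' :=
        ((h r hr).1.continuousAt.prodMk (h' r hr).1.continuousAt).eventually
          (isClosed_diagonal.isOpen_compl.mem_nhds hne)
      obtain ⟨r', h1, h2⟩ := (hfr.and_eventually this).exists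
      exact h2 (show ∀ᶠ x in 𝓝 r', γ x = γ' x from h1).self_of_nhds
    set φ := chartAt E4 (γ r)
    have hφ : φ ∈ IsManifold.maximalAtlas 𝓘(ℝ, E4) ∞ M := IsManifold.chart_mem_maximalAtlas _
    have hγ : γ r ∈ φ.source := mem_chart_source _ _
    refine h.eventuallyEq_of_chart h' (Ioo_mem_nhds hr.1 hr.2) hφ hγ h0 ?_
    by_contra hne
    have : ∀ᶠ r' in 𝓝 r, deriv (φ ∘ γ) r' ≠ deriv (φ ∘ γ') r' :=
      ((h.hasDerivAt_deriv hφ hr hγ).continuousAt.prodMk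
        (h'.hasDerivAt_deriv hφ hr (h0 ▸ hγ)).continuousAt).eventually
          (isClosed_diagonal.isOpen_compl.mem_nhds hne)
    obtain ⟨r', h1, h2⟩ := (hfr.and_eventually this).exists
    refine h2 (EventuallyEq.deriv_eq ?_)
    filter_upwards [h1] with r'' h3
    simp [h3]
  exact fun r hr ↦ (show ∀ᶠ x in 𝓝 r, γ x = γ' x from hsub hr).self_of_nhds

theorem isGeodesicOn_const (q : M) : g.IsGeodesicOn (fun _ ↦ q) J := by
  intro s _
  refine ⟨contMDiffAt_const, fun φ hφ hq v ↦ ?_⟩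
  have hd : ∀ r, deriv (φ ∘ fun _ : ℝ ↦ q) r = 0 := fun r ↦ deriv_const r (φ q)
  have hd2 : deriv (φ ∘ fun _ : ℝ ↦ q) = fun _ ↦ 0 := funext hd
  have h0 : ∀ y w, g.inCoord φ y 0 w = 0 := fun y w ↦ by simp [← coordForm_apply]
  simp [hd2, h0]

/-- A geodesic whose velocity vanishes somewhere coincides with a constant geodesic. -/
theorem IsGeodesicOn.velocity_ne_zero [T2Space M] {a b r : ℝ} (h : g.IsGeodesicOn γ (Ioo a b))
    (hs : s ∈ Ioo a b) (hv : velocity γ s ≠ 0) (hr : r ∈ Ioo a b) : velocity γ r ≠ 0 := by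
  intro h0
  have hc : velocity (fun _ : ℝ ↦ γ r) r = (0 : E4) := by
    unfold velocity
    rw [mfderiv_const]
    rfl
  have heq := h.eqOn (isGeodesicOn_const (γ r)) hr (by
    congr 1
    exact h0.trans hc.symm)
  have hev : γ =ᶠ[𝓝 s] fun _ ↦ γ r := heq.eventuallyEq_of_mem (Ioo_mem_nhds hs.1 hs.2)
  apply hv
  have : mfderiv 𝓘(ℝ, ℝ) 𝓘(ℝ, E4) γ s = (0 : ℝ →L[ℝ] E4) := by
    rw [hev.mfderiv_eq, mfderiv_const]; rfl
  unfold velocity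
  exact congrArg (fun f : ℝ →L[ℝ] E4 ↦ f 1) this

/-- The length of the velocity of a geodesic is constant. -/
theorem IsGeodesicOn.val_velocity_eq {a b r : ℝ} (h : g.IsGeodesicOn γ (Ioo a b))
    (hs : s ∈ Ioo a b) (hr : r ∈ Ioo a b) :
    g.val (γ r) (velocity γ r) (velocity γ r) = g.val (γ s) (velocity γ s) (velocity γ s) := by
  have hd : ∀ r ∈ Ioo a b,
      HasDerivAt (fun r ↦ g.val (γ r) (velocity γ r) (velocity γ r)) 0 r := by
    intro r hr
    set φ := chartAt E4 (γ r)
    have hφ : φ ∈ IsManifold.maximalAtlas 𝓘(ℝ, E4) ∞ M := IsManifold.chart_mem_maximalAtlas _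
    have hγ : γ r ∈ φ.source := mem_chart_source _ _
    have hc : HasDerivAt (φ ∘ γ) (deriv (φ ∘ γ) r) r :=
      ((h.contDiffAt_chart hφ hr hγ).differentiableAt (by norm_num)).hasDerivAt
    have hc2 := h.hasDerivAt_deriv hφ hr hγ
    have h1 := Lagrange.hasDerivAt_apply ((g.contDiffAt_coordForm hφ
      (φ.map_source hγ)).differentiableAt (by simp)) hc hc2 hc2
    refine (h1.congr_of_eventuallyEq ?_).congr_deriv ?_
    · filter_upwards [Ioo_mem_nhds hr.1 hr.2, h.eventually_mem_source hr hγ] with r' h1 h2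
      rw [val_eq_coordForm hφ h2, (hasDerivAt_chart hφ (h.mdifferentiableAt h1) h2).deriv]
      rfl
    -- The derivative is twice the geodesic equation contracted with the velocity.
    · have h2 := h.chart_eq hφ hr hγ (deriv (φ ∘ γ) r)
      have h3 := coordForm_symm (g := g) (φ := φ) (φ (γ r)) (deriv (deriv (φ ∘ γ)) r)
        (deriv (φ ∘ γ) r)
      simp only [Function.comp_apply]
      linarith
  exact isOpen_Ioo.is_const_of_deriv_eq_zero isPreconnected_Ioo
    (fun r hr ↦ (hd r hr).differentiableAt.differentiableWithinAt)
    (fun r hr ↦ (hd r hr).deriv) hr hs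

/-- Affine reparametrization. -/
theorem IsGeodesicOn.comp_mul {a b k : ℝ} (hk : 0 < k) (h : g.IsGeodesicOn γ (Ioo a b)) :
    g.IsGeodesicOn (fun r ↦ γ (k * r)) (Ioo (a / k) (b / k)) := by
  intro s hs
  have hks : k * s ∈ Ioo a b := by
    rw [mem_Ioo, div_lt_iff₀ hk, lt_div_iff₀ hk] at hs
    exact ⟨by linarith [hs.1], by linarith [hs.2]⟩
  refine ⟨ContMDiffAt.comp s (g := γ) (f := fun r ↦ k * r) (h _ hks).1
    (contDiffAt_const.mul contDiffAt_id).contMDiffAt, fun φ hφ hq v ↦ ?_⟩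
  have hd : deriv (φ ∘ fun r ↦ γ (k * r)) = fun r ↦ k • deriv (φ ∘ γ) (k * r) := by
    funext r
    exact deriv_comp_mul_left k (φ ∘ γ) r
  have hd2 : deriv (deriv (φ ∘ fun r ↦ γ (k * r))) s = (k * k) • deriv (deriv (φ ∘ γ)) (k * s) := by
    rw [hd, deriv_fun_const_smul_field, mul_smul]
    congr 1
    exact deriv_comp_mul_left k (deriv (φ ∘ γ)) s
  have h2 := h.chart_eq hφ hks hq v
  rw [hd2, fderiv_inCoord hφ (φ.map_source hq), fderiv_inCoord hφ (φ.map_source hq), hd,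
    ← coordForm_apply]
  rw [Lagrange.apply_smul, h2, mul_zero]

theorem IsGeodesicFrom.comp_mul {p : M} {v : TangentSpace 𝓘(ℝ, E4) p} {a b k : ℝ} (hk : 0 < k)
    (h : g.IsGeodesicFrom p v γ a b) :
    g.IsGeodesicFrom p (k • v) (fun r ↦ γ (k * r)) (a / k) (b / k) := by
  obtain ⟨ha, hb, hγ, h0⟩ := h
  refine ⟨div_neg_of_neg_of_pos ha hk, div_pos hb hk, hγ.comp_mul hk, ?_⟩
  have hp : γ 0 = p := congrArg TotalSpace.proj h0
  subst hp
  have hv : velocity γ 0 = v := by simpa using h0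
  have h1 : MDifferentiableAt 𝓘(ℝ, ℝ) 𝓘(ℝ, E4) γ (k * 0) := by
    rw [mul_zero]; exact hγ.mdifferentiableAt ⟨ha, hb⟩
  have h2 : HasMFDerivAt 𝓘(ℝ, ℝ) 𝓘(ℝ, ℝ) (fun r : ℝ ↦ k * r) 0
      (k • ContinuousLinearMap.id ℝ ℝ) :=
    hasMFDerivAt_iff_hasFDerivAt.2 ((hasFDerivAt_id (0 : ℝ)).const_mul k)
  have h3 := (HasMFDerivAt.comp (0 : ℝ) (g := γ) (f := fun r : ℝ ↦ k * r)
    h1.hasMFDerivAt h2).mfderiv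
  let F : ℝ → TangentBundle 𝓘(ℝ, E4) M := fun x ↦ ⟨γ x, (k • velocity γ x : E4)⟩
  have h4 : (velocity (fun r ↦ γ (k * r)) 0 : E4) = (k • velocity γ (k * 0) : E4) := by
    refine (congrArg (fun f : ℝ →L[ℝ] E4 ↦ f 1) h3).trans ?_
    have h5 : ∀ f : ℝ →L[ℝ] E4, f.comp (k • ContinuousLinearMap.id ℝ ℝ) 1 = k • f 1 := fun f ↦ by
      simp
    exact h5 _
  have h6 : (⟨γ (k * 0), velocity (fun r ↦ γ (k * r)) 0⟩ : TangentBundle 𝓘(ℝ, E4) M)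
      = F (k * 0) := by
    simp only [F]
    congr 1
  rw [h6, mul_zero, ← hv]

end LorentzMetric

/-! ### Null vectors and null geodesics of a foliated space-time -/

namespace FoliatedSpacetime

variable {M : Type*} [TopologicalSpace M] [ChartedSpace E4 M] [IsManifold 𝓘(ℝ, E4) ∞ M]
  {S : FoliatedSpacetime M} {x p : M} {v w : TangentSpace 𝓘(ℝ, E4) p} {γ γ' : ℝ → M}
  {a b a' b' s s' : ℝ}

theorem dt_add (v w : TangentSpace 𝓘(ℝ, E4) x) : S.dt x (v + w) = S.dt x v + S.dt x w :=
  map_add (mfderiv 𝓘(ℝ, E4) 𝓘(ℝ, ℝ) S.time x) v w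

theorem dt_sub (v w : TangentSpace 𝓘(ℝ, E4) x) : S.dt x (v - w) = S.dt x v - S.dt x w :=
  map_sub (mfderiv 𝓘(ℝ, E4) 𝓘(ℝ, ℝ) S.time x) v w

theorem dt_smul (k : ℝ) (v : TangentSpace 𝓘(ℝ, E4) x) : S.dt x (k • v) = k * S.dt x v :=
  map_smul (mfderiv 𝓘(ℝ, E4) 𝓘(ℝ, ℝ) S.time x) k v

theorem dt_T_pos (S : FoliatedSpacetime M) (x : M) : 0 < S.dt x (S.T x) := S.T_future x

theorem lapse_pos (S : FoliatedSpacetime M) (x : M) : 0 < S.lapse x := inv_pos.2 (S.T_future x)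

theorem lapse_mul_dt_T (S : FoliatedSpacetime M) (x : M) : S.lapse x * S.dt x (S.T x) = 1 :=
  inv_mul_cancel₀ (S.dt_T_pos x).ne'

/-- Subtracting the multiple of `T` with the same `dt` leaves a vector tangent to the slice, which
is orthogonal to `T`. -/
theorem val_T (v : TangentSpace 𝓘(ℝ, E4) x) : S.g.val x (S.T x) v = -(S.lapse x * S.dt x v) := by
  have h0 := S.lapse_mul_dt_T x
  have h : S.dt x (v - (S.lapse x * S.dt x v) • S.T x) = 0 := by
    rw [dt_sub, dt_smul]
    linear_combination (-(S.dt x v)) * h0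
  have h1 := S.T_normal x _ h
  rw [map_sub, map_smul, S.T_unit, smul_eq_mul] at h1
  linarith

theorem val_T_right (v : TangentSpace 𝓘(ℝ, E4) x) :
    S.g.val x v (S.T x) = -(S.lapse x * S.dt x v) := by
  rw [S.g.symm, val_T]

theorem nullVector_isPastNull (hw : w ∈ S.directions p) : S.IsPastNull p (S.nullVector p w) := by
  obtain ⟨h1, h2⟩ := hw
  constructor
  · have h3 := val_T (S := S) w
    have h4 := val_T_right (S := S) w
    simp only [nullVector, map_sub, sub_apply, h2, h3, h4, h1, S.T_unit]
    ring
  · rw [nullVector, dt_sub, h1]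
    linarith [S.dt_T_pos p]

theorem IsPastNull.val_T_pos (hv : S.IsPastNull p v) : 0 < S.g.val p v (S.T p) := by
  rw [val_T_right]
  nlinarith [S.lapse_pos p, hv.2, mul_pos_of_neg_of_neg (neg_neg_of_pos (S.lapse_pos p)) hv.2]

theorem val_proj (hv : S.IsPastNull p v) :
    S.g.val p (S.proj p v) (S.proj p v) = (S.g.val p v (S.T p)) ^ 2 := by
  have h1 := S.g.symm p (S.T p) v
  simp only [proj, map_add, map_smul, add_apply, smul_apply, hv.1, S.T_unit, smul_eq_mul, h1]
  ring

theorem dt_proj : S.dt p (S.proj p v) = 0 := by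
  have h0 := S.lapse_mul_dt_T p
  rw [proj, dt_add, dt_smul, val_T_right]
  linear_combination (-(S.dt p v)) * h0

/-- A past directed null vector is a multiple of `ℓ_w`, where `w` is its direction. -/
theorem IsPastNull.exists_direction (hv : S.IsPastNull p v) :
    (S.g.val p v (S.T p))⁻¹ • S.proj p v ∈ S.directions p ∧
      v = S.g.val p v (S.T p) • S.nullVector p ((S.g.val p v (S.T p))⁻¹ • S.proj p v) := by
  have hpos := hv.val_T_pos
  refine ⟨⟨by rw [dt_smul, dt_proj, mul_zero], ?_⟩, ?_⟩
  · simp only [map_smul, smul_apply, smul_eq_mul, val_proj hv]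
    field_simp
  · rw [nullVector, smul_sub, smul_smul, mul_inv_cancel₀ hpos.ne', one_smul, proj]
    abel

/-- Opposite null vectors have opposite directions. -/
theorem direction_neg {v₁ v₂ : TangentSpace 𝓘(ℝ, E4) p} (h₁ : S.IsPastNull p v₁)
    (h₂ : S.IsPastNull p v₂) {k : ℝ} (hk : 0 < k) (h : S.proj p v₁ = -(k • S.proj p v₂)) :
    (S.g.val p v₁ (S.T p))⁻¹ • S.proj p v₁ = -((S.g.val p v₂ (S.T p))⁻¹ • S.proj p v₂) := by
  have hp1 := h₁.val_T_pos
  have hp2 := h₂.val_T_pos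
  have e1 := val_proj h₁
  have e2 := val_proj h₂
  have e3 : S.g.val p v₁ (S.T p) = k * S.g.val p v₂ (S.T p) := by
    have : (S.g.val p v₁ (S.T p)) ^ 2 = (k * S.g.val p v₂ (S.T p)) ^ 2 := by
      rw [← e1, mul_pow, ← e2, h]
      simp only [map_neg, map_smul, neg_apply, smul_apply, smul_eq_mul]
      ring
    exact (pow_left_inj₀ hp1.le (by positivity) two_ne_zero).1 this
  rw [h, e3, smul_neg, smul_smul]
  congr 2
  field_simp

theorem hasDerivAt_time (hγ : MDifferentiableAt 𝓘(ℝ, ℝ) 𝓘(ℝ, E4) γ s) :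
    HasDerivAt (S.time ∘ γ) (S.dt (γ s) (velocity γ s)) s := by
  have h1 := (S.time_smooth.mdifferentiableAt (x := γ s) (by simp)).hasMFDerivAt
  let L : ℝ →L[ℝ] ℝ :=
    (mfderiv 𝓘(ℝ, E4) 𝓘(ℝ, ℝ) S.time (γ s)).comp (mfderiv 𝓘(ℝ, ℝ) 𝓘(ℝ, E4) γ s)
  have h2 : HasFDerivAt (S.time ∘ γ) L s :=
    hasMFDerivAt_iff_hasFDerivAt.1 (h1.comp s hγ.hasMFDerivAt)
  have h3 : HasDerivAt (S.time ∘ γ) (L 1) s := h2.hasDerivAt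
  exact h3

/-- A geodesic starting from `p` with a past directed null velocity. -/
def IsPastRay (S : FoliatedSpacetime M) (p : M) (v : TangentSpace 𝓘(ℝ, E4) p) (γ : ℝ → M)
    (a b : ℝ) : Prop :=
  S.IsPastNull p v ∧ S.g.IsGeodesicFrom p v γ a b

theorem IsPastRay.isGeodesicOn (h : S.IsPastRay p v γ a b) : S.g.IsGeodesicOn γ (Ioo a b) :=
  h.2.2.2.1

theorem IsPastRay.apply_zero (h : S.IsPastRay p v γ a b) : γ 0 = p :=
  congrArg TotalSpace.proj h.2.2.2.2

theorem IsPastRay.zero_mem (h : S.IsPastRay p v γ a b) : (0 : ℝ) ∈ Ioo a b := ⟨h.2.1, h.2.2.1⟩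

theorem IsPastRay.isPastNull_zero (h : S.IsPastRay p v γ a b) :
    S.IsPastNull (γ 0) (velocity γ 0) := by
  have h1 : ∀ z : TangentBundle 𝓘(ℝ, E4) M, z = ⟨p, v⟩ → S.IsPastNull z.1 z.2 := by
    rintro z rfl; exact h.1
  exact h1 _ h.2.2.2.2

/-- The velocity of a past directed null geodesic stays past directed and null. -/
theorem IsPastRay.isPastNull [T2Space M] (h : S.IsPastRay p v γ a b) (hs : s ∈ Ioo a b) :
    S.IsPastNull (γ s) (velocity γ s) := by
  have h0 := h.isPastNull_zero
  have hnull : ∀ s ∈ Ioo a b, S.g.val (γ s) (velocity γ s) (velocity γ s) = 0 := fun s hs ↦ by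
    rw [h.isGeodesicOn.val_velocity_eq h.zero_mem hs]; exact h0.1
  refine ⟨hnull s hs, ?_⟩
  have hv0 : velocity γ 0 ≠ 0 := by
    intro hv
    have h1 := h0.2
    have h2 := dt_smul (S := S) 0 (velocity γ 0)
    rw [hv, smul_zero, zero_mul] at h2
    rw [hv, h2] at h1
    exact lt_irrefl _ h1
  -- A nonzero vector with `dt = 0` is space-like, hence not null. So `dt` of the velocity never
  -- vanishes and keeps its initial sign by continuity.
  have hne : ∀ s ∈ Ioo a b, S.dt (γ s) (velocity γ s) ≠ 0 := fun s hs h1 ↦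
    (S.spacelike (γ s) _ h1 (h.isGeodesicOn.velocity_ne_zero h.zero_mem hv0 hs)).ne' (hnull s hs)
  have hd : ∀ s ∈ Ioo a b, deriv (S.time ∘ γ) s = S.dt (γ s) (velocity γ s) := fun s hs ↦
    (hasDerivAt_time (h.isGeodesicOn.mdifferentiableAt hs)).deriv
  have hcont : ContinuousOn (deriv (S.time ∘ γ)) (Ioo a b) := fun s hs ↦ by
    have h1 : ContDiffAt ℝ 2 (S.time ∘ γ) s :=
      ((S.time_smooth.contMDiffAt.of_le ENat.LEInfty.out).comp s (h.isGeodesicOn s hs).1).contDiffAt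
    exact ((h1.fderiv_right (m := 1) (by norm_num)).clm_apply
      contDiffAt_const).continuousAt.continuousWithinAt
  by_contra hpos
  have hpos' : 0 < deriv (S.time ∘ γ) s := by
    rw [hd s hs]; exact lt_of_le_of_ne (not_lt.1 hpos) (hne s hs).symm
  have hneg : deriv (S.time ∘ γ) 0 < 0 := by rw [hd 0 h.zero_mem]; exact h0.2
  obtain ⟨r, hr, hr0⟩ := isPreconnected_Ioo.intermediate_value h.zero_mem hs hcont
    ⟨hneg.le, hpos'.le⟩
  exact hne r hr (by rw [← hd r hr, hr0])

theorem IsPastRay.strictAntiOn [T2Space M] (h : S.IsPastRay p v γ a b) :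
    StrictAntiOn (S.time ∘ γ) (Ioo a b) := by
  have hd : ∀ s ∈ Ioo a b, HasDerivAt (S.time ∘ γ) (S.dt (γ s) (velocity γ s)) s := fun s hs ↦
    hasDerivAt_time (h.isGeodesicOn.mdifferentiableAt hs)
  refine strictAntiOn_of_deriv_neg (convex_Ioo a b)
    (fun s hs ↦ (hd s hs).continuousAt.continuousWithinAt) fun s hs ↦ ?_
  rw [interior_Ioo] at hs
  rw [(hd s hs).deriv]
  exact (h.isPastNull hs).2

/-- A past directed null geodesic meets a level set of the time function at most once. -/
theorem IsPastRay.eq_of_time_eq [T2Space M] (h : S.IsPastRay p v γ a b)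
    (h' : S.IsPastRay p v γ' a' b') (hs : s ∈ Ico 0 b) (hs' : s' ∈ Ico 0 b')
    (ht : S.time (γ s) = S.time (γ' s')) : γ s = γ' s' := by
  have hz := h.zero_mem
  have hz' := h'.zero_mem
  have heq : EqOn γ γ' (Ioo (max a a') (min b b')) := by
    refine LorentzMetric.IsGeodesicOn.eqOn (s := 0) (g := S.g)
      (fun r hr ↦ h.isGeodesicOn r
        ⟨(le_max_left _ _).trans_lt hr.1, hr.2.trans_le (min_le_left _ _)⟩)
      (fun r hr ↦ h'.isGeodesicOn r
        ⟨(le_max_right _ _).trans_lt hr.1, hr.2.trans_le (min_le_right _ _)⟩)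
      ⟨max_lt hz.1 hz'.1, lt_min hz.2 hz'.2⟩ (h.2.2.2.2.trans h'.2.2.2.2.symm)
  have hmax : max a a' < 0 := max_lt hz.1 hz'.1
  rcases le_total s s' with hle | hle
  · have h1 := heq ⟨hmax.trans_le hs.1, lt_min hs.2 (hle.trans_lt hs'.2)⟩
    have : s = s' := h'.strictAntiOn.injOn ⟨hz'.1.trans_le hs.1, hle.trans_lt hs'.2⟩
      ⟨hz'.1.trans_le hs'.1, hs'.2⟩ (by simp only [Function.comp_apply]; rw [← h1, ht])
    rw [h1, this]
  · have h1 := heq ⟨hmax.trans_le hs'.1, lt_min (hle.trans_lt hs.2) hs'.2⟩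
    have : s = s' := h.strictAntiOn.injOn ⟨hz.1.trans_le hs.1, hs.2⟩
      ⟨hz.1.trans_le hs'.1, hle.trans_lt hs.2⟩ (by simp only [Function.comp_apply]; rw [h1, ht])
    rw [← h1, this]

end FoliatedSpacetime

/-! ### Adapted coordinates -/

namespace FoliatedSpacetime

/-- The spatial part of the coordinates, as a linear map. -/
def spatialL : E4 →L[ℝ] E3 :=
  LinearMap.toContinuousLinearMap
    { toFun := spatial
      map_add' := fun _ _ ↦ rfl
      map_smul' := fun _ _ ↦ rfl }

theorem spatialL_apply (y : E4) : spatialL y = spatial y := rfl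

/-- The vector with vanishing time component and given spatial part. -/
def emb : E3 →L[ℝ] E4 :=
  LinearMap.toContinuousLinearMap
    { toFun := fun x ↦ WithLp.toLp 2 (Fin.cons 0 x)
      map_add' := fun x y ↦ by
        ext i; refine Fin.cases ?_ (fun j ↦ ?_) i <;> simp
      map_smul' := fun k x ↦ by
        ext i; refine Fin.cases ?_ (fun j ↦ ?_) i <;> simp }

@[simp] theorem emb_zero_apply (x : E3) : emb x 0 = 0 := rfl

@[simp] theorem emb_succ_apply (x : E3) (i : Fin 3) : emb x i.succ = x i := rfl

/-- The time direction. -/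
def timeVec : E4 := EuclideanSpace.single 0 1

@[simp] theorem spatial_emb (x : E3) : spatial (emb x) = x := rfl

@[simp] theorem timeVec_zero : timeVec 0 = 1 := by simp [timeVec]

@[simp] theorem spatial_timeVec : spatial timeVec = 0 := by
  ext i; simp [timeVec, spatial]

theorem smul_timeVec_add_emb (y : E4) : y 0 • timeVec + emb (spatial y) = y := by
  ext i
  refine Fin.cases ?_ (fun j ↦ ?_) i
  · simp
  · simp [timeVec, spatial]

theorem emb_eq_sum (x : E3) : emb x = ∑ i, x i • EuclideanSpace.single (Fin.succ i) (1 : ℝ) := by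
  ext j
  refine Fin.cases ?_ (fun k ↦ ?_) j
  · simp
  · simp [Finset.sum_apply, Pi.single_apply, Fin.succ_inj]

theorem sum_abs_le (x : E3) : ∑ i, |x i| ≤ 2 * ‖x‖ ∧ (∑ i, |x i|) ^ 2 ≤ 3 * ‖x‖ ^ 2 := by
  have h : (∑ i, |x i|) ^ 2 ≤ 3 * ‖x‖ ^ 2 := by
    have := sq_sum_le_card_mul_sum_sq (s := Finset.univ) (f := fun i ↦ |x i|)
    rw [EuclideanSpace.norm_sq_eq]
    simpa using this
  refine ⟨?_, h⟩
  have h0 : 0 ≤ ∑ i, |x i| := Finset.sum_nonneg fun _ _ ↦ abs_nonneg _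
  nlinarith [norm_nonneg x]

/-- The vector that represents a linear form. -/
def sharp : (E3 →L[ℝ] ℝ) →L[ℝ] E3 :=
  LinearMap.toContinuousLinearMap
    { toFun := (InnerProductSpace.toDual ℝ E3).symm
      map_add' := map_add _
      map_smul' := fun k f ↦ by simp }

@[simp] theorem inner_sharp (f : E3 →L[ℝ] ℝ) (w : E3) : ⟪sharp f, w⟫ = f w :=
  InnerProductSpace.toDual_symm_apply

theorem norm_le_of_abs_inner_le {x : E3} {C : ℝ} (h : ∀ w, |⟪x, w⟫| ≤ C * ‖w‖) : ‖x‖ ≤ C := by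
  rcases eq_or_ne x 0 with rfl | hx
  · rw [norm_zero]
    have := (abs_nonneg _).trans (h (EuclideanSpace.single 0 1))
    simpa using this
  · have h1 := h x
    rw [real_inner_self_eq_norm_sq, abs_of_nonneg (by positivity), sq] at h1
    exact le_of_mul_le_mul_right h1 (norm_pos_iff.2 hx)

variable {B : E4 →L[ℝ] E4 →L[ℝ] ℝ} {n ε : ℝ}

/-- The factor `3` comes from `(∑ |v i|)² ≤ 3 ‖v‖²`, applied to both vectors. -/
theorem abs_emb_emb_sub_inner_le (h : ∀ α β : Fin 4, |B (EuclideanSpace.single α 1)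
      (EuclideanSpace.single β 1) - minkowski n α β| < ε) (v w : E3) :
    |B (emb v) (emb w) - ⟪v, w⟫| ≤ 3 * ε * ‖v‖ * ‖w‖ := by
  have e1 : B (emb v) (emb w) - ⟪v, w⟫ = ∑ i, ∑ j, v i * w j *
      (B (EuclideanSpace.single (Fin.succ i) 1) (EuclideanSpace.single (Fin.succ j) 1)
        - minkowski n (Fin.succ i) (Fin.succ j)) := by
    have e2 : B (emb v) (emb w) = ∑ i, ∑ j, v i * w j *
        B (EuclideanSpace.single (Fin.succ i) 1) (EuclideanSpace.single (Fin.succ j) 1) := by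
      rw [emb_eq_sum, emb_eq_sum]
      simp only [map_sum, map_smul, sum_apply, smul_apply, smul_eq_mul, Finset.mul_sum]
      rw [Finset.sum_comm]
      refine Finset.sum_congr rfl fun i _ ↦ Finset.sum_congr rfl fun j _ ↦ ?_
      ring
    have e3 : ⟪v, w⟫ = ∑ i, ∑ j, v i * w j * minkowski n (Fin.succ i) (Fin.succ j) := by
      simp [minkowski, Fin.succ_inj, PiLp.inner_apply, mul_comm]
    rw [e2, e3]
    simp only [mul_sub, Finset.sum_sub_distrib]
  rw [e1]
  have h0 : 0 ≤ ε := (abs_nonneg _).trans (h 0 0).le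
  have h1 : ∑ i, ∑ j, |v i| * |w j| * ε = ε * ((∑ i, |v i|) * (∑ j, |w j|)) := by
    rw [Finset.sum_mul_sum, Finset.mul_sum]
    refine Finset.sum_congr rfl fun i _ ↦ ?_
    rw [Finset.mul_sum]
    exact Finset.sum_congr rfl fun j _ ↦ mul_comm _ _
  have h2 : (∑ i, |v i|) * (∑ j, |w j|) ≤ 3 * (‖v‖ * ‖w‖) := by
    refine abs_le_of_sq_le_sq' ?_ (by positivity) |>.2
    calc ((∑ i, |v i|) * (∑ j, |w j|)) ^ 2 = (∑ i, |v i|) ^ 2 * (∑ j, |w j|) ^ 2 := by ring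
      _ ≤ (3 * ‖v‖ ^ 2) * (3 * ‖w‖ ^ 2) := by
        gcongr <;> exact (sum_abs_le _).2
      _ = _ := by ring
  calc _ ≤ ∑ i, ∑ j, |v i| * |w j| * ε := by
        refine (Finset.abs_sum_le_sum_abs _ _).trans (Finset.sum_le_sum fun i _ ↦
          (Finset.abs_sum_le_sum_abs _ _).trans (Finset.sum_le_sum fun j _ ↦ ?_))
        rw [abs_mul, abs_mul]
        gcongr
        exact (h _ _).le
    _ ≤ ε * (3 * (‖v‖ * ‖w‖)) := by rw [h1]; gcongr
    _ = _ := by ring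

theorem abs_timeVec_emb_le (h : ∀ α β : Fin 4, |B (EuclideanSpace.single α 1)
      (EuclideanSpace.single β 1) - minkowski n α β| < ε) (w : E3) :
    |B timeVec (emb w)| ≤ 2 * ε * ‖w‖ := by
  have h0 : 0 ≤ ε := (abs_nonneg _).trans (h 0 0).le
  have e1 : B timeVec (emb w) = ∑ j, w j * B timeVec (EuclideanSpace.single (Fin.succ j) 1) := by
    rw [emb_eq_sum]
    simp only [map_sum, map_smul, smul_eq_mul]
  rw [e1]
  calc _ ≤ ∑ j, |w j| * ε := by
        refine (Finset.abs_sum_le_sum_abs _ _).trans (Finset.sum_le_sum fun j _ ↦ ?_)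
        rw [abs_mul]
        have := (h 0 (Fin.succ j)).le
        rw [minkowski, if_neg (Fin.succ_ne_zero j).symm, sub_zero] at this
        gcongr
        exact this
    _ ≤ ε * (2 * ‖w‖) := by
        rw [← Finset.sum_mul, mul_comm]
        gcongr
        exact (sum_abs_le w).1
    _ = _ := by ring

theorem abs_timeVec_timeVec_add_le (h : ∀ α β : Fin 4, |B (EuclideanSpace.single α 1)
      (EuclideanSpace.single β 1) - minkowski n α β| < ε) :
    |B timeVec timeVec + n ^ 2| ≤ ε := by
  have := (h 0 0).le
  simpa [minkowski, timeVec] using this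

variable {M : Type*} [TopologicalSpace M] [ChartedSpace E4 M] [IsManifold 𝓘(ℝ, E4) ∞ M]
  {S : FoliatedSpacetime M} {p : M} {R : ℝ}

/-- Conditions on the sizes of the time `T` and the error `θ` in adapted coordinates. -/
structure ConeParams (n ε R T θ : ℝ) : Prop where
  T_pos : 0 < T
  T_lt : 3 * T < 2 * R
  T_le : T ≤ n * R
  ε_le : 3 * ε ≤ θ
  ε_le₁ : 2 * ε ≤ θ * n
  ε_le₂ : ε ≤ θ * n ^ 2
  θ_nonneg : 0 ≤ θ
  θ_le : θ ≤ 1 / 100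

/-- Coordinates around `p` whose zeroth component is the time function, in which the metric is
close to the Minkowski metric. -/
structure AdaptedChart (S : FoliatedSpacetime M) (p : M) (ε R : ℝ) where
  /-- The coordinates. -/
  φ : OpenPartialHomeomorph M E4
  mem : φ ∈ IsManifold.maximalAtlas 𝓘(ℝ, E4) ∞ M
  mem_source : p ∈ φ.source
  time_eq : ∀ q ∈ φ.source, φ q 0 = S.time q
  near : ∀ y ∈ φ.target, ∀ α β : Fin 4,
    |S.g.coordForm φ y (EuclideanSpace.single α 1) (EuclideanSpace.single β 1)
      - minkowski (S.lapse p) α β| < ε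
  mem_target : ∀ y : E4, y 0 ∈ Icc (S.time p - R) (S.time p) →
    ‖spatial y - spatial (φ p)‖ < 2 * R → y ∈ φ.target

theorem AssumptionA3.exists_adaptedChart {r₀ : ℝ} (hr : 0 < r₀) (h : S.AssumptionA3 p ε r₀) :
    Nonempty (AdaptedChart S p ε (r₀ / 3)) := by
  obtain ⟨φ, hφ, J, V, hJ, hp, htime, htarget, hnear, -, -, hball⟩ := h
  refine ⟨⟨φ, hφ, hp, htime, hnear, fun y hy0 hy ↦ ?_⟩⟩
  -- The ball at the bottom time `t(p) - r₀/3` has the full radius `2 r₀ / 3`. The product form of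
  -- the image carries it up to `t(p)` and yields a cylinder.
  have h1 : ((S.time p - r₀ / 3) • timeVec + emb (spatial y) : E4) ∈ φ.target := by
    refine hball (S.time p - r₀ / 3) ⟨le_rfl, by linarith⟩ _ (by simp) ?_
    have : spatial ((S.time p - r₀ / 3) • timeVec + emb (spatial y)) = spatial y := by
      rw [← spatialL_apply, map_add, map_smul, spatialL_apply, spatialL_apply]
      simp
    rw [this]
    linarith
  have h2 := φ.map_source hp
  rw [htarget] at h1 h2 ⊢
  have h3 : spatial ((S.time p - r₀ / 3) • timeVec + emb (spatial y)) = spatial y := by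
    rw [← spatialL_apply, map_add, map_smul, spatialL_apply, spatialL_apply]
    simp
  have h4 : ((S.time p - r₀ / 3) • timeVec + emb (spatial y) : E4) 0 = S.time p - r₀ / 3 := by simp
  obtain ⟨h5, h6⟩ := h1
  rw [h3] at h6
  rw [h4] at h5
  exact ⟨hJ.out h5 (htime p hp ▸ h2.1) hy0, h6⟩

namespace AdaptedChart

variable (A : AdaptedChart S p ε R)

/-- The point with normalized coordinates `z`. -/
def point (z : ℝ × E3) : E4 :=
  (S.time p - z.1 / S.lapse p) • timeVec + emb (spatial (A.φ p) + z.2)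

/-- The vector that moves the normalized time at unit rate and has spatial part `v`. -/
def lift (S : FoliatedSpacetime M) (p : M) (v : E3) : E4 := (-(1 / S.lapse p)) • timeVec + emb v

@[simp] theorem point_zero (z : ℝ × E3) : A.point z 0 = S.time p - z.1 / S.lapse p := by
  simp [point]

@[simp] theorem spatial_point (z : ℝ × E3) : spatial (A.point z) = spatial (A.φ p) + z.2 := by
  rw [point, ← spatialL_apply, map_add, map_smul, spatialL_apply, spatialL_apply, spatial_timeVec,
    smul_zero, zero_add, spatial_emb]

theorem hasFDerivAt_point (z : ℝ × E3) : HasFDerivAt A.point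
    ((ContinuousLinearMap.fst ℝ ℝ E3).smulRight ((-(1 / S.lapse p)) • timeVec)
      + emb.comp (ContinuousLinearMap.snd ℝ ℝ E3)) z := by
  have h : A.point = fun z : ℝ × E3 ↦ ((ContinuousLinearMap.fst ℝ ℝ E3).smulRight
      ((-(1 / S.lapse p)) • timeVec) + emb.comp (ContinuousLinearMap.snd ℝ ℝ E3)) z
      + (S.time p • timeVec + emb (spatial (A.φ p))) := by
    funext z
    simp only [point, map_add, add_apply, ContinuousLinearMap.smulRight_apply,
      ContinuousLinearMap.coe_fst', ContinuousLinearMap.comp_apply, ContinuousLinearMap.coe_snd',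
      sub_smul, smul_smul]
    have : z.1 * -(1 / S.lapse p) = -(z.1 / S.lapse p) := by ring
    rw [this, neg_smul]
    abel
  rw [h]
  exact (ContinuousLinearMap.hasFDerivAt _).add_const _

theorem contDiff_point {m : WithTop ℕ∞} : ContDiff ℝ m A.point := by
  unfold point
  exact ((contDiff_const.sub (contDiff_fst.div_const _)).smul contDiff_const).add
    (emb.contDiff.comp (contDiff_const.add contDiff_snd))

/-- The spatial part of the covector `G (y, v)`. -/
def covec (z : ℝ × E3) (v : E4) : E3 →L[ℝ] ℝ := (S.g.coordForm A.φ (A.point z) v).comp emb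

theorem contDiffOn_covec (v : E4) :
    ContDiffOn ℝ 2 (fun z ↦ A.covec z v) (A.point ⁻¹' A.φ.target) := by
  have h1 : ContDiffOn ℝ 2 (fun z ↦ S.g.coordForm A.φ (A.point z)) (A.point ⁻¹' A.φ.target) :=
    ((S.g.contDiffOn_coordForm A.mem).of_le ENat.LEInfty.out).comp A.contDiff_point.contDiffOn
      fun _ h ↦ h
  exact (h1.clm_apply contDiffOn_const).clm_comp contDiffOn_const

/-- The field of null cones in adapted coordinates. -/
def cone {T θ : ℝ} (h : ConeParams (S.lapse p) ε R T θ) : ConeField T θ where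
  S z := sharp.comp (ContinuousLinearMap.bilinearComp (S.g.coordForm A.φ (A.point z)) emb emb)
  b z := (1 / S.lapse p) • sharp (A.covec z timeVec)
  a z := S.g.coordForm A.φ (A.point z) timeVec timeVec / S.lapse p ^ 2
  U := A.point ⁻¹' A.φ.target
  isOpen := A.φ.open_target.preimage (A.contDiff_point (m := 0)).continuous
  -- `T ≤ n R` keeps the times in the slab of height `R`, and `3 T < 2 R` keeps the closed ball
  -- inside the open ball of radius `2 R`.
  subset := by
    rintro ⟨t, x⟩ ⟨ht, hx⟩
    have hn := S.lapse_pos p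
    refine A.mem_target _ ?_ ?_
    · rw [point_zero]
      have h1 : t / S.lapse p ≤ R := by
        rw [div_le_iff₀ hn]; linarith [ht.2, h.T_le]
      have h2 : 0 ≤ t / S.lapse p := div_nonneg ht.1 hn.le
      exact ⟨by simp only; linarith, by simp only; linarith⟩
    · rw [spatial_point, add_sub_cancel_left]
      rw [mem_closedBall_zero_iff] at hx
      exact hx.trans_lt h.T_lt
  S_smooth := by
    refine contDiffOn_clm_apply.2 fun v ↦ ?_
    exact sharp.contDiff.comp_contDiffOn
      (A.contDiffOn_covec (emb v))
  b_smooth := (sharp.contDiff.comp_contDiffOn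
      (A.contDiffOn_covec timeVec)).const_smul _
  a_smooth := by
    have h1 : ContDiffOn ℝ 2 (fun z ↦ S.g.coordForm A.φ (A.point z)) (A.point ⁻¹' A.φ.target) :=
      ((S.g.contDiffOn_coordForm A.mem).of_le ENat.LEInfty.out).comp A.contDiff_point.contDiffOn
        fun _ h ↦ h
    exact ((h1.clm_apply contDiffOn_const).clm_apply contDiffOn_const).div_const _
  symm := by
    intro z _ v w
    have h1 : ∀ v w, ⟪sharp.comp (ContinuousLinearMap.bilinearComp
        (S.g.coordForm A.φ (A.point z)) emb emb) v, w⟫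
        = S.g.coordForm A.φ (A.point z) (emb v) (emb w) := fun v w ↦ inner_sharp _ _
    rw [real_inner_comm _ v, h1, h1]
    exact S.g.coordForm_symm _ _ _
  S_near := by
    intro z hz v
    refine norm_le_of_abs_inner_le fun w ↦ ?_
    have h1 := abs_emb_emb_sub_inner_le (A.near _ hz) v w
    have h2 : ⟪sharp.comp (ContinuousLinearMap.bilinearComp
        (S.g.coordForm A.φ (A.point z)) emb emb) v, w⟫
        = S.g.coordForm A.φ (A.point z) (emb v) (emb w) := inner_sharp _ _
    rw [inner_sub_left, h2]
    refine h1.trans ?_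
    have := h.ε_le
    gcongr
  b_near := by
    intro z hz
    refine norm_le_of_abs_inner_le fun w ↦ ?_
    have hn := S.lapse_pos p
    have h1 := abs_timeVec_emb_le (A.near _ hz) w
    rw [real_inner_smul_left, inner_sharp, abs_mul, abs_of_pos (by positivity), one_div,
      inv_mul_le_iff₀ hn]
    refine h1.trans ?_
    calc 2 * ε * ‖w‖ ≤ θ * S.lapse p * ‖w‖ := mul_le_mul_of_nonneg_right h.ε_le₁ (norm_nonneg w)
      _ = _ := by ring
  a_near := by
    intro z hz
    have hn := S.lapse_pos p
    have h1 := abs_timeVec_timeVec_add_le (A.near _ hz)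
    have h2 : S.g.coordForm A.φ (A.point z) timeVec timeVec / S.lapse p ^ 2 + 1
        = (S.g.coordForm A.φ (A.point z) timeVec timeVec + S.lapse p ^ 2) / S.lapse p ^ 2 := by
      field_simp
    rw [h2, abs_div, abs_of_pos (pow_pos hn 2), div_le_iff₀ (pow_pos hn 2)]
    exact h1.trans h.ε_le₂
  θ_nonneg := h.θ_nonneg
  θ_le := h.θ_le
  T_pos := h.T_pos

section Cone

variable {T θ : ℝ} {h : ConeParams (S.lapse p) ε R T θ}

theorem mem_cone_U {z : ℝ × E3} :
    z ∈ (A.cone h).U ↔ A.point z ∈ A.φ.target := Iff.rfl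

theorem cone_Q (z : ℝ × E3) (v : E3) : (A.cone h).Q z v
    = S.g.coordForm A.φ (A.point z) (lift S p v) (lift S p v) := by
  have h1 : ⟪(A.cone h).S z v, v⟫
      = S.g.coordForm A.φ (A.point z) (emb v) (emb v) := inner_sharp _ _
  have h2 : ⟪(A.cone h).b z, v⟫
      = (1 / S.lapse p) * S.g.coordForm A.φ (A.point z) timeVec (emb v) := by
    refine (real_inner_smul_left _ _ _).trans ?_
    rw [inner_sharp]
    rfl
  have h3 := S.g.coordForm_symm (φ := A.φ) (A.point z) (emb v) timeVec
  rw [ConeField.Q, h1, h2, lift]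
  simp only [cone, map_add, map_smul, add_apply, smul_apply, smul_eq_mul, h3]
  ring

theorem inner_cone_mom (z : ℝ × E3) (v w : E3) :
    ⟪(A.cone h).mom z v, w⟫
      = S.g.coordForm A.φ (A.point z) (lift S p v) (emb w) := by
  have h1 : ⟪(A.cone h).S z v, w⟫
      = S.g.coordForm A.φ (A.point z) (emb v) (emb w) := inner_sharp _ _
  have h2 : ⟪(A.cone h).b z, w⟫
      = (1 / S.lapse p) * S.g.coordForm A.φ (A.point z) timeVec (emb w) := by
    refine (real_inner_smul_left _ _ _).trans ?_
    rw [inner_sharp]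
    rfl
  rw [ConeField.mom, inner_sub_left, h1, h2, lift]
  simp only [map_add, map_smul, add_apply, smul_apply, smul_eq_mul]
  ring

theorem inner_cone_force {z : ℝ × E3} (hz : A.point z ∈ A.φ.target) (v w : E3) :
    ⟪(A.cone h).force z v, w⟫
      = 1 / 2 * fderiv ℝ (S.g.coordForm A.φ) (A.point z) (emb w) (lift S p v) (lift S p v) := by
  rw [ConeField.inner_force]
  congr 1
  have h1 : HasFDerivAt (fun y ↦ S.g.inCoord A.φ y (lift S p v) (lift S p v))
      (fderiv ℝ (fun y ↦ S.g.inCoord A.φ y (lift S p v) (lift S p v)) (A.point z)) (A.point z) :=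
    ((((S.g.contDiffAt_coordForm A.mem hz).differentiableAt (by simp)).clm_apply
      (differentiableAt_const _)).clm_apply (differentiableAt_const _)).hasFDerivAt
  have h2 := h1.comp z (A.hasFDerivAt_point z)
  have h3 : (fun z' ↦ (A.cone h).Q z' v)
      = (fun y ↦ S.g.inCoord A.φ y (lift S p v) (lift S p v)) ∘ A.point := by
    funext z'; exact A.cone_Q z' v
  rw [h3, h2.fderiv, ← LorentzMetric.fderiv_inCoord A.mem hz]
  simp

end Cone

end AdaptedChart
end FoliatedSpacetime

/-! ### Null geodesics in adapted coordinates -/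

namespace FoliatedSpacetime

namespace AdaptedChart

variable {M : Type*} [TopologicalSpace M] [ChartedSpace E4 M] [IsManifold 𝓘(ℝ, E4) ∞ M]
  {S : FoliatedSpacetime M} {p : M} {ε R : ℝ} (A : AdaptedChart S p ε R)

theorem hasDerivAt_spatial {γ : ℝ → M} {s : ℝ} {c' : E4} (h : HasDerivAt (A.φ ∘ γ) c' s) :
    HasDerivAt (fun r ↦ spatial (A.φ (γ r)) - spatial (A.φ p)) (spatial c') s :=
  (spatialL.hasFDerivAt.comp_hasDerivAt s h).sub_const _

variable {v : TangentSpace 𝓘(ℝ, E4) p} {γ : ℝ → M} {a b s T θ : ℝ}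

theorem deriv_zero (h : S.IsPastRay p v γ a b) (hs : s ∈ Ioo a b) (hγ : γ s ∈ A.φ.source) :
    deriv (A.φ ∘ γ) s 0 = S.dt (γ s) (velocity γ s) := by
  have h1 := hasDerivAt_chart A.mem (h.isGeodesicOn.mdifferentiableAt hs) hγ
  rw [h1.deriv]
  have h2 := (EuclideanSpace.proj (0 : Fin 4) : E4 →L[ℝ] ℝ).hasFDerivAt.comp_hasDerivAt s h1
  have h3 := hasDerivAt_time (S := S) (h.isGeodesicOn.mdifferentiableAt hs)
  refine h2.unique (h3.congr_of_eventuallyEq ?_)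
  filter_upwards [h.isGeodesicOn.eventually_mem_source hs hγ] with r hr
  exact A.time_eq _ hr

theorem point_eq {q : M} (hq : q ∈ A.φ.source) :
    A.point (S.lapse p * (S.time p - S.time q), spatial (A.φ q) - spatial (A.φ p)) = A.φ q := by
  have hn := (S.lapse_pos p).ne'
  rw [point, mul_div_cancel_left₀ _ hn, sub_sub_cancel, add_sub_cancel, ← A.time_eq q hq,
    smul_timeVec_add_emb]

theorem smul_lift (y : E4) (hy : y 0 ≠ 0) :
    (-(S.lapse p * y 0)) • lift S p ((-(S.lapse p * y 0))⁻¹ • spatial y) = y := by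
  have hn := (S.lapse_pos p).ne'
  have h1 : -(S.lapse p * y 0) ≠ 0 := neg_ne_zero.2 (mul_ne_zero hn hy)
  rw [lift, smul_add, smul_smul, ← map_smul, smul_smul, mul_inv_cancel₀ h1, one_smul]
  have h2 : -(S.lapse p * y 0) * -(1 / S.lapse p) = y 0 := by field_simp
  rw [h2, smul_timeVec_add_emb]

variable [T2Space M] {h : ConeParams (S.lapse p) ε R T θ}

theorem cone_null (hγ : S.IsPastRay p v γ a b) (hs : s ∈ Ioo a b) (hs' : γ s ∈ A.φ.source) :
    (A.cone h).Q (S.lapse p * (S.time p - S.time (γ s)), spatial (A.φ (γ s)) - spatial (A.φ p))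
      ((-(S.lapse p * S.dt (γ s) (velocity γ s)))⁻¹ • spatial (deriv (A.φ ∘ γ) s)) = 0 := by
  have h0 := A.deriv_zero hγ hs hs'
  have hneg := (hγ.isPastNull hs).2
  have h1 := smul_lift (S := S) (p := p) (deriv (A.φ ∘ γ) s) (by rw [h0]; exact hneg.ne)
  rw [h0] at h1
  have h2 : S.g.coordForm A.φ (A.φ (γ s)) (deriv (A.φ ∘ γ) s) (deriv (A.φ ∘ γ) s) = 0 := by
    rw [(hasDerivAt_chart A.mem (hγ.isGeodesicOn.mdifferentiableAt hs) hs').deriv,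
      ← LorentzMetric.val_eq_coordForm A.mem hs']
    exact (hγ.isPastNull hs).1
  rw [A.cone_Q, A.point_eq hs']
  set m := -(S.lapse p * S.dt (γ s) (velocity γ s)) with hm
  have hm0 : m ≠ 0 := neg_ne_zero.2 (mul_ne_zero (S.lapse_pos p).ne' hneg.ne)
  rw [← h1] at h2
  simp only [map_smul, smul_apply, smul_eq_mul] at h2
  have h3 := (mul_eq_zero.1 h2).resolve_left hm0
  exact (mul_eq_zero.1 h3).resolve_left hm0

theorem norm_spatial_deriv_le (h : ConeParams (S.lapse p) ε R T θ) (hγ : S.IsPastRay p v γ a b)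
    (hs : s ∈ Ioo a b) (hs' : γ s ∈ A.φ.source) :
    ‖spatial (deriv (A.φ ∘ γ) s)‖ ≤ 3 / 2 * -(S.lapse p * S.dt (γ s) (velocity γ s)) := by
  have hm : 0 < -(S.lapse p * S.dt (γ s) (velocity γ s)) :=
    neg_pos.2 (mul_neg_of_pos_of_neg (S.lapse_pos p) (hγ.isPastNull hs).2)
  have h1 := ConeField.norm_lt_of_Q_le (D := A.cone h) (A.mem_cone_U.2 (by
    rw [A.point_eq hs']; exact A.φ.map_source hs'))
    (by rw [A.cone_null hγ hs hs']; norm_num)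
  rw [norm_smul, norm_inv, Real.norm_of_nonneg hm.le, inv_mul_lt_iff₀ hm] at h1
  linarith

/-- The coordinate velocity is `m` times the lift of the normalized velocity, so `m • mom` is the
spatial part of the covector of the velocity. The geodesic equation with lowered index, contracted
with spatial vectors, is then the momentum equation. -/
theorem isTrajectory (h : ConeParams (S.lapse p) ε R T θ) (hγ : S.IsPastRay p v γ a b)
    (hs : s ∈ Ico 0 b) (hsrc : ∀ r ∈ Icc 0 s, γ r ∈ A.φ.source)
    (hT : S.lapse p * (S.time p - S.time (γ s)) = T) :
    (A.cone h).IsTrajectory s (fun r ↦ S.lapse p * (S.time p - S.time (γ r)))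
      (fun r ↦ -(S.lapse p * S.dt (γ r) (velocity γ r)))
      (fun r ↦ spatial (A.φ (γ r)) - spatial (A.φ p)) (fun r ↦ spatial (deriv (A.φ ∘ γ) r)) := by
  have hsub : ∀ r ∈ Icc 0 s, r ∈ Ioo a b := fun r hr ↦
    ⟨hγ.zero_mem.1.trans_le hr.1, hr.2.trans_lt hs.2⟩
  have hm : ∀ r ∈ Icc 0 s, 0 < -(S.lapse p * S.dt (γ r) (velocity γ r)) := fun r hr ↦
    neg_pos.2 (mul_neg_of_pos_of_neg (S.lapse_pos p) (hγ.isPastNull (hsub r hr)).2)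
  have hc : ∀ r ∈ Icc 0 s, HasDerivAt (A.φ ∘ γ) (deriv (A.φ ∘ γ) r) r := fun r hr ↦
    ((hγ.isGeodesicOn.contDiffAt_chart A.mem (hsub r hr) (hsrc r hr)).differentiableAt
      (by norm_num)).hasDerivAt
  have hpt : ∀ r ∈ Icc 0 s, A.point (S.lapse p * (S.time p - S.time (γ r)),
      spatial (A.φ (γ r)) - spatial (A.φ p)) = A.φ (γ r) := fun r hr ↦ A.point_eq (hsrc r hr)
  have hlift : ∀ r ∈ Icc 0 s, (-(S.lapse p * S.dt (γ r) (velocity γ r))) • lift S p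
      ((-(S.lapse p * S.dt (γ r) (velocity γ r)))⁻¹ • spatial (deriv (A.φ ∘ γ) r))
        = deriv (A.φ ∘ γ) r := by
    intro r hr
    have h0 := A.deriv_zero hγ (hsub r hr) (hsrc r hr)
    have h1 := smul_lift (S := S) (p := p) (deriv (A.φ ∘ γ) r)
      (by rw [h0]; exact (hγ.isPastNull (hsub r hr)).2.ne)
    rwa [h0] at h1
  refine
    { s_nonneg := hs.1
      τ_zero := by simp [hγ.apply_zero]
      τ_last := hT
      x_zero := by simp [hγ.apply_zero]
      mem := fun r hr ↦ A.mem_cone_U.2 (by rw [hpt r hr]; exact A.φ.map_source (hsrc r hr))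
      τ_deriv := fun r hr ↦ ?_
      m_pos := hm
      x_deriv := fun r hr ↦ (A.hasDerivAt_spatial (hc r hr)).hasDerivWithinAt
      mom_deriv := fun r hr ↦ ?_
      null := fun r hr ↦ A.cone_null hγ (hsub r hr) (hsrc r hr) }
  · have h1 := (hasDerivAt_time (S := S) (hγ.isGeodesicOn.mdifferentiableAt (hsub r hr)))
    have h2 := (h1.const_sub (S.time p)).const_mul (S.lapse p)
    rw [mul_neg] at h2
    exact h2.hasDerivWithinAt
  · have h1 := Lagrange.hasDerivAt_momentum emb ((S.g.contDiffAt_coordForm A.mem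
      (A.φ.map_source (hsrc r hr))).differentiableAt (by simp)) (hc r hr)
      (hγ.isGeodesicOn.hasDerivAt_deriv A.mem (hsub r hr) (hsrc r hr))
    have h2 := (sharp.hasFDerivAt.comp_hasDerivAt r h1).hasDerivWithinAt (s := Icc 0 s)
    have key : ∀ r ∈ Icc 0 s, (-(S.lapse p * S.dt (γ r) (velocity γ r))) • (A.cone h).mom
        (S.lapse p * (S.time p - S.time (γ r)), spatial (A.φ (γ r)) - spatial (A.φ p))
        ((-(S.lapse p * S.dt (γ r) (velocity γ r)))⁻¹ • spatial (deriv (A.φ ∘ γ) r))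
        = sharp ((S.g.coordForm A.φ ((A.φ ∘ γ) r) (deriv (A.φ ∘ γ) r)).comp emb) := by
      intro r hr
      refine ext_inner_right ℝ fun w ↦ ?_
      rw [real_inner_smul_left, A.inner_cone_mom, hpt r hr, inner_sharp]
      have h3 := hlift r hr
      conv_rhs => rw [← h3]
      simp only [ContinuousLinearMap.comp_apply, Function.comp_apply, map_smul, smul_apply,
        smul_eq_mul]
    refine (h2.congr key (key r hr)).congr_deriv ?_
    refine ext_inner_right ℝ fun w ↦ ?_
    have h4 := hγ.isGeodesicOn.chart_eq A.mem (hsub r hr) (hsrc r hr) (emb w)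
    rw [inner_sharp, real_inner_smul_left, A.inner_cone_force (by
      rw [hpt r hr]; exact A.φ.map_source (hsrc r hr)), hpt r hr]
    have h5 := hlift r hr
    set m := -(S.lapse p * S.dt (γ r) (velocity γ r))
    set l := lift S p (m⁻¹ • spatial (deriv (A.φ ∘ γ) r))
    have h6 : ∀ D : E4 →L[ℝ] E4 →L[ℝ] ℝ, D (deriv (A.φ ∘ γ) r) (deriv (A.φ ∘ γ) r)
        = m ^ 2 * D l l := by
      intro D
      rw [← h5]
      simp only [map_smul, smul_apply, smul_eq_mul]
      ring
    rw [h6 (fderiv ℝ (S.g.coordForm A.φ) (A.φ (γ r)) (emb w))] at h4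
    simp only [ContinuousLinearMap.comp_apply, add_apply, Function.comp_apply]
    linarith

/-- A past directed null geodesic from `p` does not leave the adapted coordinates too early. -/
theorem ray_mem_source (h : ConeParams (S.lapse p) ε R T θ) (hγ : S.IsPastRay p v γ a b)
    (hs : s ∈ Ico 0 b) (hT : S.lapse p * (S.time p - S.time (γ s)) = T) :
    ∀ r ∈ Icc 0 s, γ r ∈ A.φ.source := by
  have hsub : ∀ r ∈ Icc 0 s, r ∈ Ioo a b := fun r hr ↦
    ⟨hγ.zero_mem.1.trans_le hr.1, hr.2.trans_lt hs.2⟩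
  -- A compact cone inside the chart. The parameters at which the ray lies in it form a closed set.
  -- From such a parameter the ray stays in the cone for a while longer, because null speeds are at
  -- most `3 / 2 < 2` inside the chart.
  set K : Set (ℝ × E3) := (Icc 0 T ×ˢ Metric.closedBall 0 (3 * T)) ∩ {z | ‖z.2‖ ≤ 2 * z.1} with hK
  have hKc : IsCompact K := (isCompact_Icc.prod (isCompact_closedBall _ _)).inter_right
    (isClosed_le (by fun_prop) (by fun_prop))
  have hKt : MapsTo A.point K A.φ.target := fun z hz ↦ (A.cone h).subset hz.1
  have hKM : IsCompact (A.φ.symm '' (A.point '' K)) :=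
    (hKc.image (A.contDiff_point (m := 0)).continuous).image_of_continuousOn
      (A.φ.continuousOn_symm.mono (image_subset_iff.2 hKt))
  have hKsrc : A.φ.symm '' (A.point '' K) ⊆ A.φ.source := by
    rintro _ ⟨_, ⟨z, hz, rfl⟩, rfl⟩
    exact A.φ.map_target (hKt hz)
  have hmemK : ∀ r ∈ Icc 0 s, γ r ∈ A.φ.source → ‖spatial (A.φ (γ r)) - spatial (A.φ p)‖
      ≤ 2 * (S.lapse p * (S.time p - S.time (γ r))) → γ r ∈ A.φ.symm '' (A.point '' K) := by
    intro r hr hsrc hle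
    have h1 : 0 ≤ S.lapse p * (S.time p - S.time (γ r)) := by
      refine mul_nonneg (S.lapse_pos p).le (sub_nonneg.2 ?_)
      have := hγ.strictAntiOn.antitoneOn hγ.zero_mem (hsub r hr) hr.1
      simpa [hγ.apply_zero] using this
    have h2 : S.lapse p * (S.time p - S.time (γ r)) ≤ T := by
      rw [← hT]
      have := hγ.strictAntiOn.antitoneOn (hsub r hr) (hsub s ⟨hs.1, le_rfl⟩) hr.2
      simp only [Function.comp_apply] at this
      exact mul_le_mul_of_nonneg_left (by linarith) (S.lapse_pos p).le
    have h3 : (S.lapse p * (S.time p - S.time (γ r)),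
        spatial (A.φ (γ r)) - spatial (A.φ p)) ∈ K :=
      ⟨mk_mem_prod ⟨h1, h2⟩ (mem_closedBall_zero_iff.2 (by linarith)), hle⟩
    exact ⟨A.φ (γ r), ⟨_, h3, A.point_eq hsrc⟩, A.φ.left_inv hsrc⟩
  suffices hall : Icc 0 s ⊆ {r | γ r ∈ A.φ.symm '' (A.point '' K)} from fun r hr ↦ hKsrc (hall hr)
  have hcont : ContinuousOn γ (Icc 0 s) := fun r hr ↦
    (hγ.isGeodesicOn r (hsub r hr)).1.continuousAt.continuousWithinAt
  refine IsClosed.Icc_subset_of_forall_exists_gt ?_ ?_ ?_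
  · rw [inter_comm]
    exact hcont.preimage_isClosed_of_isClosed isClosed_Icc hKM.isClosed
  · refine hmemK 0 ⟨le_rfl, hs.1⟩ ?_ ?_
    · rw [hγ.apply_zero]; exact A.mem_source
    · simp [hγ.apply_zero]
  · rintro r ⟨hrK, hr⟩ r' hr'
    have hrI : r ∈ Icc 0 s := Ico_subset_Icc_self hr
    have hrs := hKsrc hrK
    obtain ⟨δ, hδ, hball⟩ := Metric.eventually_nhds_iff_ball.1
      (hγ.isGeodesicOn.eventually_mem_source (hsub r hrI) hrs)
    set r₁ := min (min r' s) (r + δ / 2) with hr₁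
    have h1 : r < r₁ := lt_min (lt_min hr' hr.2) (by linarith)
    have h2 : r₁ ≤ r' := (min_le_left _ _).trans (min_le_left _ _)
    have h3 : r₁ ≤ s := (min_le_left _ _).trans (min_le_right _ _)
    have h4 : r₁ ≤ r + δ / 2 := min_le_right _ _
    have hseg : ∀ q ∈ Icc r r₁, γ q ∈ A.φ.source ∧ q ∈ Icc 0 s := fun q hq ↦
      ⟨hball q (by
          rw [Metric.mem_ball, Real.dist_eq, abs_lt]; constructor <;> linarith [hq.1, hq.2]),
        hr.1.trans hq.1, hq.2.trans h3⟩
    refine ⟨r₁, ?_, h1, h2⟩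
    obtain ⟨hr₁s, hr₁I⟩ := hseg r₁ ⟨h1.le, le_rfl⟩
    refine hmemK r₁ hr₁I hr₁s ?_
    have hstart : ‖spatial (A.φ (γ r)) - spatial (A.φ p)‖
        ≤ 2 * (S.lapse p * (S.time p - S.time (γ r))) := by
      obtain ⟨_, ⟨z, hz, rfl⟩, hzr⟩ := hrK
      have e1 : A.φ (γ r) = A.point z := by rw [← hzr, A.φ.right_inv (hKt hz)]
      have e2 : S.time (γ r) = A.point z 0 := by rw [← A.time_eq _ hrs, e1]
      rw [e1, e2, A.spatial_point, A.point_zero, add_sub_cancel_left, sub_sub_cancel,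
        mul_div_cancel₀ _ (S.lapse_pos p).ne']
      exact hz.2
    have hdiff := norm_sub_le_of_norm_deriv_le h1.le
      (f := fun q ↦ spatial (A.φ (γ q)) - spatial (A.φ p))
      (f' := fun q ↦ spatial (deriv (A.φ ∘ γ) q))
      (B := fun q ↦ 3 / 2 * (S.lapse p * (S.time p - S.time (γ q))))
      (B' := fun q ↦ 3 / 2 * -(S.lapse p * S.dt (γ q) (velocity γ q)))
      (fun q hq ↦ (A.hasDerivAt_spatial ((hγ.isGeodesicOn.contDiffAt_chart A.mem
        (hsub q (hseg q hq).2) (hseg q hq).1).differentiableAt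
          (by norm_num)).hasDerivAt).hasDerivWithinAt)
      (fun q hq ↦ by
        have h1 := hasDerivAt_time (S := S)
          (hγ.isGeodesicOn.mdifferentiableAt (hsub q (hseg q hq).2))
        have h2 := ((h1.const_sub (S.time p)).const_mul (S.lapse p)).const_mul (3 / 2 : ℝ)
        rw [mul_neg] at h2
        exact h2.hasDerivWithinAt)
      (fun q hq ↦ A.norm_spatial_deriv_le h hγ (hsub q (hseg q hq).2) (hseg q hq).1)
    have htri := norm_le_norm_add_norm_sub' (spatial (A.φ (γ r₁)) - spatial (A.φ p))
      (spatial (A.φ (γ r)) - spatial (A.φ p))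
    have hmono := hγ.strictAntiOn.antitoneOn (hsub r hrI) (hsub r₁ hr₁I) h1.le
    simp only [Function.comp_apply] at hmono
    have : S.lapse p * (S.time p - S.time (γ r)) ≤ S.lapse p * (S.time p - S.time (γ r₁)) := by
      have hn := (S.lapse_pos p).le
      gcongr
    linarith

end AdaptedChart
end FoliatedSpacetime

/-! ### Orthonormal frames -/

theorem exists_linearEquiv_inner {V : Type*} [AddCommGroup V] [Module ℝ V] [FiniteDimensional ℝ V]
    {n : ℕ} (hn : Module.finrank ℝ V = n) (B : V →ₗ[ℝ] V →ₗ[ℝ] ℝ) (hsymm : ∀ v w, B v w = B w v)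
    (hpos : ∀ v, v ≠ 0 → 0 < B v v) :
    ∃ e : EuclideanSpace ℝ (Fin n) ≃ₗ[ℝ] V, ∀ a b, B (e a) (e b) = ⟪a, b⟫ := by
  let core : InnerProductSpace.Core ℝ V :=
    { inner := fun v w ↦ B v w
      conj_inner_symm := fun v w ↦ hsymm w v
      re_inner_nonneg := fun v ↦ by
        rcases eq_or_ne v 0 with rfl | hv
        · simp
        · exact (hpos v hv).le
      add_left := fun u v w ↦ by simp
      smul_left := fun u v k ↦ by simp
      definite := fun v hv ↦ by
        by_contra h
        exact (hpos v h).ne' hv }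
  let _ : NormedAddCommGroup V := core.toNormedAddCommGroup
  let _ : InnerProductSpace ℝ V := InnerProductSpace.ofCore core.toCore
  let b := (stdOrthonormalBasis ℝ V).reindex (finCongr hn)
  exact ⟨b.repr.symm.toLinearEquiv, fun x y ↦ b.repr.symm.inner_map_map x y⟩

namespace FoliatedSpacetime

variable {M : Type*} [TopologicalSpace M] [ChartedSpace E4 M]

theorem velocity_eq_zero_of_eventuallyEq {c : ℝ → M} {q : M} {s : ℝ} (h : c =ᶠ[𝓝 s] fun _ ↦ q) :
    velocity c s = 0 := by
  have h1 : mfderiv 𝓘(ℝ, ℝ) 𝓘(ℝ, E4) c s = (0 : ℝ →L[ℝ] E4) := by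
    rw [h.mfderiv_eq, mfderiv_const]; rfl
  unfold velocity
  exact congrArg (fun f : ℝ →L[ℝ] E4 ↦ f 1) h1

theorem mdifferentiableAt_of_velocity_ne_zero {c : ℝ → M} {s : ℝ} (h : velocity c s ≠ 0) :
    MDifferentiableAt 𝓘(ℝ, ℝ) 𝓘(ℝ, E4) c s := by
  by_contra hc
  refine h ?_
  unfold velocity
  rw [mfderiv_zero_of_not_mdifferentiableAt hc]
  rfl

theorem greatCircle_zero {p : M} (w X : TangentSpace 𝓘(ℝ, E4) p) : greatCircle w X 0 = w := by
  simp [greatCircle]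

variable [IsManifold 𝓘(ℝ, E4) ∞ M]
  {S : FoliatedSpacetime M} {p : M} {ε R : ℝ}

/-- The kernel of `dt` has dimension `3` and carries a positive definite metric. An orthonormal
basis identifies the directions at `p` with the Euclidean unit sphere. -/
theorem exists_frame (S : FoliatedSpacetime M) (p : M) :
    ∃ f : E3 →ₗ[ℝ] TangentSpace 𝓘(ℝ, E4) p, (∀ a, S.dt p (f a) = 0) ∧
      (∀ a b, S.g.val p (f a) (f b) = ⟪a, b⟫) ∧ ∀ w, S.dt p w = 0 → ∃ a, f a = w := by
  let L : E4 →ₗ[ℝ] ℝ :=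
    { toFun := fun v ↦ S.dt p v
      map_add' := fun v w ↦ dt_add (S := S) (x := p) v w
      map_smul' := fun k v ↦ dt_smul (S := S) (x := p) k v }
  have hL : LinearMap.range L = ⊤ := by
    refine LinearMap.range_eq_top.2 fun r ↦ ⟨(r * S.lapse p) • (S.T p : E4), ?_⟩
    change S.dt p ((r * S.lapse p) • S.T p) = r
    rw [dt_smul, mul_assoc, S.lapse_mul_dt_T p, mul_one]
  have hdim : Module.finrank ℝ (LinearMap.ker L) = 3 := by
    have h := L.finrank_range_add_finrank_ker
    rw [hL, finrank_top] at h
    simp only [Module.finrank_self, finrank_euclideanSpace, Fintype.card_fin] at h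
    omega
  let B : LinearMap.ker L →ₗ[ℝ] LinearMap.ker L →ₗ[ℝ] ℝ :=
    LinearMap.mk₂ ℝ (fun v w ↦ S.g.val p (v : E4) (w : E4))
      (fun u v w ↦ congrArg (fun f ↦ f (w : E4)) (map_add (S.g.val p) (u : E4) (v : E4)))
      (fun k v w ↦ congrArg (fun f ↦ f (w : E4)) (map_smul (S.g.val p) k (v : E4)))
      (fun u v w ↦ map_add (S.g.val p (u : E4)) (v : E4) (w : E4))
      (fun k v w ↦ map_smul (S.g.val p (v : E4)) k (w : E4))
  obtain ⟨e, he⟩ := exists_linearEquiv_inner hdim B (fun v w ↦ S.g.symm p _ _) (fun v hv ↦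
    S.spacelike p (v : E4) v.2 (fun h ↦ hv (Subtype.ext h)))
  refine ⟨(LinearMap.ker L).subtype ∘ₗ e.toLinearMap, fun a ↦ (e a).2, fun a b ↦ he a b,
    fun w hw ↦ ⟨e.symm ⟨w, hw⟩, congrArg Subtype.val (e.apply_symm_apply ⟨w, hw⟩)⟩⟩

/-! ### The exponential map relative to the time foliation -/

theorem expT_eq_or (S : FoliatedSpacetime M) (p : M) (t : ℝ) (w : TangentSpace 𝓘(ℝ, E4) p) :
    ((∃ s, 0 ≤ s ∧ S.OnRay p w s (S.expT p t w)) ∧ S.time (S.expT p t w) = t) ∨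
      S.expT p t w = p := by
  unfold expT
  split_ifs with h
  · exact Or.inl h.choose_spec
  · exact Or.inr rfl

theorem val_pos_velocity_ne_zero {c : ℝ → M} {s : ℝ}
    (h : 0 < S.g.val (c s) (velocity c s) (velocity c s)) : velocity c s ≠ 0 := by
  intro h0
  rw [h0, map_zero] at h
  exact lt_irrefl _ h

variable {t : ℝ} {w X : TangentSpace 𝓘(ℝ, E4) p}

/-- In `|σ - σ₀| < ε σ` the left side is nonnegative, which alone forces `σ > 0`. -/
theorem AssumptionA2.val_velocity_pos (hε : 0 < ε) (h : S.AssumptionA2 p ε)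
    (ht : t < S.time p) (htl : ((S.time p - t : ℝ) : EReal) < S.ellStar p)
    (hw : w ∈ S.directions p) (hX : X ∈ S.unitTangents p w) :
    0 < S.g.val (S.expT p t (greatCircle w X 0))
      (velocity (fun u ↦ S.expT p t (greatCircle w X u)) 0)
      (velocity (fun u ↦ S.expT p t (greatCircle w X u)) 0) := by
  have h1 := h.1 t ht htl w hw X hX
  exact pos_of_mul_pos_right ((abs_nonneg _).trans_lt h1) hε.le

/-- The exponential map is defined where the metric `σ_t` is close to the round metric. -/
theorem AssumptionA2.expT_spec (hε : 0 < ε) (h : S.AssumptionA2 p ε)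
    (ht : t < S.time p) (htl : ((S.time p - t : ℝ) : EReal) < S.ellStar p)
    (hw : w ∈ S.directions p) (hX : X ∈ S.unitTangents p w) :
    (∃ s, 0 ≤ s ∧ S.OnRay p w s (S.expT p t w)) ∧ S.time (S.expT p t w) = t := by
  -- A nonzero `velocity` implies differentiability, since the default derivative is zero. If the
  -- value were the default `p`, continuity would keep the time away from `t` nearby, so the curve
  -- would be constantly `p` there and its velocity would vanish.
  refine (S.expT_eq_or p t w).resolve_right fun hp ↦ ?_
  have hv := val_pos_velocity_ne_zero (c := fun u ↦ S.expT p t (greatCircle w X u)) (s := 0)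
    (h.val_velocity_pos hε ht htl hw hX)
  have hc := (mdifferentiableAt_of_velocity_ne_zero hv).continuousAt
  refine hv (velocity_eq_zero_of_eventuallyEq (q := p) ?_)
  have h0 : S.time (S.expT p t (greatCircle w X 0)) ≠ t := by
    rw [greatCircle_zero, hp]; exact ht.ne'
  have htime : ContinuousAt (fun u ↦ S.time (S.expT p t (greatCircle w X u))) 0 :=
    S.time_smooth.continuous.continuousAt.comp hc
  filter_upwards [htime.eventually_ne h0] with u hu
  exact (S.expT_eq_or p t _).resolve_left fun h ↦ hu h.2

end FoliatedSpacetime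

/-! ### The spheres `S_t` in adapted coordinates -/

theorem exists_unit_orthogonal (a : E3) : ∃ X : E3, ‖X‖ = 1 ∧ ⟪X, a⟫ = 0 := by
  have hdim : 1 < Module.finrank ℝ E3 := by simp
  have h1 : (ℝ ∙ a)ᗮ ≠ ⊥ := by
    intro h
    have h2 := Submodule.finrank_add_finrank_orthogonal (ℝ ∙ a)
    rw [h, finrank_bot, add_zero] at h2
    have h3 := finrank_span_le_card (R := ℝ) ({a} : Set E3)
    rw [toFinset_singleton, Finset.card_singleton] at h3
    omega
  obtain ⟨X, hX, hX0⟩ := Submodule.exists_mem_ne_zero_of_ne_bot h1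
  refine ⟨‖X‖⁻¹ • X, by
    rw [norm_smul, norm_inv, norm_norm, inv_mul_cancel₀ (norm_ne_zero_iff.2 hX0)], ?_⟩
  rw [real_inner_smul_left, real_inner_comm,
    Submodule.mem_orthogonal_singleton_iff_inner_right.1 hX, mul_zero]

/-- Two unit vectors lie on a great circle. -/
theorem exists_greatCircle {a b : E3} (ha : ‖a‖ = 1) (hb : ‖b‖ = 1) :
    ∃ X : E3, ‖X‖ = 1 ∧ ⟪X, a⟫ = 0 ∧
      b = Real.cos (InnerProductGeometry.angle a b) • a
        + Real.sin (InnerProductGeometry.angle a b) • X := by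
  set α := InnerProductGeometry.angle a b with hα
  have hcos : Real.cos α = ⟪a, b⟫ := by
    rw [hα, InnerProductGeometry.cos_angle, ha, hb]; simp
  have hsin := Real.sin_sq_add_cos_sq α
  have hn : ‖b - Real.cos α • a‖ ^ 2 = Real.sin α ^ 2 := by
    rw [norm_sub_sq_real, norm_smul, real_inner_smul_right, real_inner_comm, ← hcos, ha, hb,
      Real.norm_eq_abs, mul_one, sq_abs]
    linarith
  by_cases hs : Real.sin α = 0
  · obtain ⟨X, hX, hXa⟩ := exists_unit_orthogonal a
    refine ⟨X, hX, hXa, ?_⟩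
    rw [hs, zero_pow two_ne_zero, sq_eq_zero_iff, norm_eq_zero, sub_eq_zero] at hn
    rw [hs, zero_smul, add_zero, hn.symm]
  · refine ⟨(Real.sin α)⁻¹ • (b - Real.cos α • a), ?_, ?_, ?_⟩
    · rw [← sq_eq_sq₀ (norm_nonneg _) zero_le_one, norm_smul, mul_pow, hn, norm_inv, inv_pow,
        Real.norm_eq_abs, sq_abs, inv_mul_cancel₀ (pow_ne_zero 2 hs), one_pow]
    · rw [real_inner_smul_left, inner_sub_left, real_inner_smul_left, real_inner_comm, ← hcos,
        real_inner_self_eq_norm_sq, ha]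
      simp
    · rw [smul_smul, mul_inv_cancel₀ hs, one_smul, add_sub_cancel]

theorem norm_greatCircle {a X : E3} (ha : ‖a‖ = 1) (hX : ‖X‖ = 1) (h : ⟪X, a⟫ = 0) (u : ℝ) :
    ‖Real.cos u • a + Real.sin u • X‖ = 1 := by
  rw [← sq_eq_sq₀ (norm_nonneg _) zero_le_one, norm_add_sq_real, norm_smul, norm_smul, ha, hX,
    real_inner_smul_left, real_inner_smul_right, real_inner_comm, h]
  simp

namespace FoliatedSpacetime

variable {M : Type*} [TopologicalSpace M] [ChartedSpace E4 M]
  [IsManifold 𝓘(ℝ, E4) ∞ M] {S : FoliatedSpacetime M} {p : M} {ε R t T θ : ℝ}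

/-- `S_t`, seen from `p` in adapted coordinates and rescaled to unit size. -/
def AdaptedChart.sphere (A : AdaptedChart S p ε R) (f : E3 →ₗ[ℝ] TangentSpace 𝓘(ℝ, E4) p)
    (t : ℝ) (a : E3) : E3 :=
  (S.lapse p * (S.time p - t))⁻¹ • (spatial (A.φ (S.expT p t (f a))) - spatial (A.φ p))

variable {f : E3 →ₗ[ℝ] TangentSpace 𝓘(ℝ, E4) p}

/-- `f` is an orthonormal frame of the slice through `p`. -/
structure IsFrame (S : FoliatedSpacetime M) (f : E3 →ₗ[ℝ] TangentSpace 𝓘(ℝ, E4) p) : Prop where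
  dt_eq : ∀ a, S.dt p (f a) = 0
  val_eq : ∀ a b, S.g.val p (f a) (f b) = ⟪a, b⟫

theorem IsFrame.mem_directions (hf : IsFrame S f) {a : E3} (ha : ‖a‖ = 1) : f a ∈ S.directions p :=
  ⟨hf.dt_eq a, by rw [hf.val_eq, real_inner_self_eq_norm_sq, ha, one_pow]⟩

theorem IsFrame.mem_unitTangents (hf : IsFrame S f) {a X : E3} (hX : ‖X‖ = 1) (h : ⟪X, a⟫ = 0) :
    f X ∈ S.unitTangents p (f a) :=
  ⟨hf.dt_eq X, by rw [hf.val_eq, h], by rw [hf.val_eq, real_inner_self_eq_norm_sq, hX, one_pow]⟩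

theorem IsFrame.expT_spec (hf : IsFrame S f) (hε : 0 < ε) (h2 : S.AssumptionA2 p ε)
    (ht : t < S.time p) (htl : ((S.time p - t : ℝ) : EReal) < S.ellStar p) {a : E3} (ha : ‖a‖ = 1) :
    (∃ s, 0 ≤ s ∧ S.OnRay p (f a) s (S.expT p t (f a))) ∧ S.time (S.expT p t (f a)) = t := by
  obtain ⟨X, hX, hXa⟩ := exists_unit_orthogonal a
  exact h2.expT_spec hε ht htl (hf.mem_directions ha) (hf.mem_unitTangents hX hXa)

/-- The null geodesic that ends at a given point of `S_t`. -/
theorem IsFrame.exists_ray (hf : IsFrame S f) (hε : 0 < ε) (h2 : S.AssumptionA2 p ε)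
    (ht : t < S.time p) (htl : ((S.time p - t : ℝ) : EReal) < S.ellStar p) {a : E3} (ha : ‖a‖ = 1) :
    ∃ (γ : ℝ → M) (b₁ b₂ s : ℝ), S.IsPastRay p (S.nullVector p (f a)) γ b₁ b₂ ∧ s ∈ Ico 0 b₂ ∧
      γ s = S.expT p t (f a) ∧ S.time (γ s) = t := by
  obtain ⟨⟨s, hs, γ, b₁, b₂, hγ, hsb, heq⟩, htime⟩ := hf.expT_spec hε h2 ht htl ha
  exact ⟨γ, b₁, b₂, s, ⟨nullVector_isPastNull (hf.mem_directions ha), hγ⟩, ⟨hs, hsb.2⟩, heq,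
    by rw [heq, htime]⟩

variable (A : AdaptedChart S p ε R)

theorem AdaptedChart.dt_eq {q : M} (hq : q ∈ A.φ.source) (v : TangentSpace 𝓘(ℝ, E4) q) :
    S.dt q v = (EuclideanSpace.proj (0 : Fin 4) : E4 →L[ℝ] ℝ)
      (mfderiv 𝓘(ℝ, E4) 𝓘(ℝ, E4) A.φ q v) := by
  have h1 : HasMFDerivAt 𝓘(ℝ, E4) 𝓘(ℝ, E4) A.φ q (mfderiv 𝓘(ℝ, E4) 𝓘(ℝ, E4) A.φ q) :=
    ((mdifferentiable_of_mem_maximalAtlas A.mem).mdifferentiableAt hq).hasMFDerivAt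
  have h2 : HasMFDerivAt 𝓘(ℝ, E4) 𝓘(ℝ, ℝ) (EuclideanSpace.proj (0 : Fin 4) : E4 →L[ℝ] ℝ) (A.φ q)
      (EuclideanSpace.proj (0 : Fin 4) : E4 →L[ℝ] ℝ) :=
    (EuclideanSpace.proj (0 : Fin 4) : E4 →L[ℝ] ℝ).hasMFDerivAt
  have h3 := h2.comp q h1
  have h4 : S.time =ᶠ[𝓝 q] (EuclideanSpace.proj (0 : Fin 4) : E4 →L[ℝ] ℝ) ∘ A.φ := by
    filter_upwards [A.φ.open_source.mem_nhds hq] with x hx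
    exact (A.time_eq x hx).symm
  have h5 := (h3.congr_of_eventuallyEq h4).mfderiv
  exact congrArg (fun L : E4 →L[ℝ] ℝ ↦ L v) h5

variable [T2Space M]

theorem AdaptedChart.expT_mem_source (hP : ConeParams (S.lapse p) ε R T θ) (hf : IsFrame S f)
    (hε : 0 < ε) (h2 : S.AssumptionA2 p ε)
    (ht : t < S.time p) (htl : ((S.time p - t : ℝ) : EReal) < S.ellStar p)
    (hT : S.lapse p * (S.time p - t) = T) {a : E3} (ha : ‖a‖ = 1) :
    S.expT p t (f a) ∈ A.φ.source := by
  obtain ⟨γ, b₁, b₂, s, hγ, hs, heq, htime⟩ := hf.exists_ray hε h2 ht htl ha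
  rw [← heq]
  exact A.ray_mem_source hP hγ hs (by rw [htime, hT]) s ⟨hs.1, le_rfl⟩

/-- The curve stays in `Σ_t`, so A3 compares the Euclidean length `r` of its velocity with `σ_t`,
and A2 compares `σ_t` with `T²`. Each comparison costs a factor `1 - θ` on squares, so `(1 - θ) r ≤
T`, and `1 ≤ (1 + 4θ) (1 - θ)`. -/
theorem AdaptedChart.hasDerivAt_sphere (hP : ConeParams (S.lapse p) ε R T θ) (hf : IsFrame S f)
    (hε : 0 < ε) (h2 : S.AssumptionA2 p ε)
    (ht : t < S.time p) (htl : ((S.time p - t : ℝ) : EReal) < S.ellStar p)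
    (hT : S.lapse p * (S.time p - t) = T) {a X : E3} (ha : ‖a‖ = 1) (hX : ‖X‖ = 1)
    (hXa : ⟪X, a⟫ = 0) :
    ∃ y, HasDerivAt (fun u ↦ A.sphere f t (Real.cos u • a + Real.sin u • X)) y 0 ∧
      ‖y‖ ≤ 1 + 4 * θ := by
  set c : ℝ → M := fun u ↦ S.expT p t (greatCircle (f a) (f X) u) with hc
  have hw := hf.mem_directions ha
  have hXt := hf.mem_unitTangents hX hXa
  have hcf : ∀ u, c u = S.expT p t (f (Real.cos u • a + Real.sin u • X)) := fun u ↦ by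
    simp only [hc, greatCircle, map_add, map_smul]
  have hsrc : ∀ u, c u ∈ A.φ.source := fun u ↦ by
    rw [hcf]
    exact A.expT_mem_source hP hf hε h2 ht htl hT (norm_greatCircle ha hX hXa u)
  have htime : ∀ u, S.time (c u) = t := fun u ↦ by
    rw [hcf]
    exact (hf.expT_spec hε h2 ht htl (norm_greatCircle ha hX hXa u)).2
  have hpos : 0 < S.g.val (c 0) (velocity c 0) (velocity c 0) :=
    h2.val_velocity_pos hε ht htl hw hXt
  have hA2 : |S.g.val (c 0) (velocity c 0) (velocity c 0) - (S.lapse p * (S.time p - t)) ^ 2|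
      < ε * S.g.val (c 0) (velocity c 0) (velocity c 0) := h2.1 t ht htl _ hw _ hXt
  have hmd := mdifferentiableAt_of_velocity_ne_zero (val_pos_velocity_ne_zero hpos)
  have hd := hasDerivAt_chart A.mem hmd (hsrc 0)
  rw [LorentzMetric.val_eq_coordForm A.mem (hsrc 0)] at hA2 hpos
  set y : E4 := mfderiv 𝓘(ℝ, E4) 𝓘(ℝ, E4) A.φ (c 0) (velocity c 0) with hy
  have hy0 : y 0 = 0 := by
    have h3 := (EuclideanSpace.proj (0 : Fin 4) : E4 →L[ℝ] ℝ).hasFDerivAt.comp_hasDerivAt 0 hd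
    refine h3.unique ((hasDerivAt_const (0 : ℝ) t).congr_of_eventuallyEq ?_)
    refine Eventually.of_forall fun u ↦ ?_
    exact (A.time_eq _ (hsrc u)).trans (htime u)
  have hye : y = emb (spatial y) := by
    conv_lhs => rw [← smul_timeVec_add_emb y, hy0, zero_smul, zero_add]
  have hTpos := hP.T_pos
  refine ⟨T⁻¹ • spatial y, ?_, ?_⟩
  · have h3 := (A.hasDerivAt_spatial hd).const_smul T⁻¹
    refine h3.congr_of_eventuallyEq (Eventually.of_forall fun u ↦ ?_)
    simp only [sphere, hT, ← hcf]
    rfl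
  · have h4 := abs_emb_emb_sub_inner_le (A.near _ (A.φ.map_source (hsrc 0))) (spatial y) (spatial y)
    rw [hT] at hA2
    generalize hσ : S.g.coordForm A.φ (A.φ (c 0)) y y = σ at hA2 hpos
    rw [← hye, hσ, real_inner_self_eq_norm_sq] at h4
    set r := ‖spatial y‖ with hr
    have hr0 : 0 ≤ r := norm_nonneg _
    have h5 := (abs_le.1 h4).1
    have h6 := (abs_lt.1 hA2).2
    have hθ := hP.ε_le
    have hθ1 := hP.θ_le
    have hθ0 := hP.θ_nonneg
    have h7 : (1 - θ) * r ^ 2 ≤ σ := by nlinarith [sq_nonneg r]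
    have h8 : (1 - θ) * σ ≤ T ^ 2 := by nlinarith
    have h9 : ((1 - θ) * r) ^ 2 ≤ T ^ 2 := by nlinarith
    have h10 : (1 - θ) * r ≤ T := abs_le_of_sq_le_sq' h9 hTpos.le |>.2
    rw [norm_smul, norm_inv, Real.norm_of_nonneg hTpos.le, inv_mul_le_iff₀ hTpos]
    have h11 : r ≤ (1 + 4 * θ) * ((1 - θ) * r) := by nlinarith [mul_nonneg hθ0 hr0]
    nlinarith

/-- The derivative bound is integrated along the great circle arc from `a` to `b`. It is available
at each `u` after rotating the pair `(a, X)` by `u`. -/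
theorem AdaptedChart.norm_sphere_sub_le (hP : ConeParams (S.lapse p) ε R T θ) (hf : IsFrame S f)
    (hε : 0 < ε) (h2 : S.AssumptionA2 p ε)
    (ht : t < S.time p) (htl : ((S.time p - t : ℝ) : EReal) < S.ellStar p)
    (hT : S.lapse p * (S.time p - t) = T) {a b : E3} (ha : ‖a‖ = 1) (hb : ‖b‖ = 1) :
    ‖A.sphere f t a - A.sphere f t b‖ ≤ (1 + 4 * θ) * InnerProductGeometry.angle a b := by
  obtain ⟨X, hX, hXa, hbX⟩ := exists_greatCircle ha hb
  set α := InnerProductGeometry.angle a b with hα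
  set F : ℝ → E3 := fun u ↦ A.sphere f t (Real.cos u • a + Real.sin u • X) with hF
  have hd : ∀ u, ∃ y, HasDerivAt F y u ∧ ‖y‖ ≤ 1 + 4 * θ := by
    intro u
    have hX' : ‖(-Real.sin u) • a + Real.cos u • X‖ = 1 := by
      have := norm_greatCircle ha hX hXa (u + Real.pi / 2)
      rwa [Real.cos_add_pi_div_two, Real.sin_add_pi_div_two] at this
    have hXa' : ⟪(-Real.sin u) • a + Real.cos u • X, Real.cos u • a + Real.sin u • X⟫ = 0 := by
      simp only [inner_add_left, inner_add_right, real_inner_smul_left, real_inner_smul_right,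
        real_inner_self_eq_norm_sq, ha, hX, hXa, real_inner_comm X a]
      ring
    obtain ⟨y, hy, hyn⟩ := A.hasDerivAt_sphere hP hf hε h2 ht htl hT
      (norm_greatCircle ha hX hXa u) hX' hXa'
    refine ⟨y, ?_, hyn⟩
    have h3 : HasDerivAt (fun r ↦ F (u + r)) y 0 := by
      refine hy.congr_of_eventuallyEq (Eventually.of_forall fun r ↦ ?_)
      simp only [hF, Real.cos_add, Real.sin_add]
      congr 1
      module
    have h4 := HasDerivAt.scomp u (g₁ := fun r ↦ F (u + r)) (h := fun r ↦ r - u) (h' := 1)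
      (by simpa using h3) ((hasDerivAt_id u).sub_const u)
    simpa [Function.comp_def] using h4
  choose F' hF' hFn using hd
  have h0 : F 0 = A.sphere f t a := by simp [hF]
  have h1 : F α = A.sphere f t b := by rw [hbX]
  have hle := (convex_univ (𝕜 := ℝ) (E := ℝ)).norm_image_sub_le_of_norm_hasDerivWithin_le
    (f := F) (f' := F') (C := 1 + 4 * θ) (x := α) (y := 0)
    (fun u _ ↦ (hF' u).hasDerivWithinAt) (fun u _ ↦ hFn u) (mem_univ _) (mem_univ _)
  rw [h0, h1, zero_sub, norm_neg,
    Real.norm_of_nonneg (InnerProductGeometry.angle_nonneg _ _)] at hle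
  exact hle

/-- The initial velocity `v₀` found by extremal polygons lifts to a null vector `ξ` at `p` with `dt
ξ = -1/n`, so `ξ + T` is a unit direction. By A2 the ray in this direction reaches `Σ_t`; it is the
trajectory with initial velocity `v₀`, and so it ends at `l • e`. -/
theorem AdaptedChart.exists_sphere_eq (hP : ConeParams (S.lapse p) ε R T θ) (hf : IsFrame S f)
    (hsurj : ∀ w, S.dt p w = 0 → ∃ a, f a = w) (hε : 0 < ε) (h2 : S.AssumptionA2 p ε)
    (ht : t < S.time p) (htl : ((S.time p - t : ℝ) : EReal) < S.ellStar p)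
    (hT : S.lapse p * (S.time p - t) = T) {e : E3} (he : ‖e‖ = 1) :
    ∃ a, ‖a‖ = 1 ∧ ∃ l, 1 - 4 * θ ≤ l ∧ A.sphere f t a = l • e := by
  have hn := S.lapse_pos p
  obtain ⟨l, v₀, hl, hQ, hreach⟩ := (A.cone hP).exists_trajectory_reaching he
  have hpt : A.point (0, 0) = A.φ p := by
    have := A.point_eq A.mem_source
    simpa using this
  rw [A.cone_Q, hpt] at hQ
  obtain ⟨ξ, hξ⟩ := (mdifferentiable_of_mem_maximalAtlas A.mem).mfderiv_surjective A.mem_source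
    (AdaptedChart.lift S p v₀)
  have hξ' : (mfderiv 𝓘(ℝ, E4) 𝓘(ℝ, E4) A.φ p ξ : E4) = AdaptedChart.lift S p v₀ := hξ
  have hlift0 : AdaptedChart.lift S p v₀ 0 = -(1 / S.lapse p) := by simp [AdaptedChart.lift]
  have hlifts : spatial (AdaptedChart.lift S p v₀) = v₀ := by
    rw [AdaptedChart.lift, ← spatialL_apply, map_add, map_smul, spatialL_apply, spatialL_apply,
      spatial_timeVec, smul_zero, zero_add, spatial_emb]
  have hdtξ : S.dt p ξ = -(1 / S.lapse p) := by
    rw [A.dt_eq A.mem_source, hξ']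
    exact hlift0
  have hgξ : S.g.val p ξ ξ = 0 := by
    rw [LorentzMetric.val_eq_coordForm A.mem A.mem_source, hξ', hQ]
  have hdtT : S.dt p (S.T p) = 1 / S.lapse p := by
    rw [lapse, one_div, inv_inv]
  have hw : ξ + S.T p ∈ S.directions p := by
    refine ⟨by rw [dt_add, hdtξ, hdtT]; ring, ?_⟩
    have e1 := val_T (S := S) ξ
    have e2 := val_T_right (S := S) ξ
    simp only [map_add, add_apply, hgξ, e1, e2, S.T_unit, hdtξ]
    field_simp
    ring
  obtain ⟨a, ha⟩ := hsurj _ hw.1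
  have ha1 : ‖a‖ = 1 := by
    have := hf.val_eq a a
    rw [ha, hw.2, real_inner_self_eq_norm_sq] at this
    exact (pow_eq_one_iff_of_nonneg (norm_nonneg a) two_ne_zero).1 this.symm
  refine ⟨a, ha1, T⁻¹ * l, ?_, ?_⟩
  · rw [inv_mul_eq_div, le_div_iff₀ hP.T_pos]
    exact hl
  · obtain ⟨γ, b₁, b₂, s, hγ, hs, heq, htime⟩ := hf.exists_ray hε h2 ht htl ha1
    have hTs : S.lapse p * (S.time p - S.time (γ s)) = T := by rw [htime, hT]
    have hsrc := A.ray_mem_source hP hγ hs hTs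
    have htraj := A.isTrajectory hP hγ hs hsrc hTs
    have hnv : S.nullVector p (f a) = ξ := by rw [ha, nullVector, add_sub_cancel_right]
    have hc0 : deriv (A.φ ∘ γ) 0 = AdaptedChart.lift S p v₀ := by
      rw [(hasDerivAt_chart A.mem (hγ.isGeodesicOn.mdifferentiableAt hγ.zero_mem)
        (hsrc 0 ⟨le_rfl, hs.1⟩)).deriv, ← hξ']
      have h3 := hγ.2.2.2.2
      rw [hnv] at h3
      exact congrArg (fun z : TangentBundle 𝓘(ℝ, E4) M ↦
        (mfderiv 𝓘(ℝ, E4) 𝓘(ℝ, E4) A.φ z.1 z.2 : E4)) h3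
    have hm0 : -(S.lapse p * S.dt (γ 0) (velocity γ 0)) = 1 := by
      rw [← A.deriv_zero hγ hγ.zero_mem (hsrc 0 ⟨le_rfl, hs.1⟩), hc0, hlift0]
      field_simp
    have hx := hreach s _ _ _ _ htraj (by simp only [hm0, one_smul, hc0, hlifts])
    rw [AdaptedChart.sphere, hT, ← heq, hx, smul_smul]

end FoliatedSpacetime

/-! ### Opposite null geodesics -/

namespace FoliatedSpacetime

/-- The summands `3`, `2 N` and `N ^ 2` serve the three conditions on `ε`; the last two conditions
use `1 ≤ n N` to trade powers of `n` for powers of `N`. -/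
theorem coneParams_of_le {N n r d ε θ : ℝ} (hN : 0 < N) (hn : 0 < n) (hnN : 1 ≤ n * N)
    (hε : 0 < ε) (hθ : ε * (3 + 2 * N + N ^ 2) ≤ θ) (hθ' : θ ≤ 1 / 100) (hd : 0 < d)
    (hdr : d ≤ r / 3) (hnd : n * d < 2 * r / 9) : ConeParams n ε (r / 3) (n * d) θ := by
  have h1 : 0 < ε * N := mul_pos hε hN
  have h2 : 0 < ε * N ^ 2 := mul_pos hε (pow_pos hN 2)
  have hsum : ε * (3 + 2 * N + N ^ 2) = 3 * ε + 2 * (ε * N) + ε * N ^ 2 := by ring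
  rw [hsum] at hθ
  refine ⟨mul_pos hn hd, by linarith, mul_le_mul_of_nonneg_left hdr hn.le, by linarith, ?_, ?_,
    by linarith, hθ'⟩
  · calc 2 * ε ≤ 2 * ε * (n * N) := le_mul_of_one_le_right (by linarith) hnN
      _ = 2 * (ε * N) * n := by ring
      _ ≤ θ * n := mul_le_mul_of_nonneg_right (by linarith) hn.le
  · calc ε ≤ ε * (n * N) ^ 2 := le_mul_of_one_le_right hε.le (one_le_pow₀ hnN)
      _ = ε * N ^ 2 * n ^ 2 := by ring
      _ ≤ θ * n ^ 2 := mul_le_mul_of_nonneg_right (by linarith) (pow_pos hn 2).le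

variable {M : Type*} [TopologicalSpace M] [T2Space M] [ChartedSpace E4 M]
  [IsManifold 𝓘(ℝ, E4) ∞ M] {S : FoliatedSpacetime M} {p : M} {ε R θ η ρ : ℝ}
  {γ γ₁ γ₂ : ℝ → M} {a b s a₁ b₁ s₁ a₂ b₂ s₂ : ℝ} {v w : TangentSpace 𝓘(ℝ, E4) p}

/-- A past directed null geodesic meets the level sets just above its endpoint near the endpoint. -/
theorem IsPastRay.exists_time_eq (hγ : S.IsPastRay p v γ a b) (hs : s ∈ Ioo 0 b) {F : M → E3}
    (hF : ContinuousAt F (γ s)) (hρ : 0 < ρ) :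
    ∃ t' > S.time (γ s), ∀ t ∈ Icc (S.time (γ s)) t', ∃ r ∈ Ico 0 b, S.time (γ r) = t ∧
      ‖F (γ r) - F (γ s)‖ < ρ := by
  have hab : ∀ r ∈ Icc 0 s, r ∈ Ioo a b := fun r hr ↦
    ⟨hγ.zero_mem.1.trans_le hr.1, hr.2.trans_lt hs.2⟩
  have hsI : s ∈ Ioo a b := hab s ⟨hs.1.le, le_rfl⟩
  have hcont : ∀ r ∈ Ioo a b, ContinuousAt γ r := fun r hr ↦ (hγ.isGeodesicOn r hr).1.continuousAt
  have hFγ : ContinuousAt (fun r ↦ F (γ r)) s :=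
    ContinuousAt.comp (f := γ) hF (hcont s hsI)
  obtain ⟨δ, hδ, hball⟩ := Metric.continuousAt_iff.1 hFγ ρ hρ
  set s' := max 0 (s - δ / 2) with hs'
  have h1 : s' < s := max_lt hs.1 (by linarith)
  have h2 : 0 ≤ s' := le_max_left _ _
  have h3 : s - δ / 2 ≤ s' := le_max_right _ _
  refine ⟨S.time (γ s'), hγ.strictAntiOn (hab s' ⟨h2, h1.le⟩) hsI h1, fun t ht ↦ ?_⟩
  have htc : ContinuousOn (S.time ∘ γ) (Icc s' s) := fun r hr ↦
    (S.time_smooth.continuous.continuousAt.comp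
      (hcont r (hab r ⟨h2.trans hr.1, hr.2⟩))).continuousWithinAt
  obtain ⟨r, hr, hrt⟩ := intermediate_value_Icc' h1.le htc ht
  refine ⟨r, ⟨h2.trans hr.1, hr.2.trans_lt hs.2⟩, hrt, ?_⟩
  rw [← dist_eq_norm]
  exact hball (by rw [Real.dist_eq, abs_lt]; constructor <;> linarith [hr.1, hr.2])

/-- Opposite null geodesics from `p` do not meet before the time `ℓ_*(p, t)`. -/
theorem AdaptedChart.opposite_rays_disjoint (A : AdaptedChart S p ε R)
    (hsep : ∀ F : E3 → E3, (∀ a b, ‖a‖ = 1 → ‖b‖ = 1 →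
      ‖F a - F b‖ ≤ (1 + η) * InnerProductGeometry.angle a b) →
      (∀ e, ‖e‖ = 1 → ∃ a, ‖a‖ = 1 ∧ ∃ l, 1 - η ≤ l ∧ F a = l • e) →
      ∀ N, ‖N‖ = 1 → 1 / 100 < ‖F N - F (-N)‖)
    (hη : 4 * θ ≤ η) (hε : 0 < ε) (h2 : S.AssumptionA2 p ε)
    (hP : ∀ t ∈ Ico (S.time (γ₁ s₁)) (S.time p),
      ConeParams (S.lapse p) ε R (S.lapse p * (S.time p - t)) θ)
    (hw : w ∈ S.directions p) (hγ₁ : S.IsPastRay p (S.nullVector p w) γ₁ a₁ b₁)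
    (hγ₂ : S.IsPastRay p (S.nullVector p (-w)) γ₂ a₂ b₂) (hs₁ : s₁ ∈ Ico 0 b₁)
    (hs₂ : s₂ ∈ Ico 0 b₂) (heq : γ₁ s₁ = γ₂ s₂) (htime : S.time (γ₁ s₁) < S.time p)
    (hl : ((S.time p - S.time (γ₁ s₁) : ℝ) : EReal) ≤ S.ellStar p) : False := by
  have hn := S.lapse_pos p
  have hs₁0 : 0 < s₁ := lt_of_le_of_ne hs₁.1 (by
    rintro rfl; rw [hγ₁.apply_zero] at htime; exact lt_irrefl _ htime)
  have hs₂0 : 0 < s₂ := lt_of_le_of_ne hs₂.1 (by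
    rintro rfl; rw [heq, hγ₂.apply_zero] at htime; exact lt_irrefl _ htime)
  have hsrc := A.ray_mem_source (hP _ ⟨le_rfl, htime⟩) hγ₁ hs₁ rfl s₁ ⟨hs₁.1, le_rfl⟩
  have hcont : ContinuousAt (fun q ↦ spatial (A.φ q)) (γ₁ s₁) :=
    spatialL.continuous.continuousAt.comp (A.φ.continuousAt hsrc)
  set L := S.time p - S.time (γ₁ s₁) with hL
  have hL0 : 0 < L := sub_pos.2 htime
  -- At the meeting time itself A2 may fail, as `t(p) - t` may equal `ℓ_*`, so the rays are compared
  -- slightly later, where each is within this distance of the meeting point. Since `t ≤ t(p) - L /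
  -- 2`, the scale is at least `n L / 2`, and the rescaled points are at most `4 / 1000 < 1 / 100`
  -- apart.
  have hρ : 0 < S.lapse p * L / 1000 := by positivity
  obtain ⟨t₁, ht₁, hr₁⟩ := hγ₁.exists_time_eq ⟨hs₁0, hs₁.2⟩ hcont hρ
  obtain ⟨t₂, ht₂, hr₂⟩ := hγ₂.exists_time_eq ⟨hs₂0, hs₂.2⟩ (heq ▸ hcont) hρ
  rw [← heq] at ht₂ hr₂
  obtain ⟨t, htq, ht₁', ht₂', htm⟩ : ∃ t, S.time (γ₁ s₁) < t ∧ t ≤ t₁ ∧ t ≤ t₂ ∧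
      t ≤ S.time p - L / 2 :=
    ⟨min (min t₁ t₂) (S.time p - L / 2), lt_min (lt_min ht₁ ht₂) (by linarith),
      (min_le_left _ _).trans (min_le_left _ _), (min_le_left _ _).trans (min_le_right _ _),
      min_le_right _ _⟩
  have htp : t < S.time p := by linarith
  have htl : ((S.time p - t : ℝ) : EReal) < S.ellStar p :=
    lt_of_lt_of_le (EReal.coe_lt_coe_iff.2 (by linarith)) hl
  obtain ⟨r₁, hr₁I, hr₁t, hr₁n⟩ := hr₁ t ⟨htq.le, ht₁'⟩
  obtain ⟨r₂, hr₂I, hr₂t, hr₂n⟩ := hr₂ t ⟨htq.le, ht₂'⟩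
  have hPt := hP t ⟨htq.le, htp⟩
  obtain ⟨f, hf1, hf2, hsurj⟩ := S.exists_frame p
  have hf : IsFrame S f := ⟨hf1, hf2⟩
  obtain ⟨N, hN⟩ := hsurj w hw.1
  have hN1 : ‖N‖ = 1 := by
    have := hf.val_eq N N
    rw [hN, hw.2, real_inner_self_eq_norm_sq] at this
    exact (pow_eq_one_iff_of_nonneg (norm_nonneg N) two_ne_zero).1 this.symm
  -- The point chosen by `expT` lies on the given ray because the time is strictly monotone along
  -- rays.
  have hexp : ∀ {a₀ : E3} {γ : ℝ → M} {a b r : ℝ}, ‖a₀‖ = 1 →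
      S.IsPastRay p (S.nullVector p (f a₀)) γ a b → r ∈ Ico 0 b → S.time (γ r) = t →
      S.expT p t (f a₀) = γ r := by
    intro a₀ γ a b r ha₀ hγ hr hrt
    obtain ⟨γ', c₁, c₂, s, hγ', hs, hs', hst⟩ := hf.exists_ray hε h2 htp htl ha₀
    rw [← hs']
    exact hγ'.eq_of_time_eq hγ hs hr (hst.trans hrt.symm)
  have e1 : S.expT p t (f N) = γ₁ r₁ := hexp hN1 (hN ▸ hγ₁) hr₁I hr₁t
  have e2 : S.expT p t (f (-N)) = γ₂ r₂ :=
    hexp (by rw [norm_neg, hN1]) (by rw [map_neg, hN]; exact hγ₂) hr₂I hr₂t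
  have hfar := hsep (A.sphere f t) (fun a b ha hb ↦
    (A.norm_sphere_sub_le hPt hf hε h2 htp htl rfl ha hb).trans
      (mul_le_mul_of_nonneg_right (by linarith) (InnerProductGeometry.angle_nonneg _ _)))
    (fun e he ↦ by
      obtain ⟨a, ha, l, hl, hal⟩ := A.exists_sphere_eq hPt hf hsurj hε h2 htp htl rfl he
      exact ⟨a, ha, l, by linarith, hal⟩) N hN1
  have hT := hPt.T_pos
  rw [AdaptedChart.sphere, AdaptedChart.sphere, ← smul_sub, sub_sub_sub_cancel_right, e1, e2,
    norm_smul, norm_inv, Real.norm_of_nonneg hT.le, inv_mul_eq_div, lt_div_iff₀ hT] at hfar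
  have htri : ‖spatial (A.φ (γ₁ r₁)) - spatial (A.φ (γ₂ r₂))‖
      ≤ S.lapse p * L / 1000 + S.lapse p * L / 1000 := by
    rw [← sub_sub_sub_cancel_right _ _ (spatial (A.φ (γ₁ s₁)))]
    exact (norm_sub_le _ _).trans (add_le_add hr₁n.le hr₂n.le)
  have hTL : S.lapse p * (L / 2) ≤ S.lapse p * (S.time p - t) :=
    mul_le_mul_of_nonneg_left (by linarith) hn.le
  nlinarith [mul_pos hn hL0]

end FoliatedSpacetime

end

/-! ### The proposition. -/

theorem proposition3p5 (N₀ : ℝ) (hN₀ : 0 < N₀) :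
    ∃ ε₀ : ℝ, 0 < ε₀ ∧ ∃ κ : ℝ, 0 < κ ∧
      ∀ (M : Type*) [TopologicalSpace M] [T2Space M] [SecondCountableTopology M]
        [ChartedSpace E4 M] [IsManifold 𝓘(ℝ, E4) ∞ M]
        (S : FoliatedSpacetime M) (p : M) (ε r₀ δ : ℝ),
        N₀⁻¹ ≤ S.lapse p → S.lapse p ≤ N₀ →
        0 < ε → ε ≤ ε₀ → 0 < r₀ → δ ≤ κ * r₀ →
        S.AssumptionA1 p → S.AssumptionA2 p ε → S.AssumptionA3 p ε r₀ →
        S.ellStar p < (δ : EReal) →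
        ∀ v₁ v₂ : TangentSpace 𝓘(ℝ, E4) p,
          S.IsPastNull p v₁ → S.IsPastNull p v₂ →
          (∃ k : ℝ, 0 < k ∧ S.proj p v₁ = -(k • S.proj p v₂)) →
          ∀ (γ₁ γ₂ : ℝ → M) (a₁ b₁ a₂ b₂ : ℝ),
            S.g.IsGeodesicFrom p v₁ γ₁ a₁ b₁ → S.g.IsGeodesicFrom p v₂ γ₂ a₂ b₂ →
            ∀ s₁ ∈ Set.Ico 0 b₁, ∀ s₂ ∈ Set.Ico 0 b₂, γ₁ s₁ = γ₂ s₂ →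
              ¬ (S.time (γ₁ s₁) < S.time p ∧
                ((S.time p - S.time (γ₁ s₁) : ℝ) : EReal) ≤ S.ellStar p) := by
  obtain ⟨η, hη, hη', hsep⟩ := antipodes_separated
  set C : ℝ := 3 + 2 * N₀ + N₀ ^ 2 with hC
  have hC0 : 0 < C := by positivity
  -- The errors are run with `θ = η / 4`, since both properties of the sphere map lose `4 θ`, and
  -- `ε₀ C = θ`. With `R = r₀ / 3`, the two bounds on `κ` give `δ ≤ R` and `3 N₀ δ ≤ 2 R`, as
  -- `ConeParams` requires.
  refine ⟨η / 4 / C, by positivity, min (1 / 3) (2 / (9 * N₀)), by positivity, ?_⟩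
  intro M _ _ _ _ _ S p ε r₀ δ hn₁ hn₂ hε hε₀ hr₀ hδ _ h2 h3 hl v₁ v₂ hv₁ hv₂ hk γ₁ γ₂ a₁ b₁ a₂ b₂
    hγ₁ hγ₂ s₁ hs₁ s₂ hs₂ heq
  rintro ⟨htime, hle⟩
  obtain ⟨k, hk, hproj⟩ := hk
  obtain ⟨A⟩ := h3.exists_adaptedChart hr₀
  have hn := S.lapse_pos p
  have hN1 : 1 ≤ S.lapse p * N₀ := by
    rwa [inv_le_iff_one_le_mul₀ hN₀] at hn₁
  have hεC : ε * C ≤ η / 4 := by rwa [le_div_iff₀ hC0] at hε₀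
  have hlt : S.time p - S.time (γ₁ s₁) < δ := EReal.coe_lt_coe_iff.1 (hle.trans_lt hl)
  have hκ₁ : δ ≤ r₀ / 3 := hδ.trans (by
    calc _ ≤ 1 / 3 * r₀ := by gcongr; exact min_le_left _ _
      _ = _ := by ring)
  have hκ₂ : N₀ * δ ≤ 2 * r₀ / 9 := by
    calc N₀ * δ ≤ N₀ * (2 / (9 * N₀) * r₀) := by
          gcongr
          exact hδ.trans (by gcongr; exact min_le_right _ _)
      _ = _ := by field_simp
  obtain ⟨hw₁, hv₁'⟩ := hv₁.exists_direction
  obtain ⟨hw₂, hv₂'⟩ := hv₂.exists_direction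
  have hw := FoliatedSpacetime.direction_neg hv₁ hv₂ hk hproj
  set c₁ := S.g.val p v₁ (S.T p) with hc₁
  set c₂ := S.g.val p v₂ (S.T p) with hc₂
  have hc₁0 : 0 < c₁ := hv₁.val_T_pos
  have hc₂0 : 0 < c₂ := hv₂.val_T_pos
  set w := c₁⁻¹ • S.proj p v₁ with hw₁'
  have hw₂' : c₂⁻¹ • S.proj p v₂ = -w := by rw [hw, neg_neg]
  rw [hw₂'] at hw₂ hv₂'
  -- Affine reparametrization turns the initial velocities into the normalized null vectors of `w`
  -- and `-w`; the meeting parameters become `c₁ * s₁` and `c₂ * s₂`.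
  have hg₁ := hγ₁.comp_mul (inv_pos.2 hc₁0)
  have hg₂ := hγ₂.comp_mul (inv_pos.2 hc₂0)
  rw [hv₁', smul_smul, inv_mul_cancel₀ hc₁0.ne', one_smul] at hg₁
  rw [hv₂', smul_smul, inv_mul_cancel₀ hc₂0.ne', one_smul] at hg₂
  have e₁ : c₁⁻¹ * (c₁ * s₁) = s₁ := inv_mul_cancel_left₀ hc₁0.ne' s₁
  have e₂ : c₂⁻¹ * (c₂ * s₂) = s₂ := inv_mul_cancel_left₀ hc₂0.ne' s₂
  refine A.opposite_rays_disjoint (γ₁ := fun r ↦ γ₁ (c₁⁻¹ * r)) (γ₂ := fun r ↦ γ₂ (c₂⁻¹ * r))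
    (s₁ := c₁ * s₁) (s₂ := c₂ * s₂) (θ := η / 4) hsep (by linarith) hε h2 ?_ hw₁
    ⟨FoliatedSpacetime.nullVector_isPastNull hw₁, hg₁⟩
    ⟨FoliatedSpacetime.nullVector_isPastNull hw₂, hg₂⟩ ?_ ?_ ?_ ?_ ?_
  · simp only [e₁]
    intro t ht
    have hd : 0 < S.time p - t := sub_pos.2 ht.2
    have hdδ : S.time p - t < δ := by linarith [ht.1]
    have hnT : S.lapse p * (S.time p - t) < 2 * r₀ / 9 :=
      (mul_le_mul_of_nonneg_right hn₂ hd.le).trans_lt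
        ((mul_lt_mul_of_pos_left hdδ hN₀).trans_le hκ₂)
    exact FoliatedSpacetime.coneParams_of_le hN₀ hn hN1 hε hεC (by linarith) hd (by linarith) hnT
  · exact ⟨mul_nonneg hc₁0.le hs₁.1, by
      rw [div_inv_eq_mul, mul_comm]; exact mul_lt_mul_of_pos_right hs₁.2 hc₁0⟩
  · exact ⟨mul_nonneg hc₂0.le hs₂.1, by
      rw [div_inv_eq_mul, mul_comm]; exact mul_lt_mul_of_pos_right hs₂.2 hc₂0⟩
  · simp only [e₁, e₂, heq]
  · simpa only [e₁] using htime
  · simpa only [e₁] using hle
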